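/- **Setting.** Let $\mathbb F$ be a field of characteristic $0$, let $N\ge 0$ be an integer, and let $I$ be either $\{i\in\mathbb Z\mid i\ge -N\}$ or $\{-N,-N+1,\dots,-1\}$. Let $\mathcal V=\mathcal R_I=\mathbb F\langle u_i^{(n)}\mid i\in I,\ n\ge 0\rangle$ be the free associative unital algebra with the derivation $\partial u_i^{(n)}=u_i^{(n+1)}$, write $u_i=u_i^{(0)}$, and let $L(z)=z^N+\sum_{i\in I}u_iz^{-i-1}\in\mathcal V((z^{-1}))$. *Notation.* For $a(\partial)=\sum_n a_n\partial^n$ put $a(z)=\sum_n a_nz^n$ and let $a^*(\partial)=\sum_n(-\partial)^n a_n$ be the formal adjoint, so that $a^*(-z+\lambda)=\sum_n(z-\lambda-\partial)^na_n$. Here $i_z$ is the expansion for large $|z|$, e.g. $i_z(z-w-\lambda-\partial)^{-1}=\sum_{k\ge0}z^{-k-1}(w+\lambda+\partial)^k$, and powers of $z-\lambda-\partial$, $w+\lambda+\partial$, $w+\lambda$ are expanded in non-negative powers of $\lambda$ and $\partial$. In all the formulas for $H,K,H_m,K_m$ below, $\partial$ acts to the right only, i.e. on the coefficients of the last factor.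 *Double PVAs.* On $\mathcal V\otimes\mathcal V$ let $b(x\otimes y)c=bx\otimes yc$, $(x\otimes y)\star_1 b=xb\otimes y$, $a\star_1(x\otimes y)=x\otimes ay$, $(x\otimes y)^\sigma=y\otimes x$, and let $\partial$ act as a derivation. A 2-fold $\lambda$-bracket on $\mathcal V$ is a bilinear map $(a,b)\mapsto\{\!\{a_\lambda b\}\!\}\in(\mathcal V\otimes\mathcal V)[\lambda]$ with $\{\!\{\partial a_\lambda b\}\!\}=-\lambda\{\!\{a_\lambda b\}\!\}$, $\{\!\{a_\lambda\partial b\}\!\}=(\lambda+\partial)\{\!\{a_\lambda b\}\!\}$, $\{\!\{a_\lambda bc\}\!\}=\{\!\{a_\lambda b\}\!\}c+b\{\!\{a_\lambda c\}\!\}$ and, if $\{\!\{a_\lambda c\}\!\}=\sum_n A_n\lambda^n$ and $\{\!\{b_\lambda c\}\!\}=\sum_n B_n\lambda^n$, $\{\!\{ab_\lambda c\}\!\}=\sum_n A_n\star_1\big((\lambda+\partial)^nb\big)+\sum_n\big((\lambda+\partial)^na\big)\star_1B_n$. It is a double Poisson vertex algebra (double PVA) structure if moreover $\{\!\{a_\lambda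 b\}\!\}=-\{\!\{b_{-\lambda-\partial}a\}\!\}^\sigma$ (with $-\lambda-\partial$ moved to the left, acting on the coefficients) and $$\{\!\{a_\lambda\{\!\{b_\mu c\}\!\}\}\!\}_L-\{\!\{b_\mu\{\!\{a_\lambda c\}\!\}\}\!\}_R=\{\!\{\{\!\{a_\lambda b\}\!\}_{\lambda+\mu}c\}\!\}_L ,$$ where $\{\!\{a_\lambda(x\otimes y)\}\!\}_L=\{\!\{a_\lambda x\}\!\}\otimes y$, $\{\!\{a_\lambda(x\otimes y)\}\!\}_R=x\otimes\{\!\{a_\lambda y\}\!\}$ and $\{\!\{(x\otimes y)_\lambda c\}\!\}_L=\sum_n A_n'\otimes\big((\lambda+\partial)^ny\big)\otimes A_n''$ for $\{\!\{x_\lambda c\}\!\}=\sum_nA_n'\otimes A_n''\lambda^n$. A (commutative) $\lambda$-bracket on a commutative differential algebra, and a Poisson vertex algebra (PVA) structure on it, are as usual: values in $\mathcal A[\lambda]$, sesquilinearity, the left and right Leibniz rules, and for a PVA also skewsymmetry $\{a_\lambda b\}=-\{b_{-\lambda-\partial}a\}$ and the Jacobi identity $\{a_\lambda\{b_\mu c\}\}-\{b_\mu\{a_\lambda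 c\}\}=\{\{a_\lambda b\}_{\lambda+\mu}c\}$. Two (double) PVA structures are compatible if every linear combination of them is again one. *The algebras $\mathcal V_m$.* For $m\ge1$, $\mathcal V_m$ is the commutative algebra generated by symbols $a_{ij}$ ($a\in\mathcal V$, $1\le i,j\le m$), linear in $a$, with relations $(ab)_{ij}=\sum_ka_{ik}b_{kj}$ and $1_{ij}=\delta_{ij}$, and with the derivation $\partial(a_{ij})=(\partial a)_{ij}$. Put $u_{i,ab}=(u_i)_{ab}$ and $L_{ab}(z)=\delta_{ab}z^N+\sum_{i\in I}u_{i,ab}z^{-i-1}$. **Statement.** (1) There are unique 2-fold $\lambda$-brackets $H$ and $K$ on $\mathcal V$ with $$\{\!\{L(z)_\lambda L(w)\}\!\}_H=L(z)\otimes i_z(z-w-\lambda-\partial)^{-1}L(w)-L(w+\lambda+\partial)\otimes i_z(z-w-\lambda-\partial)^{-1}L^*(-z+\lambda),$$ $$\{\!\{L(z)_\lambda L(w)\}\!\}_K=i_z(z-w-\lambda)^{-1}\big(L(z)-L(w+\lambda)\big)\otimes1+1\otimes i_z(z-w-\lambda-\partial)^{-1}\big(L(w)-L^*(-z+\lambda)\big),$$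 and $H$, $K$ are compatible double PVA structures on $\mathcal V$. (2) For every $m\ge1$, $\mathcal V_m$ is the polynomial algebra in the elements $u_{i,ab}^{(n)}=(u_i^{(n)})_{ab}$ ($i\in I$, $n\ge0$, $1\le a,b\le m$), and there are unique $\lambda$-brackets $H_m$ and $K_m$ on $\mathcal V_m$ such that for all $1\le a,b,c,d\le m$ $$\{L_{ab}(z)_\lambda L_{cd}(w)\}_{H_m}=L_{cb}(z)\,i_z(z-w-\lambda-\partial)^{-1}L_{ad}(w)-L_{cb}(w+\lambda+\partial)\,i_z(z-w-\lambda-\partial)^{-1}L_{ad}^*(\lambda-z),$$ $$\{L_{ab}(z)_\lambda L_{cd}(w)\}_{K_m}=\delta_{ad}\,i_z(z-w-\lambda)^{-1}\big(L_{cb}(z)-L_{cb}(w+\lambda)\big)+\delta_{cb}\,i_z(z-w-\lambda-\partial)^{-1}\big(L_{ad}(w)-L_{ad}^*(\lambda-z)\big).$$ They are compatible PVA structures on $\mathcal V_m$, and they are induced by $H$ and $K$ respectively: if $\{\!\{f_\lambda g\}\!\}=\sum_n c_n'\otimes c_n''\lambda^n$ for $f,g\in\mathcal V$, then $\{{f_{ij}}_\lambda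 g_{hk}\}=\sum_n(c_n')_{hj}(c_n'')_{ik}\lambda^n$ for all $1\le i,j,h,k\le m$. -/

import Mathlib

open scoped TensorProduct

noncomputable section

namespace DPVA

/-! ## Polynomials in `λ` with coefficients in a vector space -/

section Poly

variable {F : Type*} [Field F]
variable {M P Q : Type*} [AddCommGroup M] [Module F M] [AddCommGroup P] [Module F P]
  [AddCommGroup Q] [Module F Q]

/-- The space `M[λ]`: the finitely supported `c : ℕ →₀ M` stands for `∑ n, c n λ^n`. -/
abbrev LamPoly (M : Type*) [Zero M] := ℕ →₀ M

/-- The space `M[λ, μ] = (M[λ])[μ]`: the coefficient of `λ^p μ^q` in `c` is `c q p`. -/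
abbrev LamPoly₂ (M : Type*) [Zero M] := LamPoly (LamPoly M)

/-- Coefficientwise extension of linear maps, `f ↦ (∑ c_n λ^n ↦ ∑ f(c_n) λ^n)`. -/
def pmap : (M →ₗ[F] Q) →ₗ[F] (LamPoly M →ₗ[F] LamPoly Q) where
  toFun f := Finsupp.mapRange.linearMap f
  map_add' f g := by ext; simp
  map_smul' c f := by ext; simp

/-- Constant polynomials. -/
def const : M →ₗ[F] LamPoly M := Finsupp.lsingle 0

/-- Multiplication by `λ` on `M[λ]`. -/
def lam : Module.End F (LamPoly M) := Finsupp.lmapDomain M F Nat.succ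

/-- The operator `λ + ∂` on `M[λ]`, where `∂` is a given endomorphism of `M`. -/
def lamAdd (d : Module.End F M) : Module.End F (LamPoly M) := lam + pmap d

/-- `P(λ) = ∑ c_n λ^n ↦ P(-λ-∂) = ∑ (-λ-∂)^n c_n`, with `-λ-∂` moved to the left, so that `∂`
acts on the coefficients. -/
def negSub (d : Module.End F M) : LamPoly M →ₗ[F] LamPoly M :=
  Finsupp.lsum F fun n => ((-(lamAdd d)) ^ n) ∘ₗ (const : M →ₗ[F] LamPoly M)

/-- For a bilinear product `β : M × P → Q` this is the map
`(∑ c_n λ^n, v) ↦ ∑ β(c_n, (λ+∂)^n v)`, with `β` extended linearly to `P[λ]`: the powers of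
`∂` act on the argument `v` only.  It is what the arrow in `{a_{λ+∂} c}_→ β v` means. -/
def arrow (d : Module.End F P) (β : M →ₗ[F] P →ₗ[F] Q) :
    LamPoly M →ₗ[F] P →ₗ[F] LamPoly Q :=
  Finsupp.lsum F fun n =>
    (LinearMap.lcomp F (LamPoly Q) (((lamAdd d) ^ n) ∘ₗ (const : P →ₗ[F] LamPoly P))) ∘ₗ (pmap ∘ₗ β)

/-- Multiplication by `λ` on `M[λ, μ]`. -/
def lam₁ : Module.End F (LamPoly₂ M) := pmap lam

/-- Multiplication by `μ` on `M[λ, μ]`. -/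
def lam₂ : Module.End F (LamPoly₂ M) := lam

/-- The identification of `(M[μ])[λ]` with `(M[λ])[μ] = M[λ, μ]`. -/
def swapVars : LamPoly (LamPoly M) →ₗ[F] LamPoly₂ M :=
  Finsupp.lsum F fun p => pmap (Finsupp.lsingle p : M →ₗ[F] LamPoly M)

/-- The substitution `M[ν] → M[λ, μ]`, `ν = λ + μ`. -/
def substAdd : LamPoly M →ₗ[F] LamPoly₂ M :=
  Finsupp.lsum F fun n =>
    ((lam₁ + lam₂ : Module.End F (LamPoly₂ M)) ^ n) ∘ₗ (const ∘ₗ (const : M →ₗ[F] LamPoly M))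

/-- The map `(∑ h_p λ^p) ↦ ∑ λ^p g(h_p)(λ+μ)`, for a given `g : M → Q[ν]`. -/
def nest (g : M →ₗ[F] LamPoly Q) : LamPoly M →ₗ[F] LamPoly₂ Q :=
  Finsupp.lsum F fun p => ((lam₁ : Module.End F (LamPoly₂ Q)) ^ p) ∘ₗ (substAdd ∘ₗ g)

end Poly

/-! ## Double Poisson vertex algebras -/

/-- A derivation of a not necessarily commutative algebra. -/
structure NCDerivation (F : Type*) [Field F] (A : Type*) [Ring A] [Algebra F A] where
  /-- the underlying linear map -/
  toEnd : Module.End F A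
  leibniz : ∀ a b : A, toEnd (a * b) = toEnd a * b + a * toEnd b

section Double

variable {F : Type*} [Field F] {A : Type*} [Ring A] [Algebra F A]

/-- The action of a derivation on `A ⊗ A`. -/
def tensorD (d : Module.End F A) : Module.End F (A ⊗[F] A) :=
  LinearMap.rTensor A d + LinearMap.lTensor A d

/-- `b ↦ ((x ⊗ y) ↦ b (x ⊗ y) = (b x) ⊗ y)`, the outer left multiplication. -/
def outerL (b : A) : Module.End F (A ⊗[F] A) := LinearMap.rTensor A (LinearMap.mulLeft F b)

/-- `c ↦ ((x ⊗ y) ↦ (x ⊗ y) c = x ⊗ (y c))`, the outer right multiplication. -/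
def outerR (c : A) : Module.End F (A ⊗[F] A) := LinearMap.lTensor A (LinearMap.mulRight F c)

/-- `(x ⊗ y) ⋆₁ b = (x b) ⊗ y`, as a bilinear map of `x ⊗ y` and `b`. -/
def star₁R : A ⊗[F] A →ₗ[F] A →ₗ[F] A ⊗[F] A :=
  TensorProduct.lift (LinearMap.mk₂ F
    (fun x y => ((TensorProduct.mk F A A).flip y) ∘ₗ LinearMap.mulLeft F x)
    (fun _ _ _ => by ext; simp [add_mul])
    (fun _ _ _ => by ext; simp [TensorProduct.smul_tmul'])
    (fun _ _ _ => by ext; simp)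
    (fun _ _ _ => by ext; simp))

/-- `a ⋆₁ (x ⊗ y) = x ⊗ (a y)`, as a bilinear map of `x ⊗ y` and `a`. -/
def star₁L : A ⊗[F] A →ₗ[F] A →ₗ[F] A ⊗[F] A :=
  TensorProduct.lift (LinearMap.mk₂ F
    (fun x y => (TensorProduct.mk F A A x) ∘ₗ LinearMap.mulRight F y)
    (fun _ _ _ => by ext; simp)
    (fun _ _ _ => by ext; simp [TensorProduct.smul_tmul'])
    (fun _ _ _ => by ext; simp [mul_add, TensorProduct.tmul_add])
    (fun _ _ _ => by ext; simp))

/-- `(x ⊗ y) ⊗₁ b = x ⊗ b ⊗ y`, as a bilinear map of `x ⊗ y` and `b`. -/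
def insertMid : A ⊗[F] A →ₗ[F] A →ₗ[F] A ⊗[F] (A ⊗[F] A) :=
  TensorProduct.lift (LinearMap.mk₂ F
    (fun x y => (TensorProduct.mk F A (A ⊗[F] A) x) ∘ₗ ((TensorProduct.mk F A A).flip y))
    (fun _ _ _ => by ext; simp)
    (fun _ _ _ => by ext; simp [TensorProduct.smul_tmul'])
    (fun _ _ _ => by ext; simp [TensorProduct.tmul_add])
    (fun _ _ _ => by ext; simp))

/-- `y ↦ ((x₁ ⊗ x₂) ↦ x₁ ⊗ x₂ ⊗ y)`. -/
def appendR : A →ₗ[F] (A ⊗[F] A →ₗ[F] A ⊗[F] (A ⊗[F] A)) :=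
  ((TensorProduct.assoc F A A A).toLinearMap.compRight F) ∘ₗ
    (TensorProduct.mk F (A ⊗[F] A) A).flip

variable (F A) in
/-- A bilinear map `(a, b) ↦ {{a_λ b}}` with values in `(A ⊗ A)[λ]`. -/
abbrev DoubleBracket := A →ₗ[F] A →ₗ[F] LamPoly (A ⊗[F] A)

/-- `{{a_λ (x ⊗ y)}}_L = {{a_λ x}} ⊗ y`. -/
def brL (B : DoubleBracket F A) (a : A) : A ⊗[F] A →ₗ[F] LamPoly (A ⊗[F] (A ⊗[F] A)) :=
  TensorProduct.lift ((pmap ∘ₗ appendR).flip ∘ₗ B a)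

/-- `{{a_λ (x ⊗ y)}}_R = x ⊗ {{a_λ y}}`. -/
def brR (B : DoubleBracket F A) (a : A) : A ⊗[F] A →ₗ[F] LamPoly (A ⊗[F] (A ⊗[F] A)) :=
  TensorProduct.lift
    ((LinearMap.lcomp F (LamPoly (A ⊗[F] (A ⊗[F] A))) (B a)) ∘ₗ
      (pmap ∘ₗ TensorProduct.mk F A (A ⊗[F] A)))

/-- `{{(x ⊗ y)_λ c}}_L = {{x_{λ+∂} c}}_→ ⊗₁ y`. -/
def brFstL (d : NCDerivation F A) (B : DoubleBracket F A) (c : A) :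
    A ⊗[F] A →ₗ[F] LamPoly (A ⊗[F] (A ⊗[F] A)) :=
  TensorProduct.lift (arrow d.toEnd insertMid ∘ₗ B.flip c)

/-- A 2-fold `λ`-bracket on the differential algebra `(A, ∂)`. -/
structure IsTwoFoldBracket (d : NCDerivation F A) (B : DoubleBracket F A) : Prop where
  /-- `{{∂a_λ b}} = -λ {{a_λ b}}` -/
  sesq_left : ∀ a b, B (d.toEnd a) b = -lam (F := F) (B a b)
  /-- `{{a_λ ∂b}} = (λ+∂) {{a_λ b}}` -/
  sesq_right : ∀ a b, B a (d.toEnd b) = lamAdd (tensorD d.toEnd) (B a b)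
  /-- `{{a_λ bc}} = {{a_λ b}} c + b {{a_λ c}}` -/
  leibniz_left : ∀ a b c,
    B a (b * c) = pmap (F := F) (outerR c) (B a b) + pmap (F := F) (outerL b) (B a c)
  /-- `{{ab_λ c}} = {{a_{λ+∂} c}}_→ ⋆₁ b + (e^{∂ ∂_λ} a) ⋆₁ {{b_λ c}}` -/
  leibniz_right : ∀ a b c,
    B (a * b) c = arrow d.toEnd star₁R (B a c) b + arrow d.toEnd star₁L (B b c) a

/-- A double Poisson vertex algebra structure on the differential algebra `(A, ∂)`. -/
structure IsDoublePVA (d : NCDerivation F A) (B : DoubleBracket F A) : Prop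
    extends IsTwoFoldBracket d B where
  /-- `{{a_λ b}} = -{{b_{-λ-∂} a}}^σ` -/
  skew : ∀ a b,
    B a b = -negSub (tensorD d.toEnd)
      (pmap (TensorProduct.comm F A A).toLinearMap (B b a))
  /-- `{{a_λ {{b_μ c}}}}_L - {{b_μ {{a_λ c}}}}_R = {{{{a_λ b}}_{λ+μ} c}}_L` -/
  jacobi : ∀ a b c,
    pmap (brL B a) (B b c) - swapVars (F := F) (pmap (brR B b) (B a c)) =
      nest (brFstL d B c) (B a b)

/-- Two double PVA structures are compatible if all their linear combinations are double PVA
structures. -/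
def AreCompatibleDoublePVA (d : NCDerivation F A) (H K : DoubleBracket F A) : Prop :=
  IsDoublePVA d H ∧ IsDoublePVA d K ∧ ∀ α β : F, IsDoublePVA d (α • H + β • K)

end Double

/-! ## Poisson vertex algebras -/

section Commutative

variable {F : Type*} [Field F] {A : Type*} [CommRing A] [Algebra F A]

variable (F A) in
/-- A bilinear map `(a, b) ↦ {a_λ b}` with values in `A[λ]`. -/
abbrev LambdaBracket := A →ₗ[F] A →ₗ[F] LamPoly A

/-- A `λ`-bracket on the commutative differential algebra `(A, ∂)`. -/
structure IsLambdaBracket (d : Derivation F A A) (B : LambdaBracket F A) : Prop where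
  /-- `{∂a_λ b} = -λ {a_λ b}` -/
  sesq_left : ∀ a b, B (d a) b = -lam (F := F) (B a b)
  /-- `{a_λ ∂b} = (λ+∂) {a_λ b}` -/
  sesq_right : ∀ a b, B a (d b) = lamAdd d.toLinearMap (B a b)
  /-- `{a_λ bc} = {a_λ b} c + {a_λ c} b` -/
  leibniz_left : ∀ a b c,
    B a (b * c) = pmap (LinearMap.mulRight F c) (B a b) + pmap (LinearMap.mulRight F b) (B a c)
  /-- `{ab_λ c} = {a_{λ+∂} c}_→ b + {b_{λ+∂} c}_→ a` -/
  leibniz_right : ∀ a b c,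
    B (a * b) c = arrow d.toLinearMap (LinearMap.mul F A) (B a c) b
      + arrow d.toLinearMap (LinearMap.mul F A) (B b c) a

/-- A Poisson vertex algebra structure on the commutative differential algebra `(A, ∂)`. -/
structure IsPVA (d : Derivation F A A) (B : LambdaBracket F A) : Prop
    extends IsLambdaBracket d B where
  /-- `{a_λ b} = -{b_{-λ-∂} a}` -/
  skew : ∀ a b, B a b = -negSub d.toLinearMap (B b a)
  /-- `{a_λ {b_μ c}} - {b_μ {a_λ c}} = {{a_λ b}_{λ+μ} c}` -/
  jacobi : ∀ a b c,
    pmap (B a) (B b c) - swapVars (F := F) (pmap (B b) (B a c)) = nest (B.flip c) (B a b)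

/-- Two PVA structures are compatible if all their linear combinations are PVA structures. -/
def AreCompatiblePVA (d : Derivation F A A) (H K : LambdaBracket F A) : Prop :=
  IsPVA d H ∧ IsPVA d K ∧ ∀ α β : F, IsPVA d (α • H + β • K)

end Commutative

/-! ## The algebra `A_m` of functions on `m`-dimensional representations of `A` -/

section Rep

variable (F : Type*) [Field F] (A : Type*) [Ring A] [Algebra F A] (m : ℕ)

open MvPolynomial in
/-- The defining relations of `A_m` among the symbols `a_{ij}`: linearity in `a`,
`(ab)_{ij} = ∑ k, a_{ik} b_{kj}` and `1_{ij} = δ_{ij}`. -/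
inductive RepRel : MvPolynomial (A × Fin m × Fin m) F → Prop
  | smul (k : F) (a : A) (i j : Fin m) : RepRel (X (k • a, i, j) - C k * X (a, i, j))
  | add (a b : A) (i j : Fin m) : RepRel (X (a + b, i, j) - (X (a, i, j) + X (b, i, j)))
  | mul (a b : A) (i j : Fin m) :
      RepRel (X (a * b, i, j) - ∑ k : Fin m, X (a, i, k) * X (b, k, j))
  | one (i j : Fin m) : RepRel (X (1, i, j) - C (if i = j then 1 else 0))

/-- The commutative algebra `A_m` generated by the symbols `a_{ij}`. -/
def RepAlg : Type _ :=
  MvPolynomial (A × Fin m × Fin m) F ⧸ Ideal.span {r | RepRel F A m r}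

instance : CommRing (RepAlg F A m) :=
  inferInstanceAs (CommRing (MvPolynomial (A × Fin m × Fin m) F ⧸ Ideal.span {r | RepRel F A m r}))

instance : Algebra F (RepAlg F A m) :=
  inferInstanceAs
    (Algebra F (MvPolynomial (A × Fin m × Fin m) F ⧸ Ideal.span {r | RepRel F A m r}))

/-- The quotient map from polynomials in the symbols `a_{ij}`. -/
def repMk : MvPolynomial (A × Fin m × Fin m) F →ₐ[F] RepAlg F A m :=
  Ideal.Quotient.mkₐ F (Ideal.span {r | RepRel F A m r})

variable {F A m}

theorem repMk_surjective : Function.Surjective (repMk F A m) :=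
  Ideal.Quotient.mkₐ_surjective F _

theorem repMk_eq_zero_iff (x : MvPolynomial (A × Fin m × Fin m) F) :
    repMk F A m x = 0 ↔ x ∈ Ideal.span {r | RepRel F A m r} :=
  Ideal.Quotient.eq_zero_iff_mem

theorem repMk_rel {x : MvPolynomial (A × Fin m × Fin m) F} (h : RepRel F A m x) :
    repMk F A m x = 0 :=
  (repMk_eq_zero_iff x).2 (Ideal.subset_span h)

/-- The element `a_{ij}` of `A_m`, as a linear function of `a`. -/
def coord (i j : Fin m) : A →ₗ[F] RepAlg F A m where
  toFun a := repMk F A m (MvPolynomial.X (a, i, j))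
  map_add' a b := by
    have h := repMk_rel (RepRel.add (F := F) a b i j)
    rw [map_sub, sub_eq_zero] at h
    rw [h, map_add]
  map_smul' k a := by
    have h := repMk_rel (RepRel.smul (F := F) k a i j)
    rw [map_sub, sub_eq_zero] at h
    rw [h, ← MvPolynomial.smul_eq_C_mul, map_smul]
    rfl

theorem coord_mul (a b : A) (i j : Fin m) :
    coord (F := F) i j (a * b) = ∑ k : Fin m, coord (F := F) i k a * coord (F := F) k j b := by
  have h := repMk_rel (RepRel.mul (F := F) a b i j)
  rw [map_sub, sub_eq_zero, map_sum] at h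
  simpa [coord] using h

theorem coord_one (i j : Fin m) :
    coord (F := F) (A := A) i j 1 = if i = j then 1 else 0 := by
  have h := repMk_rel (RepRel.one (F := F) (A := A) i j)
  rw [map_sub, sub_eq_zero] at h
  change repMk F A m _ = _
  rw [h]
  split_ifs <;> simp

theorem NCDerivation.map_one (d : NCDerivation F A) : d.toEnd 1 = 0 := by
  have h := d.leibniz 1 1
  simpa using h

/-- The derivation `∂(X_{a,i,j}) = X_{∂a,i,j}` of the polynomial algebra in the symbols. -/
def repPreD (d : NCDerivation F A) :
    Derivation F (MvPolynomial (A × Fin m × Fin m) F) (MvPolynomial (A × Fin m × Fin m) F) :=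
  MvPolynomial.mkDerivation F fun x => MvPolynomial.X (d.toEnd x.1, x.2.1, x.2.2)

theorem repPreD_rel (d : NCDerivation F A) {x : MvPolynomial (A × Fin m × Fin m) F}
    (h : RepRel F A m x) : repMk F A m (repPreD d x) = 0 := by
  have key : ∀ (a : A) (i j : Fin m),
      repMk F A m (MvPolynomial.X (a, i, j)) = coord (F := F) i j a := fun _ _ _ => rfl
  cases h with
  | smul k a i j => simp [repPreD, key, ← MvPolynomial.smul_eq_C_mul]
  | add a b i j => simp [repPreD, key]
  | mul a b i j =>
    simp only [repPreD, map_sub, map_sum, Derivation.leibniz, MvPolynomial.mkDerivation_X,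
      d.leibniz, map_add, key, coord_mul, smul_eq_mul, map_mul]
    rw [sub_eq_zero, ← Finset.sum_add_distrib]
    exact Finset.sum_congr rfl fun k _ => by ring
  | one i j =>
    rw [map_sub, map_sub, repPreD, MvPolynomial.mkDerivation_X, MvPolynomial.derivation_C, key,
      d.map_one]
    simp

theorem repPreD_mem (d : NCDerivation F A) (x : MvPolynomial (A × Fin m × Fin m) F)
    (hx : repMk F A m x = 0) : repMk F A m (repPreD d x) = 0 := by
  rw [repMk_eq_zero_iff] at hx
  induction hx using Submodule.span_induction with
  | mem x h => exact repPreD_rel d h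
  | zero => simp
  | add x y _ _ hx hy => simp [hx, hy]
  | smul r x h hx =>
    have h0 : repMk F A m x = 0 := (repMk_eq_zero_iff x).2 h
    simp [hx, h0]

/-- The derivation of `A_m` with `∂(a_{ij}) = (∂a)_{ij}`. -/
def repD (d : NCDerivation F A) : Derivation F (RepAlg F A m) (RepAlg F A m) :=
  Derivation.liftOfSurjective (f := repMk F A m) repMk_surjective (repPreD_mem d)

theorem repD_coord (d : NCDerivation F A) (i j : Fin m) (a : A) :
    repD d (coord (F := F) i j a) = coord (F := F) i j (d.toEnd a) := by
  change repD d (repMk F A m (MvPolynomial.X (a, i, j))) = _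
  rw [repD, Derivation.liftOfSurjective_apply]
  simp [repPreD, coord]

/-- The linear map `x ⊗ y ↦ x_{hj} y_{ik}`. -/
def inducedMap (i j h k : Fin m) : A ⊗[F] A →ₗ[F] RepAlg F A m :=
  TensorProduct.lift
    ((LinearMap.mul F (RepAlg F A m)).compl₁₂ (coord (F := F) h j) (coord (F := F) i k))

/-- `Bm` is induced by the 2-fold bracket `B`: if `{{a_λ b}} = ∑ c_n' ⊗ c_n'' λ^n`, then
`{a_{ij} _λ b_{hk}} = ∑ (c_n')_{hj} (c_n'')_{ik} λ^n`. -/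
def IsInduced (B : DoubleBracket F A) (Bm : LambdaBracket F (RepAlg F A m)) : Prop :=
  ∀ (a b : A) (i j h k : Fin m),
    Bm (coord (F := F) i j a) (coord (F := F) h k b) = pmap (inducedMap i j h k) (B a b)

end Rep

/-! ## Generating series -/

section Series

variable {F : Type*} [Field F]
variable {M P Q : Type*} [AddCommGroup M] [Module F M] [AddCommGroup P] [Module F P]
  [AddCommGroup Q] [Module F Q]

/-- The coefficient of `z^k` in `i_z (z + T)^n = ∑_{l ≥ 0} C(n, l) z^{n-l} T^l`, for an
endomorphism `T` and `n ∈ ℤ`. -/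
def powCoeff (T : Module.End F M) (n k : ℤ) : Module.End F M :=
  if k ≤ n then Ring.choose n (n - k).toNat • T ^ (n - k).toNat else 0

/-- The coefficient of `z^i w^j` in
`i_z (z - w - T)^{-1} = ∑_{k ≥ 0} z^{-k-1} (w + T)^k`, for an endomorphism `T`. -/
def cauchyCoeff (T : Module.End F M) (i j : ℤ) : Module.End F M :=
  if i < 0 then powCoeff T (-i - 1) j else 0

/-! In what follows a series `a(z) = ∑ a_n z^n` is given by its coefficients `a : ℤ → P`, and
`a_n = 0` for all large `n`.  All sums below then have only finitely many nonzero terms. -/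

/-- The coefficient of `z^i` in `a*(-z+λ)`, where `a*(∂) = ∑ (-∂)^n ∘ a_n` is the formal adjoint
of `a(∂) = ∑ a_n ∂^n`; so `a*(-z+λ) = ∑ i_z (z-λ-∂)^n a_n`. -/
def adjCoeff (d : Module.End F P) (a : ℤ → P) (i : ℤ) : LamPoly P :=
  ∑ᶠ n : ℤ, powCoeff (-(lamAdd d)) n i (const (F := F) (a n))

/-- The coefficient of `w^j` in `a(w+λ)`. -/
def shiftCoeff (F : Type*) [Field F] [Module F P] (a : ℤ → P) (j : ℤ) : LamPoly P :=
  ∑ᶠ n : ℤ, powCoeff (lam : Module.End F (LamPoly P)) n j (const (F := F) (a n))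

/-- The coefficient of `z^p w^q` in `i_z (z-w-λ-∂)^{-1} b(w)`. -/
def cauchyMul (d : Module.End F P) (b : ℤ → P) (p q : ℤ) : LamPoly P :=
  ∑ᶠ j : ℤ, cauchyCoeff (lamAdd d) p j (const (F := F) (b (q - j)))

/-- The coefficient of `z^p w^q` in `i_z (z-w-λ-∂)^{-1} b*(-z+λ)`. -/
def cauchyAdj (d : Module.End F P) (b : ℤ → P) (p q : ℤ) : LamPoly P :=
  ∑ᶠ i : ℤ, cauchyCoeff (lamAdd d) i q (adjCoeff d b (p - i))

/-- The coefficient of `z^p w^q` in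
`a(z) · i_z (z-w-λ-∂)^{-1} b(w) - a(w+λ+∂) · i_z (z-w-λ-∂)^{-1} b*(-z+λ)`,
where `·` is a given bilinear product and `∂` acts on its right factor only. -/
def hCoeff (d : Module.End F P) (β : M →ₗ[F] P →ₗ[F] Q) (a : ℤ → M) (b : ℤ → P) (p q : ℤ) :
    LamPoly Q :=
  (∑ᶠ n : ℤ, pmap (β (a n)) (cauchyMul d b (p - n) q))
    - ∑ᶠ n : ℤ, pmap (β (a n)) (∑ᶠ j : ℤ, powCoeff (lamAdd d) n j (cauchyAdj d b p (q - j)))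

/-- The coefficient of `z^p w^q` in `i_z (z-w-λ)^{-1} (a(z) - a(w+λ))`. -/
def kCoeff₁ (F : Type*) [Field F] [Module F P] (a : ℤ → P) (p q : ℤ) : LamPoly P :=
  (∑ᶠ i : ℤ, cauchyCoeff (lam : Module.End F (LamPoly P)) i q (const (F := F) (a (p - i))))
    - ∑ᶠ j : ℤ, cauchyCoeff (lam : Module.End F (LamPoly P)) p j (shiftCoeff F a (q - j))

/-- The coefficient of `z^p w^q` in `i_z (z-w-λ-∂)^{-1} (a(w) - a*(-z+λ))`. -/
def kCoeff₂ (d : Module.End F P) (a : ℤ → P) (p q : ℤ) : LamPoly P :=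
  cauchyMul d a p q - cauchyAdj d a p q

/-! The sums above are finite. -/

theorem powCoeff_eq_zero_of_lt (T : Module.End F M) {n k : ℤ} (h : n < k) :
    powCoeff T n k = 0 := if_neg (not_le.2 h)

theorem cauchyCoeff_eq_zero (T : Module.End F M) {i j : ℤ} (h : j ∉ Set.Icc 0 (-i - 1)) :
    cauchyCoeff T i j = 0 := by
  unfold cauchyCoeff
  split_ifs with hi
  · by_cases hj : j ≤ -i - 1
    · have hj0 : j < 0 := by
        by_contra hc
        exact h ⟨not_lt.1 hc, hj⟩
      obtain ⟨n, hn⟩ : ∃ n : ℕ, -i - 1 = (n : ℤ) := ⟨(-i - 1).toNat, by omega⟩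
      rw [hn, powCoeff, if_pos (by omega), Ring.choose_natCast,
        Nat.choose_eq_zero_of_lt (by omega)]
      simp
    · exact powCoeff_eq_zero_of_lt T (not_le.1 hj)
  · rfl

variable {N : ℤ}

theorem adjCoeff_finite (d : Module.End F P) {a : ℤ → P} (ha : ∀ n, N < n → a n = 0) (i : ℤ) :
    (Function.support fun n : ℤ =>
      powCoeff (-(lamAdd d)) n i (const (F := F) (a n))).Finite := by
  refine (Set.finite_Icc i N).subset fun n hn => ?_
  by_contra hc
  apply hn
  rw [Set.mem_Icc, not_and_or, not_le, not_le] at hc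
  rcases hc with h | h
  · simp [powCoeff_eq_zero_of_lt _ h]
  · simp [ha n h]

theorem adjCoeff_eq_zero (d : Module.End F P) {a : ℤ → P} (ha : ∀ n, N < n → a n = 0) {i : ℤ}
    (hi : N < i) : adjCoeff d a i = 0 := by
  refine finsum_eq_zero_of_forall_eq_zero fun n => ?_
  rcases lt_or_ge n i with h | h
  · simp [powCoeff_eq_zero_of_lt _ h]
  · simp [ha n (lt_of_lt_of_le hi h)]

theorem shiftCoeff_finite {a : ℤ → P} (ha : ∀ n, N < n → a n = 0) (j : ℤ) :
    (Function.support fun n : ℤ =>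
      powCoeff (lam : Module.End F (LamPoly P)) n j (const (F := F) (a n))).Finite := by
  refine (Set.finite_Icc j N).subset fun n hn => ?_
  by_contra hc
  apply hn
  rw [Set.mem_Icc, not_and_or, not_le, not_le] at hc
  rcases hc with h | h
  · simp [powCoeff_eq_zero_of_lt _ h]
  · simp [ha n h]

theorem cauchyCoeff_right_finite (T : Module.End F M) (p : ℤ) (f : ℤ → M) :
    (Function.support fun j : ℤ => cauchyCoeff T p j (f j)).Finite := by
  refine (Set.finite_Icc 0 (-p - 1)).subset fun j hj => ?_
  by_contra hc
  apply hj
  simp [cauchyCoeff_eq_zero T hc]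

theorem cauchyCoeff_left_finite (T : Module.End F M) (p q : ℤ) {f : ℤ → M}
    (hf : ∀ n, N < n → f n = 0) :
    (Function.support fun i : ℤ => cauchyCoeff T i q (f (p - i))).Finite := by
  refine (Set.finite_Icc (p - N) (-1)).subset fun i hi => ?_
  by_contra hc
  apply hi
  rw [Set.mem_Icc, not_and_or, not_le, not_le] at hc
  rcases hc with h | h
  · simp [hf (p - i) (by omega)]
  · have h' : ¬ i < 0 := by omega
    simp [cauchyCoeff, h']

theorem cauchyMul_eq_zero (d : Module.End F P) (b : ℤ → P) {p : ℤ} (hp : 0 ≤ p) (q : ℤ) :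
    cauchyMul d b p q = 0 :=
  finsum_eq_zero_of_forall_eq_zero fun j => by simp [cauchyCoeff, not_lt.2 hp]

theorem cauchyAdj_eq_zero (d : Module.End F P) {b : ℤ → P} (hb : ∀ n, N < n → b n = 0) {p q : ℤ}
    (hq : q ∉ Set.Icc 0 (N - p - 1)) : cauchyAdj d b p q = 0 := by
  refine finsum_eq_zero_of_forall_eq_zero fun i => ?_
  by_cases h : q ∈ Set.Icc 0 (-i - 1)
  · have hi : N < p - i := by
      by_contra hc
      exact hq ⟨h.1, le_trans h.2 (by omega)⟩
    simp [adjCoeff_eq_zero d hb hi]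
  · simp [cauchyCoeff_eq_zero _ h]

theorem hCoeff_fst_finite (d : Module.End F P) (β : M →ₗ[F] P →ₗ[F] Q) {a : ℤ → M}
    (ha : ∀ n, N < n → a n = 0) (b : ℤ → P) (p q : ℤ) :
    (Function.support fun n : ℤ => pmap (β (a n)) (cauchyMul d b (p - n) q)).Finite := by
  refine (Set.finite_Icc p N).subset fun n hn => ?_
  by_contra hc
  apply hn
  rw [Set.mem_Icc, not_and_or, not_le, not_le] at hc
  rcases hc with h | h
  · simp [cauchyMul_eq_zero d b (p := p - n) (by omega)]
  · simp [ha n h]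

theorem hCoeff_inner_finite (d : Module.End F P) {b : ℤ → P} (hb : ∀ n, N < n → b n = 0)
    (n p q : ℤ) :
    (Function.support fun j : ℤ =>
      powCoeff (lamAdd d) n j (cauchyAdj d b p (q - j))).Finite := by
  refine (Set.finite_Icc (q - (N - p - 1)) q).subset fun j hj => ?_
  by_contra hc
  apply hj
  have h : q - j ∉ Set.Icc 0 (N - p - 1) := by
    simp only [Set.mem_Icc] at hc ⊢
    omega
  simp [cauchyAdj_eq_zero d hb h]

theorem hCoeff_snd_finite (d : Module.End F P) (β : M →ₗ[F] P →ₗ[F] Q) {a : ℤ → M}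
    (ha : ∀ n, N < n → a n = 0) {b : ℤ → P} (hb : ∀ n, N < n → b n = 0) (p q : ℤ) :
    (Function.support fun n : ℤ =>
      pmap (β (a n))
        (∑ᶠ j : ℤ, powCoeff (lamAdd d) n j (cauchyAdj d b p (q - j)))).Finite := by
  refine (Set.finite_Icc (q - (N - p - 1)) N).subset fun n hn => ?_
  by_contra hc
  apply hn
  rw [Set.mem_Icc, not_and_or, not_le, not_le] at hc
  rcases hc with h | h
  · have h0 : (∑ᶠ j : ℤ, powCoeff (lamAdd d) n j (cauchyAdj d b p (q - j))) = 0 := by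
      refine finsum_eq_zero_of_forall_eq_zero fun j => ?_
      rcases lt_or_ge n j with hj | hj
      · simp [powCoeff_eq_zero_of_lt _ hj]
      · have h' : q - j ∉ Set.Icc 0 (N - p - 1) := by
          simp only [Set.mem_Icc]
          omega
        simp [cauchyAdj_eq_zero d hb h']
    simp only [h0, map_zero]
  · simp [ha n h]

end Series

/-! ## Noncommutative differential polynomials and the generic operator `L` -/

section Generic

variable (F : Type*) [Field F] (S : Set ℤ)

/-- The algebra `R_I = F⟨u_i^{(n)} | i ∈ I, n ≥ 0⟩`, for `I = S ⊆ ℤ`; the generator `u_i^{(n)}`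
is `FreeAlgebra.ι F (i, n)`. -/
abbrev DiffPoly := FreeAlgebra F (S × ℕ)

/-- The algebra map `f ↦ f + ε ∂f`, `ε² = 0`, determined by `u_i^{(n)} ↦ u_i^{(n)} +
ε u_i^{(n+1)}`. -/
def diffHom : DiffPoly F S →ₐ[F] TrivSqZeroExt (DiffPoly F S) (DiffPoly F S) :=
  FreeAlgebra.lift F fun x =>
    TrivSqZeroExt.inl (FreeAlgebra.ι F x) + TrivSqZeroExt.inr (FreeAlgebra.ι F (x.1, x.2 + 1))

theorem diffHom_fst (f : DiffPoly F S) : (diffHom F S f).fst = f := by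
  have h : (TrivSqZeroExt.fstHom F (DiffPoly F S) (DiffPoly F S)).comp (diffHom F S) =
      AlgHom.id F (DiffPoly F S) := by
    ext x
    simp [diffHom]
  exact DFunLike.congr_fun h f

/-- The derivation of `R_I` with `∂ u_i^{(n)} = u_i^{(n+1)}`. -/
def diffD : NCDerivation F (DiffPoly F S) where
  toEnd :=
    { toFun := fun f => (diffHom F S f).snd
      map_add' := fun f g => by simp
      map_smul' := fun c f => by simp }
  leibniz f g := by
    simp [diffHom_fst, add_comm]

theorem diffD_ι (i : S) (n : ℕ) :
    (diffD F S).toEnd (FreeAlgebra.ι F (i, n)) = FreeAlgebra.ι F (i, n + 1) := by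
  simp [diffD, diffHom]

variable (N : ℕ)

open Classical in
/-- The coefficients of `L(z) = z^N + ∑_{i ∈ I} u_i z^{-i-1}`. -/
def Lc (n : ℤ) : DiffPoly F S :=
  if n = N then 1 else if h : -n - 1 ∈ S then FreeAlgebra.ι F (⟨-n - 1, h⟩, 0) else 0

open Classical in
/-- The coefficients of `L_{ab}(z) = δ_{ab} z^N + ∑_{i ∈ I} u_{i,ab} z^{-i-1}`, where
`u_{i,ab} = (u_i)_{ab}`. -/
def Lmc (m : ℕ) (a b : Fin m) (n : ℤ) : RepAlg F (DiffPoly F S) m :=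
  if n = N then (if a = b then 1 else 0)
  else if h : -n - 1 ∈ S then coord (F := F) a b (FreeAlgebra.ι F (⟨-n - 1, h⟩, 0)) else 0

/-- The bracket `B` on `R_I` satisfies
`{{L(z)_λ L(w)}} = L(z) ⊗ i_z(z-w-λ-∂)^{-1} L(w) - L(w+λ+∂) ⊗ i_z(z-w-λ-∂)^{-1} L*(-z+λ)`. -/
def IsH (B : DoubleBracket F (DiffPoly F S)) : Prop :=
  ∀ p q : ℤ, B (Lc F S N p) (Lc F S N q) =
    hCoeff (diffD F S).toEnd (TensorProduct.mk F (DiffPoly F S) (DiffPoly F S))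
      (Lc F S N) (Lc F S N) p q

/-- The bracket `B` on `R_I` satisfies
`{{L(z)_λ L(w)}} = i_z(z-w-λ)^{-1} (L(z) - L(w+λ)) ⊗ 1 +
1 ⊗ i_z(z-w-λ-∂)^{-1} (L(w) - L*(-z+λ))`. -/
def IsK (B : DoubleBracket F (DiffPoly F S)) : Prop :=
  ∀ p q : ℤ, B (Lc F S N p) (Lc F S N q) =
    pmap ((TensorProduct.mk F (DiffPoly F S) (DiffPoly F S)).flip 1) (kCoeff₁ F (Lc F S N) p q)
      + pmap (TensorProduct.mk F (DiffPoly F S) (DiffPoly F S) 1)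
          (kCoeff₂ (diffD F S).toEnd (Lc F S N) p q)

/-- The bracket `B` on `(R_I)_m` satisfies
`{L_{ab}(z)_λ L_{cd}(w)} = L_{cb}(z) i_z(z-w-λ-∂)^{-1} L_{ad}(w) -
L_{cb}(w+λ+∂) i_z(z-w-λ-∂)^{-1} L_{ad}*(λ-z)`. -/
def IsHm (m : ℕ) (B : LambdaBracket F (RepAlg F (DiffPoly F S) m)) : Prop :=
  ∀ (a b c d : Fin m) (p q : ℤ), B (Lmc F S N m a b p) (Lmc F S N m c d q) =
    hCoeff (repD (diffD F S)).toLinearMap (LinearMap.mul F (RepAlg F (DiffPoly F S) m))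
      (Lmc F S N m c b) (Lmc F S N m a d) p q

/-- The bracket `B` on `(R_I)_m` satisfies
`{L_{ab}(z)_λ L_{cd}(w)} = δ_{ad} i_z(z-w-λ)^{-1} (L_{cb}(z) - L_{cb}(w+λ)) +
δ_{cb} i_z(z-w-λ-∂)^{-1} (L_{ad}(w) - L_{ad}*(λ-z))`. -/
def IsKm (m : ℕ) (B : LambdaBracket F (RepAlg F (DiffPoly F S) m)) : Prop :=
  ∀ (a b c d : Fin m) (p q : ℤ), B (Lmc F S N m a b p) (Lmc F S N m c d q) =
    (if a = d then kCoeff₁ F (Lmc F S N m c b) p q else 0)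
      + (if c = b then
          kCoeff₂ (repD (diffD F S)).toLinearMap (Lmc F S N m a d) p q else 0)

/-- The algebra map `F[u_{i,ab}^{(n)}] → (R_I)_m`, `u_{i,ab}^{(n)} ↦ (u_i^{(n)})_{ab}`. -/
def genericMap (m : ℕ) :
    MvPolynomial ((S × ℕ) × Fin m × Fin m) F →ₐ[F] RepAlg F (DiffPoly F S) m :=
  MvPolynomial.aeval fun x => coord (F := F) x.2.1 x.2.2 (FreeAlgebra.ι F x.1)

end Generic

end DPVA

end

/-!
# Compatible double Poisson vertex algebra structures for a generic operator

All brackets are determined by their values on the coefficients of `L(z)`.  The value of `H` on a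
pair of coefficients is a combination of the products `u_n ⊗ u_m` of coefficients of `L(z)`, in
which `u_n ⊗ u_m` is multiplied by the coefficient of `z^p w^q` in
`(z^n w^m - (w+s)^n (z-s)^m) / (z-w-s)`, where `s = λ + ∂` and `∂` acts on the second factor
(`hCoeff_eq_sum`).  This quotient is a power series in `s` over the Laurent polynomials in `z`, `w`,
and its coefficients `adlerCoeff` make sense in every ring.  Multiplication by `z-w-s` is
injective on series whose exponents of `z` are bounded above (`eq_zero_of_mulDiff_eq_zero`), so
identities between the coefficients can be checked after such multiplications.

* Skewsymmetry of `H` is the symmetry of the quotient under `z ↔ w`, `n ↔ m`, `s ↔ -s`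
  (`adlerCoeff_skew`).
* The Jacobi identity for `H` on coefficients of `L(z)` becomes an identity for `adlerCoeff` in two
  commuting variables `x = λ + ∂₂`, `y = μ + ∂₃`.  Multiplied by `(z-w-x)(w-v-y)(z-v-x-y)` it is
  elementary (`jacobiA_sub_jacobiB`).  It holds in `ℤ[X, Y]`, hence for commuting operators.
* `H + εK` takes on the coefficients of `L(z) + ε` the values prescribed by the formula for `H`
  (`hCoeff_add_smul`), because the brackets of a constant with anything vanish.  The arguments for
  `H` apply to every series of degree at most `N`, so `H + εK` is a double PVA structure for
  all `ε`.  The Jacobi identity is quadratic in the bracket, so this implies that all linear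
  combinations of `H` and `K` are double PVA structures (`jacobi_pencil`).

The conditions of a double PVA need to be checked only on differential generators
(`IsTwoFoldBracket.isDoublePVA`): the difference of the two sides of the Jacobi identity is a
derivation in its last argument, and for a skewsymmetric bracket it is invariant under cyclic
permutations up to an invertible substitution (`doubleJacobi_cyclic`).  The existence of brackets
with prescribed values on `u_i` follows from the Leibniz rules by extending derivations twice
(`LeibnizData.exists_isBracket`); the prescribed values must vanish on the coefficients of `L(z)`
that are constants, and they do (`hCoeff_eq_zero_of_notMem`).

A representation `f ↦ (f_{ij})` over a commutative algebra is determined by matrices for the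
generators of the free algebra, so `V_m` is a polynomial algebra (`genericMap_bijective`), and the
induced brackets exist (`exists_isInduced`).  The Jacobi identity for an induced bracket is the sum
of two double Jacobi identities, for `(a, b, c)` and for `(b, a, c)`
(`IsDoublePVA.isPVA_of_isInduced`), and the formulas for `H_m` and `K_m` follow from those for `H`
and `K` by naturality (`hCoeff_natural`).
-/

open scoped TensorProduct

noncomputable section

namespace DPVA

/-! ### Powers of `z + s` and the coefficients of the bracket -/

section Coefficients

open Filter

section Ring

variable {R : Type*} [Ring R]

/-- The coefficient of `z^k` in `(z + s)^n`, for `n ∈ ℤ`, expanded in non-negative powers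
of `s`. -/
def pw (s : R) (n k : ℤ) : R :=
  if k ≤ n then Ring.choose n (n - k).toNat • s ^ (n - k).toNat else 0

/-- The Kronecker delta. -/
def dl (R : Type*) [Ring R] (p n : ℤ) : R := if p = n then 1 else 0

theorem pw_of_lt (s : R) {n k : ℤ} (h : n < k) : pw s n k = 0 := if_neg (not_le.2 h)

theorem pw_self (s : R) (n : ℤ) : pw s n n = 1 := by simp [pw]

theorem choose_eq_zero_of_nonneg {n : ℤ} {j : ℕ} (h0 : 0 ≤ n) (hj : n < j) :
    Ring.choose n j = 0 := by
  obtain ⟨k, rfl⟩ := Int.eq_ofNat_of_zero_le h0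
  rw [Ring.choose_natCast, Nat.choose_eq_zero_of_lt (by omega)]
  rfl

theorem pw_of_neg (s : R) {n k : ℤ} (hn : 0 ≤ n) (hk : k < 0) : pw s n k = 0 := by
  rw [pw]
  split_ifs with h
  · rw [choose_eq_zero_of_nonneg hn (by omega), zero_smul]
  · rfl

theorem pw_zero_left (s : R) (k : ℤ) : pw s 0 k = dl R k 0 := by
  rcases lt_trichotomy k 0 with h | rfl | h
  · rw [pw_of_neg s le_rfl h, dl, if_neg h.ne]
  · rw [pw_self, dl, if_pos rfl]
  · rw [pw_of_lt s h, dl, if_neg h.ne']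

/-- Pascal's rule: `(z + s)^(n+1) = (z + s) (z + s)^n`. -/
theorem pw_succ (s : R) (n k : ℤ) : pw s (n + 1) k = pw s n (k - 1) + s * pw s n k := by
  rcases lt_trichotomy k (n + 1) with h | rfl | h
  · have h1 : k ≤ n := by omega
    obtain ⟨j, hj⟩ : ∃ j : ℕ, (j : ℤ) = n - k := ⟨(n - k).toNat, by omega⟩
    have e1 : (n + 1 - k).toNat = j + 1 := by omega
    have e2 : (n - (k - 1)).toNat = j + 1 := by omega
    have e3 : (n - k).toNat = j := by omega
    rw [pw, pw, pw, if_pos (by omega), if_pos (by omega), if_pos h1, e1, e2, e3,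
      Ring.choose_succ_succ, add_smul, mul_smul_comm, ← pow_succ', add_comm]
  · rw [pw_self, pw_of_lt s (k := n + 1) (by omega), add_sub_cancel_right, pw_self, mul_zero,
      add_zero]
  · rw [pw_of_lt s h, pw_of_lt s (by omega), pw_of_lt s (by omega), mul_zero, add_zero]

theorem pw_pred (s : R) (n k : ℤ) : pw s n (k - 1) = pw s (n + 1) k - s * pw s n k := by
  rw [pw_succ, add_sub_cancel_right]

theorem map_pw {R' : Type*} [Ring R'] (f : R →+* R') (s : R) (n k : ℤ) :
    f (pw s n k) = pw (f s) n k := by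
  rw [pw, pw]
  split_ifs
  · rw [map_zsmul, map_pow]
  · exact map_zero f

/-- Pascal's rule and the values at `n = 0` determine the coefficients for all `n ∈ ℤ`, provided
that the coefficients at `k > n` vanish. -/
theorem pw_eq_zero_of_pascal {t : R} {g : ℤ → ℤ → R}
    (hg : ∀ n k, g (n + 1) k = g n (k - 1) + t * g n k) (h0 : ∀ k, g 0 k = 0)
    (hlt : ∀ n k, n < k → g n k = 0) (n k : ℤ) : g n k = 0 := by
  induction n using Int.induction_on generalizing k with
  | zero => exact h0 k
  | succ n ih => rw [hg, ih, ih, mul_zero, add_zero]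
  | pred n ih =>
    -- for negative `n` the rule determines the value at `k - 1` from that at `k`
    have key : ∀ j : ℕ, g (-n - 1) (-n - j) = 0 := by
      intro j
      induction j with
      | zero => exact hlt _ _ (by push_cast; omega)
      | succ j hj =>
        have := hg (-n - 1) (-n - j)
        rw [hj, mul_zero, add_zero, sub_add_cancel, ih] at this
        rw [Nat.cast_succ, ← sub_sub]
        exact this.symm
    rcases lt_or_ge (-n - 1 : ℤ) k with h | h
    · exact hlt _ _ h
    · have := key (-n - k).toNat
      rwa [show (-n - ((-n - k).toNat : ℤ) : ℤ) = k by omega] at this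

/-- The sign of `z^i w^j` in `(z^n - w^n) / (z - w)`, where `i + j = n - 1`: it is `1` for
`i, j ≥ 0`, it is `-1` for `i, j < 0`, and the other monomials do not occur. -/
def ddSign (i j : ℤ) : ℤ :=
  if 0 ≤ i ∧ 0 ≤ j then 1 else if i < 0 ∧ j < 0 then -1 else 0

/-- The coefficient of `z^p w^q` in `(z^n w^m - (w+s)^n (z-s)^m) / (z-w-s)`, which is a power
series in `s` over the Laurent polynomials in `z` and `w`.  It is read off from the decomposition
`w^m (z^n - (w+s)^n) / (z-(w+s)) - (w+s)^n ((z-s)^m - w^m) / ((z-s)-w)`. -/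
def adlerCoeff (s : R) (p q n m : ℤ) : R :=
  ddSign p (n - 1 - p) • pw s (n - 1 - p) (q - m) -
    ∑ i ∈ Finset.Icc p (n + m - 1 - q),
      ddSign i (m - 1 - i) • (pw (-s) i p * pw s n (q - m + 1 + i))

theorem map_adlerCoeff {R' : Type*} [Ring R'] (f : R →+* R') (s : R) (p q n m : ℤ) :
    f (adlerCoeff s p q n m) = adlerCoeff (f s) p q n m := by
  simp only [adlerCoeff, map_sub, map_zsmul, map_sum, map_mul, map_pw, map_neg]

theorem ddSign_sub (i j : ℤ) :
    ddSign (i - 1) j - ddSign i (j - 1) = (if j = 0 then 1 else 0) - (if i = 0 then 1 else 0) := by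
  unfold ddSign
  split_ifs <;> omega

theorem adlerCoeff_eq_zero_of_add_le (s : R) {p q n m : ℤ} (h : n + m ≤ p + q) :
    adlerCoeff s p q n m = 0 := by
  rw [adlerCoeff, pw_of_lt s (by omega), smul_zero, Finset.Icc_eq_empty (by omega),
    Finset.sum_empty, sub_zero]

theorem adlerCoeff_eq_zero_of_le_left (s : R) {p q n m : ℤ} (h0 : 0 ≤ p) (hn : n ≤ p)
    (hm : m ≤ p) : adlerCoeff s p q n m = 0 := by
  have h1 : ∀ i j : ℤ, 0 ≤ i → j < 0 → ddSign i j = 0 := by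
    intro i j hi hj
    rw [ddSign, if_neg (by omega), if_neg (by omega)]
  rw [adlerCoeff, h1 _ _ h0 (by omega), zero_smul, zero_sub, neg_eq_zero]
  refine Finset.sum_eq_zero fun i hi => ?_
  rw [Finset.mem_Icc] at hi
  rw [h1 _ _ (by omega) (by omega), zero_smul]

theorem adlerCoeff_eq_zero_of_neg (s : R) {p q n m : ℤ} (hn : 0 ≤ n) (hm : 0 ≤ m)
    (h : p < 0 ∨ q < 0) : adlerCoeff s p q n m = 0 := by
  rw [adlerCoeff]
  have h1 : ddSign p (n - 1 - p) • pw s (n - 1 - p) (q - m) = 0 := by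
    by_cases hp : p < 0
    · rw [ddSign, if_neg (by omega), if_neg (by omega), zero_smul]
    · by_cases hp' : 0 ≤ n - 1 - p
      · rw [pw_of_neg s hp' (by omega), smul_zero]
      · rw [ddSign, if_neg (by omega), if_neg (by omega), zero_smul]
  rw [h1, zero_sub, neg_eq_zero]
  refine Finset.sum_eq_zero fun i _ => ?_
  by_cases hi : 0 ≤ i ∧ 0 ≤ m - 1 - i
  · rcases h with h | h
    · rw [pw_of_neg _ hi.1 h, zero_mul, smul_zero]
    · rw [pw_of_neg _ hn (k := q - m + 1 + i) (by omega), mul_zero, smul_zero]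
  · rw [ddSign, if_neg hi, if_neg (by omega), zero_smul]

/-- A bound that is not sharp, but makes all coefficients with large `q` vanish. -/
theorem adlerCoeff_eq_zero_of_crude (s : R) {p q n m : ℤ} (h : max n 0 + max m 0 ≤ q) :
    adlerCoeff s p q n m = 0 := by
  rw [adlerCoeff]
  have h1 : ddSign p (n - 1 - p) • pw s (n - 1 - p) (q - m) = 0 := by
    unfold ddSign
    split_ifs
    · rw [pw_of_lt s (by omega), smul_zero]
    · rw [pw_of_lt s (by omega), smul_zero]
    · rw [zero_smul]
  rw [h1, zero_sub, neg_eq_zero]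
  refine Finset.sum_eq_zero fun i _ => ?_
  unfold ddSign
  split_ifs
  · rw [pw_of_lt s (n := n) (by omega), mul_zero, smul_zero]
  · rw [pw_of_lt s (n := n) (by omega), mul_zero, smul_zero]
  · rw [zero_smul]

end Ring

section Comm

variable {R : Type*} [CommRing R]

/-- The pairing `∑ n, u n * f n` of a sequence `u` that is zero near `-∞` with a sequence `f` that
is zero near `+∞`. -/
def pairing (u f : ℤ → R) : R := ∑ᶠ n, u n * f n

theorem finite_support_of_eventually {M : Type*} [Zero M] {f : ℤ → M}
    (hb : ∀ᶠ n in atBot, f n = 0) (ht : ∀ᶠ n in atTop, f n = 0) :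
    (Function.support f).Finite := by
  obtain ⟨a, ha⟩ := eventually_atBot.1 hb
  obtain ⟨b, hb⟩ := eventually_atTop.1 ht
  refine (Set.finite_Icc a b).subset fun n hn => ?_
  constructor
  · by_contra h
    exact hn (ha n (by omega))
  · by_contra h
    exact hn (hb n (by omega))

variable {u u' f f' : ℤ → R}

theorem pairing_finite (hu : ∀ᶠ n in atBot, u n = 0) (hf : ∀ᶠ n in atTop, f n = 0) :
    (Function.support fun n => u n * f n).Finite :=
  finite_support_of_eventually (hu.mono fun n h => by rw [h, zero_mul])
    (hf.mono fun n h => by rw [h, mul_zero])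

theorem pairing_add_left (hu : ∀ᶠ n in atBot, u n = 0) (hu' : ∀ᶠ n in atBot, u' n = 0)
    (hf : ∀ᶠ n in atTop, f n = 0) :
    pairing (fun n => u n + u' n) f = pairing u f + pairing u' f := by
  simp only [pairing, add_mul]
  exact finsum_add_distrib (pairing_finite hu hf) (pairing_finite hu' hf)

theorem pairing_sub_left (hu : ∀ᶠ n in atBot, u n = 0) (hu' : ∀ᶠ n in atBot, u' n = 0)
    (hf : ∀ᶠ n in atTop, f n = 0) :
    pairing (fun n => u n - u' n) f = pairing u f - pairing u' f := by
  simp only [pairing, sub_mul]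
  exact finsum_sub_distrib (pairing_finite hu hf) (pairing_finite hu' hf)

theorem pairing_sub_right (hu : ∀ᶠ n in atBot, u n = 0) (hf : ∀ᶠ n in atTop, f n = 0)
    (hf' : ∀ᶠ n in atTop, f' n = 0) :
    pairing u (fun n => f n - f' n) = pairing u f - pairing u f' := by
  simp only [pairing, mul_sub]
  exact finsum_sub_distrib (pairing_finite hu hf) (pairing_finite hu hf')

theorem pairing_smul_right (hu : ∀ᶠ n in atBot, u n = 0) (hf : ∀ᶠ n in atTop, f n = 0) (a : R) :
    pairing u (fun n => a * f n) = a * pairing u f := by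
  simp only [pairing, mul_left_comm _ a]
  exact (mul_finsum' _ _ (pairing_finite hu hf)).symm

theorem pairing_smul_left (hu : ∀ᶠ n in atBot, u n = 0) (hf : ∀ᶠ n in atTop, f n = 0) (a : R) :
    pairing (fun n => a * u n) f = a * pairing u f := by
  simp only [pairing, mul_assoc]
  exact (mul_finsum' _ _ (pairing_finite hu hf)).symm

theorem pairing_shift (u f : ℤ → R) :
    pairing (fun n => u (n + 1)) f = pairing u (fun n => f (n - 1)) := by
  rw [pairing, pairing, ← finsum_comp_equiv (Equiv.addRight (1 : ℤ))
    (f := fun n => u n * f (n - 1))]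
  simp

theorem pairing_dl_left (p : ℤ) (f : ℤ → R) : pairing (fun n => dl R p n) f = f p := by
  rw [pairing, finsum_eq_single _ p]
  · simp [dl]
  · intro n hn
    simp [dl, hn.symm]

theorem pairing_dl_right (p : ℤ) (u : ℤ → R) : pairing u (fun n => dl R n p) = u p := by
  rw [pairing, finsum_eq_single _ p]
  · simp [dl]
  · intro n hn
    simp [dl, hn]

theorem pw_eventually_bot (s : R) (k : ℤ) : ∀ᶠ n in atBot, pw s n k = 0 :=
  (eventually_lt_atBot k).mono fun _ h => pw_of_lt s h

theorem pw_eventually_top (s : R) (n : ℤ) : ∀ᶠ k in atTop, pw s n k = 0 :=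
  (eventually_gt_atTop n).mono fun _ h => pw_of_lt s h

/-- `((z + y) + x)^n = (z + (x + y))^n`. -/
theorem pairing_pw (x y : R) (n k : ℤ) :
    pairing (fun j => pw y j k) (fun j => pw x n j) = pw (x + y) n k := by
  rw [← sub_eq_zero]
  revert n k
  refine pw_eq_zero_of_pascal (t := x + y) (fun n k => ?_) (fun k => ?_) (fun n k h => ?_)
  · have h1 : pairing (fun j => pw y j k) (fun j => pw x (n + 1) j) =
        pairing (fun j => pw y j k) (fun j => pw x n (j - 1)) +
          x * pairing (fun j => pw y j k) (fun j => pw x n j) := by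
      have e : (fun j => pw x n (j - 1)) = fun j => pw x (n + 1) j - x * pw x n j :=
        funext fun j => pw_pred x n j
      have t : ∀ᶠ j in atTop, x * pw x n j = 0 :=
        (pw_eventually_top x n).mono fun j h => by rw [h, mul_zero]
      rw [e, pairing_sub_right (pw_eventually_bot y k) (pw_eventually_top x _) t,
        pairing_smul_right (pw_eventually_bot y k) (pw_eventually_top x n), sub_add_cancel]
    have h2 : pairing (fun j => pw y j k) (fun j => pw x n (j - 1)) =
        pairing (fun j => pw y j (k - 1)) (fun j => pw x n j) +
          y * pairing (fun j => pw y j k) (fun j => pw x n j) := by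
      have t : ∀ᶠ j in atBot, y * pw y j k = 0 :=
        (pw_eventually_bot y k).mono fun j h => by rw [h, mul_zero]
      rw [← pairing_shift, ← pairing_smul_left (pw_eventually_bot y k) (pw_eventually_top x n),
        ← pairing_add_left (pw_eventually_bot y _) t (pw_eventually_top x n)]
      simp only [pw_succ]
    rw [h1, h2, pw_succ]
    ring
  · simp only [pw_zero_left]
    rw [pairing_dl_right, pw_zero_left, sub_self]
  · rw [pw_of_lt _ h, sub_zero]
    refine finsum_eq_zero_of_forall_eq_zero fun j => ?_
    change pw y j k * pw x n j = 0
    rcases lt_or_ge j k with hj | hj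
    · rw [pw_of_lt y hj, zero_mul]
    · rw [pw_of_lt x (show n < j by omega), mul_zero]

/-- Multiplication by `z - w - s` of a series in `z` and `w`. -/
def mulDiff (s : R) (f : ℤ → ℤ → R) (p q : ℤ) : R := f (p - 1) q - f p (q - 1) - s * f p q

/-- The defining property of the coefficients: multiplied by `z - w - s` they give
`z^n w^m - (w+s)^n (z-s)^m`. -/
theorem mulDiff_adlerCoeff (s : R) (p q n m : ℤ) :
    mulDiff s (fun p q => adlerCoeff s p q n m) p q =
      dl R p n * dl R q m - pw s n q * pw (-s) m p := by
  -- the two summands of `adlerCoeff`, the second one as a pairing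
  have split : ∀ p q, adlerCoeff s p q n m =
      ddSign p (n - 1 - p) • pw s (n - 1 - p) (q - m) -
        pairing (fun i => pw (-s) i p)
          (fun i => ddSign i (m - 1 - i) • pw s n (q - m + 1 + i)) := by
    intro p q
    rw [adlerCoeff, pairing, finsum_eq_sum_of_support_subset (s := Finset.Icc p (n + m - 1 - q))]
    · simp only [mul_smul_comm]
    · intro i hi
      rw [Finset.coe_Icc]
      constructor
      · by_contra h
        exact hi (by simp only [pw_of_lt (-s) (not_le.1 h), zero_mul])
      · by_contra h
        exact hi (by simp only [pw_of_lt s (show n < q - m + 1 + i by omega), smul_zero, mul_zero])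
  have ev : ∀ q, ∀ᶠ i in atTop, ddSign i (m - 1 - i) • pw s n (q - m + 1 + i) = 0 := by
    intro q
    filter_upwards [eventually_gt_atTop (n - (q - m + 1))] with i hi
    rw [pw_of_lt s (by omega), smul_zero]
  have first : ddSign (p - 1) (n - 1 - (p - 1)) • pw s (n - 1 - (p - 1)) (q - m) -
      ddSign p (n - 1 - p) • pw s (n - 1 - p) (q - 1 - m) -
      s * (ddSign p (n - 1 - p) • pw s (n - 1 - p) (q - m)) =
      dl R p n * dl R q m - dl R p 0 * pw s n (q - m) := by
    have e1 : n - 1 - (p - 1) = n - p := by ring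
    have e2 : pw s (n - 1 - p) (q - 1 - m) =
        pw s (n - p) (q - m) - s * pw s (n - 1 - p) (q - m) := by
      rw [show q - 1 - m = q - m - 1 by ring, pw_pred, show n - 1 - p + 1 = n - p by ring]
    have e3 := ddSign_sub p (n - p)
    rw [show n - p - 1 = n - 1 - p by ring] at e3
    have e4 : (dl R p n * dl R q m - dl R p 0 * pw s n (q - m) : R) =
        ((if n - p = 0 then 1 else 0) - (if p = 0 then 1 else 0) : ℤ) • pw s (n - p) (q - m) := by
      rw [sub_smul]
      congr 1
      · by_cases h : p = n
        · subst h
          simp [dl, pw_zero_left, sub_eq_zero]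
        · simp [dl, h, show ¬ (n - p = 0) by omega]
      · by_cases h : p = 0
        · subst h
          simp [dl]
        · simp [dl, h]
    rw [e1, e2, e4, ← e3, sub_smul, smul_sub, mul_smul_comm]
    abel
  have second : pairing (fun i => pw (-s) i (p - 1))
        (fun i => ddSign i (m - 1 - i) • pw s n (q - m + 1 + i)) -
      pairing (fun i => pw (-s) i p)
        (fun i => ddSign i (m - 1 - i) • pw s n (q - 1 - m + 1 + i)) -
      s * pairing (fun i => pw (-s) i p)
        (fun i => ddSign i (m - 1 - i) • pw s n (q - m + 1 + i)) =
      pw s n q * pw (-s) m p - dl R p 0 * pw s n (q - m) := by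
    have b : ∀ p, ∀ᶠ i in atBot, pw (-s) i p = 0 := fun p => pw_eventually_bot (-s) p
    have b' : ∀ᶠ i in atBot, s * pw (-s) i p = 0 := (b p).mono fun i h => by rw [h, mul_zero]
    have e1 : (fun i => pw (-s) i (p - 1)) = fun i => pw (-s) (i + 1) p + s * pw (-s) i p :=
      funext fun i => by rw [pw_succ]; ring
    have b1 : ∀ᶠ i in atBot, pw (-s) (i + 1) p = 0 :=
      (eventually_lt_atBot (p - 1)).mono fun _ h => pw_of_lt _ (by omega)
    rw [e1, pairing_add_left b1 b' (ev q), pairing_smul_left (b p) (ev q),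
      pairing_shift (fun i => pw (-s) i p), add_sub_right_comm, add_sub_cancel_right,
      ← pairing_sub_right (b p) _ (ev _)]
    · have e2 : (fun i : ℤ => ddSign (i - 1) (m - 1 - (i - 1)) • pw s n (q - m + 1 + (i - 1)) -
          ddSign i (m - 1 - i) • pw s n (q - 1 - m + 1 + i)) =
          fun i => pw s n q * dl R i m - pw s n (q - m) * dl R i 0 := by
        funext i
        have e3 := ddSign_sub i (m - i)
        rw [show q - m + 1 + (i - 1) = q - m + i by ring,
          show q - 1 - m + 1 + i = q - m + i by ring, ← sub_smul,
          show m - 1 - (i - 1) = m - i by ring, show m - 1 - i = m - i - 1 by ring, e3, sub_smul]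
        congr 1
        · by_cases h : i = m
          · subst h
            simp [dl]
          · simp [dl, h, show ¬ (m - i = 0) by omega]
        · by_cases h : i = 0
          · subst h
            simp [dl]
          · simp [dl, h]
      have t : ∀ j, ∀ᶠ i in atTop, dl R i j = 0 := fun j =>
        (eventually_gt_atTop j).mono fun i h => if_neg h.ne'
      rw [e2, pairing_sub_right (b p) ((t m).mono fun i h => by rw [h, mul_zero])
        ((t 0).mono fun i h => by rw [h, mul_zero]), pairing_smul_right (b p) (t m),
        pairing_smul_right (b p) (t 0), pairing_dl_right, pairing_dl_right, pw_zero_left]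
      ring
    · filter_upwards [(tendsto_atTop_add_const_right atTop (-1 : ℤ) tendsto_id).eventually (ev q)]
        with i hi
      exact hi
  simp only [mulDiff, split]
  linear_combination first - second

/-- `z - w - s` does not annihilate a series whose exponents of `z` are bounded above. -/
theorem eq_zero_of_mulDiff_eq_zero {s : R} {f : ℤ → ℤ → R} {K : ℤ}
    (hK : ∀ p q, K ≤ p → f p q = 0) (hf : ∀ p q, mulDiff s f p q = 0) (p q : ℤ) : f p q = 0 := by
  have key : ∀ j : ℕ, ∀ q, f (K - j) q = 0 := by
    intro j
    induction j with
    | zero => exact fun q => hK _ _ (by simp)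
    | succ j ih =>
      intro q
      have := hf (K - j) q
      rwa [mulDiff, ih, ih, mul_zero, sub_zero, sub_zero, sub_sub] at this
  rcases le_or_gt K p with h | h
  · exact hK p q h
  · have := key (K - p).toNat q
    rwa [show K - ((K - p).toNat : ℤ) = p by omega] at this

/-- The symmetry under `z ↔ w`, `n ↔ m`, `s ↔ -s`. -/
theorem adlerCoeff_skew (s : R) (p q n m : ℤ) :
    adlerCoeff s p q n m = -adlerCoeff (-s) q p m n := by
  rw [eq_neg_iff_add_eq_zero]
  refine eq_zero_of_mulDiff_eq_zero (s := s)
    (f := fun p q => adlerCoeff s p q n m + adlerCoeff (-s) q p m n)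
    (K := max n 0 + max m 0) (fun p q h => ?_) (fun p q => ?_) p q
  · rw [adlerCoeff_eq_zero_of_le_left s (by omega) (by omega) (by omega),
      adlerCoeff_eq_zero_of_crude (-s) (by omega), add_zero]
  · have h1 := mulDiff_adlerCoeff s p q n m
    have h2 := mulDiff_adlerCoeff (-s) q p m n
    simp only [mulDiff, neg_neg] at h1 h2 ⊢
    linear_combination h1 - h2

theorem adlerCoeff_eq_zero_of_le_right (s : R) {p q n m : ℤ} (h0 : 0 ≤ q) (hn : n ≤ q)
    (hm : m ≤ q) : adlerCoeff s p q n m = 0 := by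
  rw [adlerCoeff_skew, adlerCoeff_eq_zero_of_le_left _ h0 hm hn, neg_zero]

end Comm

end Coefficients

/-! ### The Jacobi identity for the coefficients -/

section AdlerJacobi

open Filter

variable {R : Type*} [CommRing R]

theorem adlerCoeff_eventually_left (s : R) (q n m : ℤ) :
    ∀ᶠ p in atTop, adlerCoeff s p q n m = 0 := by
  filter_upwards [eventually_ge_atTop (max (max n m) 0)] with p hp
  exact adlerCoeff_eq_zero_of_le_left s (by omega) (by omega) (by omega)

theorem adlerCoeff_eventually_right (s : R) (p n m : ℤ) :
    ∀ᶠ q in atTop, adlerCoeff s p q n m = 0 := by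
  filter_upwards [eventually_ge_atTop (max (max n m) 0)] with p hp
  exact adlerCoeff_eq_zero_of_le_right s (by omega) (by omega) (by omega)

theorem adlerCoeff_eventually_fst (s : R) (p q m : ℤ) :
    ∀ᶠ n in atBot, adlerCoeff s p q n m = 0 := by
  filter_upwards [eventually_le_atBot (p + q - m)] with n hn
  exact adlerCoeff_eq_zero_of_add_le s (by omega)

theorem adlerCoeff_eventually_snd (s : R) (p q n : ℤ) :
    ∀ᶠ m in atBot, adlerCoeff s p q n m = 0 := by
  filter_upwards [eventually_le_atBot (p + q - n)] with m hm
  exact adlerCoeff_eq_zero_of_add_le s (by omega)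

theorem dl_eventually_bot (p : ℤ) : ∀ᶠ n in atBot, dl R p n = 0 :=
  (eventually_lt_atBot p).mono fun _ h => if_neg h.ne'

theorem dl_eventually_top (p : ℤ) : ∀ᶠ n in atTop, dl R n p = 0 :=
  (eventually_gt_atTop p).mono fun _ h => if_neg h.ne'

theorem eventually_mul_zero {l : Filter ℤ} {f : ℤ → R} (h : ∀ᶠ n in l, f n = 0) (a : R) :
    ∀ᶠ n in l, a * f n = 0 := h.mono fun n h => by rw [h, mul_zero]

theorem eventually_pred {f : ℤ → R} (h : ∀ᶠ n in atTop, f n = 0) :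
    ∀ᶠ n in atTop, f (n - 1) = 0 :=
  (tendsto_atTop_add_const_right atTop (-1 : ℤ) tendsto_id).eventually h

/-- The substitution `w = v + y` in a series `f(z, w)`. -/
theorem mulDiff_pairing_right (x y : R) {f : ℤ → ℤ → R} (hf : ∀ p, ∀ᶠ n in atTop, f p n = 0)
    (p r : ℤ) :
    mulDiff (x + y) (fun p r => pairing (fun n => pw y n r) (f p)) p r =
      pairing (fun n => pw y n r) (fun n => mulDiff x f p n) := by
  have b := fun r => pw_eventually_bot y r
  have e : pairing (fun n => pw y n (r - 1)) (f p) =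
      pairing (fun n => pw y n r) (fun n => f p (n - 1)) -
        y * pairing (fun n => pw y n r) (f p) := by
    have b' : ∀ᶠ n in atBot, pw y (n + 1) r = 0 :=
      (eventually_lt_atBot (r - 1)).mono fun _ h => pw_of_lt _ (by omega)
    rw [← pairing_shift (fun n => pw y n r), ← pairing_smul_left (b r) (hf p),
      ← pairing_sub_left b' (eventually_mul_zero (b r) y) (hf p)]
    simp only [pw_pred]
  have h1 := eventually_pred (hf p)
  simp only [mulDiff]
  rw [pairing_sub_right (b r) _ (eventually_mul_zero (hf p) x),
    pairing_sub_right (b r) (hf _) h1, pairing_smul_right (b r) (hf p), e]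
  · ring
  · filter_upwards [hf (p - 1), h1] with n h2 h3
    rw [h2, h3, sub_zero]

/-- The substitution `z = w + x` in a series `f(z, v)`. -/
theorem mulDiff_pairing_left (x y : R) {f : ℤ → ℤ → R} (hf : ∀ r, ∀ᶠ n in atTop, f n r = 0)
    (q r : ℤ) :
    mulDiff y (fun q r => pairing (fun n => pw x n q) (fun n => f n r)) q r =
      pairing (fun n => pw x n q) (fun n => mulDiff (x + y) f n r) := by
  have b := fun r => pw_eventually_bot x r
  have e : pairing (fun n => pw x n (q - 1)) (fun n => f n r) =
      pairing (fun n => pw x n q) (fun n => f (n - 1) r) -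
        x * pairing (fun n => pw x n q) (fun n => f n r) := by
    have b' : ∀ᶠ n in atBot, pw x (n + 1) q = 0 :=
      (eventually_lt_atBot (q - 1)).mono fun _ h => pw_of_lt _ (by omega)
    rw [← pairing_shift (fun n => pw x n q) fun n => f n r,
      ← pairing_smul_left (b q) (hf r),
      ← pairing_sub_left b' (eventually_mul_zero (b q) x) (hf r)]
    simp only [pw_pred]
  have h1 := eventually_pred (hf r)
  simp only [mulDiff]
  rw [pairing_sub_right (b q) _ (eventually_mul_zero (hf r) (x + y)),
    pairing_sub_right (b q) h1 (hf _), pairing_smul_right (b q) (hf r), e]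
  · ring
  · filter_upwards [hf (r - 1), h1] with n h2 h3
    rw [h2, h3, sub_zero]

variable (x y : R) (k l m : ℤ)

/-- The coefficients of `{{L(z)_λ {{L(w)_μ L(v)}}}}_L`. -/
def jacobiA (p q r : ℤ) : R :=
  pairing (fun n => adlerCoeff y q r n m) (fun n => adlerCoeff x p n k l)

/-- The coefficients of `{{L(w)_μ {{L(z)_λ L(v)}}}}_R`. -/
def jacobiB (p q r : ℤ) : R :=
  pairing (fun n => adlerCoeff (x + y) p r k n) (fun n => adlerCoeff y q n l m)

/-- The coefficients of `{{{{L(z)_λ L(w)}}_{λ+μ} L(v)}}_L`. -/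
def jacobiC (p q r : ℤ) : R :=
  pairing (fun n => adlerCoeff x p q n l) (fun n => adlerCoeff (x + y) n r k m)

theorem mulDiff_jacobiA (p q r : ℤ) :
    mulDiff y (fun q r => jacobiA x y k l m p q r) q r =
      dl R r m * adlerCoeff x p q k l -
        pw (-y) m q * pairing (fun n => pw y n r) (fun n => adlerCoeff x p n k l) := by
  have t := adlerCoeff_eventually_right x p k l
  have b := fun q r => adlerCoeff_eventually_fst y q r m
  rw [← pairing_dl_left q fun n => adlerCoeff x p n k l,
    ← pairing_smul_left (dl_eventually_bot q) t,
    ← pairing_smul_left (pw_eventually_bot y r) t,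
    ← pairing_sub_left (eventually_mul_zero (dl_eventually_bot q) _)
      (eventually_mul_zero (pw_eventually_bot y r) _) t]
  simp only [mulDiff, jacobiA]
  rw [← pairing_smul_left (b q r) t, ← pairing_sub_left (b _ _) (b _ _) t,
    ← pairing_sub_left _ (eventually_mul_zero (b q r) y) t]
  · congr 1
    funext n
    have := mulDiff_adlerCoeff y q r n m
    simp only [mulDiff] at this
    rw [this]
    ring
  · filter_upwards [b (q - 1) r, b q (r - 1)] with n h2 h3
    rw [h2, h3, sub_zero]

theorem mulDiff_jacobiB (p q r : ℤ) :
    mulDiff (x + y) (fun p r => jacobiB x y k l m p q r) p r =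
      dl R p k * adlerCoeff y q r l m -
        pw (x + y) k r * pairing (fun n => pw (-(x + y)) n p) (fun n => adlerCoeff y q n l m) := by
  have t := adlerCoeff_eventually_right y q l m
  have b := fun p r => adlerCoeff_eventually_snd (x + y) p r k
  rw [← pairing_dl_left r fun n => adlerCoeff y q n l m,
    ← pairing_smul_left (dl_eventually_bot r) t,
    ← pairing_smul_left (pw_eventually_bot (-(x + y)) p) t,
    ← pairing_sub_left (eventually_mul_zero (dl_eventually_bot r) _)
      (eventually_mul_zero (pw_eventually_bot _ p) _) t]
  simp only [mulDiff, jacobiB]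
  rw [← pairing_smul_left (b p r) t, ← pairing_sub_left (b _ _) (b _ _) t,
    ← pairing_sub_left _ (eventually_mul_zero (b p r) _) t]
  · congr 1
    funext n
    have := mulDiff_adlerCoeff (x + y) p r k n
    simp only [mulDiff] at this
    rw [this]
  · filter_upwards [b (p - 1) r, b p (r - 1)] with n h2 h3
    rw [h2, h3, sub_zero]

theorem mulDiff_jacobiC (p q r : ℤ) :
    mulDiff x (fun p q => jacobiC x y k l m p q r) p q =
      dl R q l * adlerCoeff (x + y) p r k m -
        pw (-x) l p * pairing (fun n => pw x n q) (fun n => adlerCoeff (x + y) n r k m) := by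
  have t := adlerCoeff_eventually_left (x + y) r k m
  have b := fun p q => adlerCoeff_eventually_fst x p q l
  rw [← pairing_dl_left p fun n => adlerCoeff (x + y) n r k m,
    ← pairing_smul_left (dl_eventually_bot p) t,
    ← pairing_smul_left (pw_eventually_bot x q) t,
    ← pairing_sub_left (eventually_mul_zero (dl_eventually_bot p) _)
      (eventually_mul_zero (pw_eventually_bot _ q) _) t]
  simp only [mulDiff, jacobiC]
  rw [← pairing_smul_left (b p q) t, ← pairing_sub_left (b _ _) (b _ _) t,
    ← pairing_sub_left _ (eventually_mul_zero (b p q) _) t]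
  · congr 1
    funext n
    have := mulDiff_adlerCoeff x p q n l
    simp only [mulDiff] at this
    rw [this]
    ring
  · filter_upwards [b (p - 1) q, b p (q - 1)] with n h2 h3
    rw [h2, h3, sub_zero]

theorem pairing_dl_mul_sub {u : ℤ → R} (hu : ∀ᶠ n in atBot, u n = 0) (a b : R) (j i : ℤ) (s : R) :
    pairing u (fun n => a * dl R n j - b * pw s i n) =
      a * u j - b * pairing u (fun n => pw s i n) := by
  rw [pairing_sub_right hu (eventually_mul_zero (dl_eventually_top j) a)
    (eventually_mul_zero (pw_eventually_top s i) b),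
    pairing_smul_right hu (dl_eventually_top j), pairing_smul_right hu (pw_eventually_top s i),
    pairing_dl_right]

theorem mulDiff_substA (p r : ℤ) :
    mulDiff (x + y) (fun p r => pairing (fun n => pw y n r) (fun n => adlerCoeff x p n k l)) p r =
      dl R p k * pw y l r - pw (-x) l p * pw (x + y) k r := by
  have h : (fun n => mulDiff x (fun p q => adlerCoeff x p q k l) p n) =
      fun n => dl R p k * dl R n l - pw (-x) l p * pw x k n :=
    funext fun n => by rw [mulDiff_adlerCoeff]; ring
  rw [mulDiff_pairing_right x y (f := fun p n => adlerCoeff x p n k l)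
    (fun p => adlerCoeff_eventually_right x p k l), h,
    pairing_dl_mul_sub (pw_eventually_bot y r), pairing_pw]

theorem mulDiff_substB (p q : ℤ) :
    mulDiff x
        (fun p q => pairing (fun n => pw (-(x + y)) n p) (fun n => adlerCoeff y q n l m)) p q =
      pw (-y) m q * pw (-x) l p - dl R q l * pw (-(x + y)) m p := by
  have h : (fun n => mulDiff y (fun p q => adlerCoeff y p q l m) q n) =
      fun n => dl R q l * dl R n m - pw (-y) m q * pw y l n :=
    funext fun n => by rw [mulDiff_adlerCoeff]; ring
  have h1 := mulDiff_pairing_right y (-(x + y)) (f := fun p n => adlerCoeff y p n l m)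
    (fun p => adlerCoeff_eventually_right y p l m) q p
  rw [h, pairing_dl_mul_sub (pw_eventually_bot _ p), pairing_pw,
    show y + -(x + y) = -x by ring] at h1
  simp only [mulDiff] at h1 ⊢
  linear_combination -h1

theorem mulDiff_substC (q r : ℤ) :
    mulDiff y (fun q r => pairing (fun n => pw x n q) (fun n => adlerCoeff (x + y) n r k m)) q r =
      dl R r m * pw x k q - pw (x + y) k r * pw (-y) m q := by
  have h : (fun n => mulDiff (x + y) (fun p q => adlerCoeff (x + y) p q k m) n r) =
      fun n => dl R r m * dl R n k - pw (x + y) k r * pw (-(x + y)) m n :=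
    funext fun n => by rw [mulDiff_adlerCoeff]; ring
  rw [mulDiff_pairing_left x y (f := fun n r => adlerCoeff (x + y) n r k m)
    (fun r => adlerCoeff_eventually_left (x + y) r k m), h,
    pairing_dl_mul_sub (pw_eventually_bot x q), pairing_pw, show -(x + y) + x = -y by ring]

/-- Multiplication by `z - w - s` of a series in `z`, `w` and `v`. -/
def mulZW (s : R) (f : ℤ → ℤ → ℤ → R) (p q r : ℤ) : R :=
  f (p - 1) q r - f p (q - 1) r - s * f p q r

/-- Multiplication by `w - v - s` of a series in `z`, `w` and `v`. -/
def mulWV (s : R) (f : ℤ → ℤ → ℤ → R) (p q r : ℤ) : R :=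
  f p (q - 1) r - f p q (r - 1) - s * f p q r

/-- Multiplication by `z - v - s` of a series in `z`, `w` and `v`. -/
def mulZV (s : R) (f : ℤ → ℤ → ℤ → R) (p q r : ℤ) : R :=
  f (p - 1) q r - f p q (r - 1) - s * f p q r

theorem eq_zero_of_mulZW_mulWV_mulZV {a b c : R} {f : ℤ → ℤ → ℤ → R} {K : ℤ}
    (hp : ∀ p q r, K ≤ p → f p q r = 0) (hq : ∀ p q r, K ≤ q → f p q r = 0)
    (hf : ∀ p q r, mulZW a (mulWV b (mulZV c f)) p q r = 0) (p q r : ℤ) : f p q r = 0 := by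
  have h1 : ∀ p q r, mulWV b (mulZV c f) p q r = 0 := by
    intro p q r
    refine eq_zero_of_mulDiff_eq_zero (s := a) (f := fun p q => mulWV b (mulZV c f) p q r)
      (K := K + 1) (fun p q h => ?_) (fun p q => hf p q r) p q
    simp only [mulWV, mulZV]
    simp (disch := omega) only [hp, sub_zero, mul_zero]
  have h2 : ∀ p q r, mulZV c f p q r = 0 := by
    intro p q r
    refine eq_zero_of_mulDiff_eq_zero (s := b) (f := fun q r => mulZV c f p q r)
      (K := K) (fun q r h => ?_) (fun q r => h1 p q r) q r
    simp only [mulZV]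
    simp (disch := omega) only [hq, sub_zero, mul_zero]
  exact eq_zero_of_mulDiff_eq_zero (s := c) (f := fun p r => f p q r) (K := K)
    (fun p r h => hp p q r h) (fun p r => h2 p q r) p r

/-- The Jacobi identity for the coefficients `adlerCoeff`.  Multiplied by
`(z-w-x) (w-v-y) (z-v-x-y)` it becomes an identity between five products of powers, which holds
since the third factor is the sum of the other two. -/
theorem jacobiA_sub_jacobiB (p q r : ℤ) :
    jacobiA x y k l m p q r - jacobiB x y k l m p q r = jacobiC x y k l m p q r := by
  rw [← sub_eq_zero]
  refine eq_zero_of_mulZW_mulWV_mulZV (a := x) (b := y) (c := x + y) (K := max (max k l) (max m 0))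
    (f := fun p q r => jacobiA x y k l m p q r - jacobiB x y k l m p q r - jacobiC x y k l m p q r)
    (fun p q r h => ?_) (fun p q r h => ?_) (fun p q r => ?_) p q r
  · have hA : jacobiA x y k l m p q r = 0 := finsum_eq_zero_of_forall_eq_zero fun n => by
      simp only
      rw [adlerCoeff_eq_zero_of_le_left x (p := p) (by omega) (by omega) (by omega), mul_zero]
    have hB : jacobiB x y k l m p q r = 0 := finsum_eq_zero_of_forall_eq_zero fun n => by
      simp only
      rcases le_or_gt (max (max l m) 0) n with hn | hn
      · rw [adlerCoeff_eq_zero_of_le_right y (q := n) (by omega) (by omega) (by omega), mul_zero]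
      · rw [adlerCoeff_eq_zero_of_le_left _ (p := p) (by omega) (by omega) (by omega), zero_mul]
    have hC : jacobiC x y k l m p q r = 0 := finsum_eq_zero_of_forall_eq_zero fun n => by
      simp only
      rcases le_or_gt (max (max k m) 0) n with hn | hn
      · rw [adlerCoeff_eq_zero_of_le_left _ (p := n) (by omega) (by omega) (by omega), mul_zero]
      · rw [adlerCoeff_eq_zero_of_le_left _ (p := p) (by omega) (by omega) (by omega), zero_mul]
    simp only [hA, hB, hC, sub_zero]
  · have hA : jacobiA x y k l m p q r = 0 := finsum_eq_zero_of_forall_eq_zero fun n => by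
      simp only
      rcases le_or_gt (max (max k l) 0) n with hn | hn
      · rw [adlerCoeff_eq_zero_of_le_right _ (q := n) (by omega) (by omega) (by omega), mul_zero]
      · rw [adlerCoeff_eq_zero_of_le_left _ (p := q) (by omega) (by omega) (by omega), zero_mul]
    have hB : jacobiB x y k l m p q r = 0 := finsum_eq_zero_of_forall_eq_zero fun n => by
      simp only
      rw [adlerCoeff_eq_zero_of_le_left y (p := q) (by omega) (by omega) (by omega), mul_zero]
    have hC : jacobiC x y k l m p q r = 0 := finsum_eq_zero_of_forall_eq_zero fun n => by
      simp only
      rcases le_or_gt (max (max k m) 0) n with hn | hn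
      · rw [adlerCoeff_eq_zero_of_le_left _ (p := n) (by omega) (by omega) (by omega), mul_zero]
      · rw [adlerCoeff_eq_zero_of_le_right _ (q := q) (by omega) (by omega) (by omega), zero_mul]
    simp only [hA, hB, hC, sub_zero]
  · -- each of the three terms is first multiplied by the factor that splits it in two, and then
    -- each half by the factor that makes it explicit
    have hA := fun p q r => mulDiff_jacobiA x y k l m p q r
    have hB := fun p q r => mulDiff_jacobiB x y k l m p q r
    have hC := fun p q r => mulDiff_jacobiC x y k l m p q r
    have hA1 := fun p q => mulDiff_adlerCoeff x p q k l
    have hA2 := fun p r => mulDiff_substA x y k l p r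
    have hB1 := fun q r => mulDiff_adlerCoeff y q r l m
    have hB2 := fun p q => mulDiff_substB x y l m p q
    have hC1 := fun p r => mulDiff_adlerCoeff (x + y) p r k m
    have hC2 := fun q r => mulDiff_substC x y k m q r
    have eA : mulZW x (mulZV (x + y) (mulWV y (jacobiA x y k l m))) p q r =
        mulZV (x + y) (fun p q r => dl R r m * (dl R p k * dl R q l - pw x k q * pw (-x) l p))
          p q r -
        mulZW x (fun p q r => pw (-y) m q * (dl R p k * pw y l r - pw (-x) l p * pw (x + y) k r))
          p q r := by
      have e : mulWV y (jacobiA x y k l m) = _ :=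
        funext fun p => funext fun q => funext fun r => hA p q r
      rw [e]
      simp only [← hA1, ← hA2]
      simp only [mulZW, mulZV, mulDiff]
      ring
    have eB : mulZW x (mulWV y (mulZV (x + y) (jacobiB x y k l m))) p q r =
        mulZW x (fun p q r => dl R p k * (dl R q l * dl R r m - pw y l r * pw (-y) m q)) p q r -
        mulWV y (fun p q r => pw (x + y) k r *
          (pw (-y) m q * pw (-x) l p - dl R q l * pw (-(x + y)) m p)) p q r := by
      have e : mulZV (x + y) (jacobiB x y k l m) = _ :=
        funext fun p => funext fun q => funext fun r => hB p q r
      rw [e]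
      simp only [← hB1, ← hB2]
      simp only [mulZW, mulWV, mulDiff]
      ring
    have eC : mulWV y (mulZV (x + y) (mulZW x (jacobiC x y k l m))) p q r =
        mulWV y (fun p q r => dl R q l *
          (dl R p k * dl R r m - pw (x + y) k r * pw (-(x + y)) m p)) p q r -
        mulZV (x + y) (fun p q r => pw (-x) l p *
          (dl R r m * pw x k q - pw (x + y) k r * pw (-y) m q)) p q r := by
      have e : mulZW x (jacobiC x y k l m) = _ :=
        funext fun p => funext fun q => funext fun r => hC p q r
      rw [e]
      simp only [← hC1, ← hC2]
      simp only [mulZV, mulWV, mulDiff]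
      ring
    simp only [mulZV, mulWV, mulZW] at eA eB eC ⊢
    linear_combination eA - eB - eC

end AdlerJacobi

/-! ### Polynomials in `λ` -/

section PolyLemmas

variable {F : Type*} [Field F]
variable {M P Q M' P' Q' : Type*} [AddCommGroup M] [Module F M] [AddCommGroup P] [Module F P]
  [AddCommGroup Q] [Module F Q] [AddCommGroup M'] [Module F M'] [AddCommGroup P'] [Module F P']
  [AddCommGroup Q'] [Module F Q']

theorem const_apply (m : M) : const (F := F) m = Finsupp.single 0 m := rfl

theorem lam_single (n : ℕ) (m : M) :
    lam (F := F) (Finsupp.single n m) = Finsupp.single (n + 1) m := by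
  simp [lam, Finsupp.lmapDomain_apply, Finsupp.mapDomain_single]

theorem pmap_single (f : M →ₗ[F] Q) (n : ℕ) (m : M) :
    pmap f (Finsupp.single n m) = Finsupp.single n (f m) := by
  simp [pmap]

theorem lam_pow_const (n : ℕ) (m : M) :
    ((lam : Module.End F (LamPoly M)) ^ n) (const (F := F) m) = Finsupp.single n m := by
  induction n with
  | zero => rfl
  | succ n ih => rw [pow_succ', Module.End.mul_apply, ih, lam_single]

/-- Induction over `M[λ]`: constants, sums, and multiplication by `λ`. -/
@[elab_as_elim]
theorem lamPoly_induction {p : LamPoly M → Prop} (P : LamPoly M)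
    (hc : ∀ m, p (const (F := F) m)) (ha : ∀ a b, p a → p b → p (a + b))
    (hl : ∀ a, p a → p (lam (F := F) a)) : p P := by
  have h0 : p 0 := by simpa using hc 0
  induction P using Finsupp.induction_linear with
  | zero => exact h0
  | add a b iha ihb => exact ha a b iha ihb
  | single n m =>
    rw [← lam_pow_const (F := F)]
    induction n with
    | zero => exact hc m
    | succ n ih =>
      rw [pow_succ', Module.End.mul_apply]
      exact hl _ ih

theorem pmap_const (f : M →ₗ[F] Q) (m : M) :
    pmap f (const (F := F) m) = const (F := F) (f m) := by
  rw [const_apply, const_apply, pmap_single]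

theorem pmap_lam (f : M →ₗ[F] Q) (p : LamPoly M) :
    pmap f (lam (F := F) p) = lam (F := F) (pmap f p) := by
  induction p using Finsupp.induction_linear with
  | zero => simp
  | add a b iha ihb => rw [map_add, map_add, iha, ihb, map_add, map_add]
  | single n m => rw [lam_single, pmap_single, pmap_single, lam_single]

theorem pmap_pmap (g : Q →ₗ[F] P) (f : M →ₗ[F] Q) (p : LamPoly M) :
    pmap g (pmap f p) = pmap (g ∘ₗ f) p := by
  induction p using Finsupp.induction_linear with
  | zero => simp
  | add a b iha ihb => rw [map_add, map_add, iha, ihb, map_add]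
  | single n m => rw [pmap_single, pmap_single, pmap_single, LinearMap.comp_apply]

theorem pmap_id (p : LamPoly M) : pmap (LinearMap.id : M →ₗ[F] M) p = p := by
  induction p using Finsupp.induction_linear with
  | zero => simp
  | add a b iha ihb => rw [map_add, iha, ihb]
  | single n m => rw [pmap_single, LinearMap.id_apply]

theorem pmap_comm {g : Q →ₗ[F] P} {f : M →ₗ[F] Q} {g' : Q' →ₗ[F] P} {f' : M →ₗ[F] Q'}
    (h : ∀ m, g (f m) = g' (f' m)) (p : LamPoly M) :
    pmap g (pmap f p) = pmap g' (pmap f' p) := by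
  rw [pmap_pmap, pmap_pmap]
  congr 2
  exact LinearMap.ext h

theorem lamAdd_apply (d : Module.End F M) (p : LamPoly M) :
    lamAdd d p = lam (F := F) p + pmap d p := rfl

theorem pmap_lamAdd {d : Module.End F M} {d' : Module.End F Q} {f : M →ₗ[F] Q}
    (h : ∀ m, f (d m) = d' (f m)) (p : LamPoly M) :
    pmap f (lamAdd d p) = lamAdd d' (pmap f p) := by
  rw [lamAdd_apply, lamAdd_apply, map_add, pmap_lam, pmap_comm h]

theorem end_pow_comm {f : M →ₗ[F] Q} {s : Module.End F M} {s' : Module.End F Q}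
    (h : ∀ m, f (s m) = s' (f m)) (n : ℕ) (m : M) : f ((s ^ n) m) = (s' ^ n) (f m) := by
  induction n with
  | zero => rfl
  | succ n ih => rw [pow_succ', pow_succ', Module.End.mul_apply, Module.End.mul_apply, h, ih]

/-! ### Substitution of `-λ-∂` for `λ` -/

theorem negSub_const (d : Module.End F M) (m : M) :
    negSub d (const (F := F) m) = const (F := F) m := by
  simp [negSub, const]

theorem negSub_lam (d : Module.End F M) (p : LamPoly M) :
    negSub d (lam (F := F) p) = -lamAdd d (negSub d p) := by
  induction p using Finsupp.induction_linear with
  | zero => simp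
  | add a b iha ihb => rw [map_add, map_add, iha, ihb, map_add, map_add, neg_add]
  | single n m =>
    rw [lam_single, negSub, Finsupp.lsum_single, Finsupp.lsum_single, LinearMap.comp_apply,
      LinearMap.comp_apply, pow_succ', Module.End.mul_apply, LinearMap.neg_apply]

theorem negSub_comm {d : Module.End F M} {d' : Module.End F Q} {f : M →ₗ[F] Q}
    (h : ∀ m, f (d m) = d' (f m)) (p : LamPoly M) :
    negSub d' (pmap f p) = pmap f (negSub d p) := by
  refine lamPoly_induction (F := F) p (fun m => ?_) (fun a b ha hb => ?_) (fun a ha => ?_)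
  · rw [pmap_const, negSub_const, negSub_const, pmap_const]
  · rw [map_add, map_add, map_add, map_add, ha, hb]
  · rw [pmap_lam, negSub_lam, negSub_lam, map_neg, pmap_lamAdd h, ha]

theorem negSub_pmap_self (d : Module.End F M) (p : LamPoly M) :
    negSub d (pmap d p) = pmap d (negSub d p) := negSub_comm (fun _ => rfl) p

theorem negSub_lamAdd (d : Module.End F M) (p : LamPoly M) :
    negSub d (lamAdd d p) = -lam (F := F) (negSub d p) := by
  rw [lamAdd_apply, map_add, negSub_lam, negSub_pmap_self, lamAdd_apply]
  abel

theorem negSub_negSub (d : Module.End F M) (p : LamPoly M) : negSub d (negSub d p) = p := by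
  refine lamPoly_induction (F := F) p (fun m => ?_) (fun a b ha hb => ?_) (fun a ha => ?_)
  · rw [negSub_const, negSub_const]
  · rw [map_add, map_add, ha, hb]
  · rw [negSub_lam, map_neg, negSub_lamAdd, ha, neg_neg]

/-- A map that turns `∂` into `λ+∂` turns the substitution of `-μ-∂` for `μ` into that of
`-λ-μ-∂` for `μ`. -/
theorem pmap_negSub {d : Module.End F M} {d' : Module.End F Q} {f : M →ₗ[F] LamPoly Q}
    (h : ∀ m, f (d m) = lamAdd d' (f m)) (p : LamPoly M) :
    pmap f (negSub d p) = negSub (lamAdd d') (pmap f p) := (negSub_comm h p).symm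

/-! ### The map `arrow` -/

theorem arrow_const (d : Module.End F P) (β : M →ₗ[F] P →ₗ[F] Q) (m : M) (v : P) :
    arrow d β (const (F := F) m) v = const (F := F) (β m v) := by
  simp [arrow, const, pmap_single]

theorem arrow_single (d : Module.End F P) (β : M →ₗ[F] P →ₗ[F] Q) (n : ℕ) (m : M) (v : P) :
    arrow d β (Finsupp.single n m) v =
      pmap (β m) (((lamAdd d) ^ n) (const (F := F) v)) := by
  simp [arrow]

theorem lamAdd_const (d : Module.End F P) (v : P) :
    lamAdd d (const (F := F) v) = lam (F := F) (const (F := F) v) + const (F := F) (d v) := by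
  rw [lamAdd_apply, pmap_const]

theorem pow_lamAdd_lam (d : Module.End F P) (n : ℕ) (p : LamPoly P) :
    ((lamAdd d) ^ n) (lam (F := F) p) = lam (F := F) (((lamAdd d) ^ n) p) :=
  (end_pow_comm (f := (lam : Module.End F (LamPoly P))) (fun p => by
    rw [lamAdd_apply, lamAdd_apply, map_add, pmap_lam]) n p).symm

theorem arrow_lam (d : Module.End F P) (β : M →ₗ[F] P →ₗ[F] Q) (p : LamPoly M) (v : P) :
    arrow d β (lam (F := F) p) v = lam (F := F) (arrow d β p v) + arrow d β p (d v) := by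
  induction p using Finsupp.induction_linear with
  | zero => simp
  | add a b iha ihb =>
    simp only [map_add, LinearMap.add_apply, iha, ihb]
    abel
  | single n m =>
    rw [lam_single, arrow_single, arrow_single, arrow_single, pow_succ, Module.End.mul_apply,
      lamAdd_const, map_add, map_add, pow_lamAdd_lam, pmap_lam]

/-- If `∂` is a derivation for the product `β`, then `arrow β` turns `λ+∂` on its first argument
into `λ+∂` on the result. -/
theorem arrow_lamAdd {d : Module.End F M} {d' : Module.End F P} {d'' : Module.End F Q}
    {β : M →ₗ[F] P →ₗ[F] Q} (h : ∀ m v, d'' (β m v) = β (d m) v + β m (d' v))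
    (p : LamPoly M) (v : P) :
    arrow d' β (lamAdd d p) v = lamAdd d'' (arrow d' β p v) := by
  have key : ∀ p : LamPoly M, ∀ v : P,
      pmap d'' (arrow d' β p v) = arrow d' β (pmap d p) v + arrow d' β p (d' v) := by
    intro p
    refine lamPoly_induction (F := F) (p := fun p => ∀ v,
      pmap d'' (arrow d' β p v) = arrow d' β (pmap d p) v + arrow d' β p (d' v)) p
      (fun m v => ?_) (fun a b ha hb v => ?_) (fun a ha v => ?_)
    · rw [arrow_const, pmap_const, pmap_const, arrow_const, arrow_const, h, map_add]
    · simp only [map_add, LinearMap.add_apply, ha, hb]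
      abel
    · rw [arrow_lam, map_add, pmap_lam, ha, pmap_lam, arrow_lam, arrow_lam, ha, map_add]
      abel
  rw [lamAdd_apply, lamAdd_apply, map_add, LinearMap.add_apply, arrow_lam, key]
  abel

/-- Naturality of `arrow`. -/
theorem arrow_naturality {d : Module.End F P} {d' : Module.End F P'} {β : M →ₗ[F] P →ₗ[F] Q}
    {β' : M' →ₗ[F] P' →ₗ[F] Q'} {f : M →ₗ[F] M'} {g : P →ₗ[F] P'} {h : Q →ₗ[F] Q'}
    (hβ : ∀ m v, h (β m v) = β' (f m) (g v)) (hd : ∀ v, g (d v) = d' (g v))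
    (p : LamPoly M) (v : P) :
    pmap h (arrow d β p v) = arrow d' β' (pmap f p) (g v) := by
  refine lamPoly_induction (F := F) (p := fun p => ∀ v, pmap h (arrow d β p v) =
    arrow d' β' (pmap f p) (g v)) p (fun m v => ?_) (fun a b ha hb v => ?_) (fun a ha v => ?_) v
  · rw [arrow_const, pmap_const, pmap_const, arrow_const, hβ]
  · simp only [map_add, LinearMap.add_apply, ha, hb]
  · rw [arrow_lam, map_add, pmap_lam, pmap_lam, arrow_lam, ha, ha, hd]

/-- Two successive insertions by `arrow` combine into one. -/
theorem arrow_arrow {N : Type*} [AddCommGroup N] [Module F N]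
    {d₁ : Module.End F P} {d₂ : Module.End F P'} {d : Module.End F N}
    {β : M →ₗ[F] P →ₗ[F] M'} {γ : M' →ₗ[F] P' →ₗ[F] Q} {δ : M →ₗ[F] N →ₗ[F] Q}
    {ρ : P →ₗ[F] P' →ₗ[F] N} (h : ∀ m v w, γ (β m v) w = δ m (ρ v w))
    (hρ : ∀ v w, d (ρ v w) = ρ (d₁ v) w + ρ v (d₂ w)) (p : LamPoly M) (v : P) (w : P') :
    arrow d₂ γ (arrow d₁ β p v) w = arrow d δ p (ρ v w) := by
  refine lamPoly_induction (F := F) (p := fun p => ∀ v w, arrow d₂ γ (arrow d₁ β p v) w =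
    arrow d δ p (ρ v w)) p (fun m v w => ?_) (fun a b ha hb v w => ?_) (fun a ha v w => ?_) v w
  · rw [arrow_const, arrow_const, arrow_const, h]
  · simp only [map_add, LinearMap.add_apply, ha, hb]
  · rw [arrow_lam, arrow_lam, map_add, LinearMap.add_apply, arrow_lam, ha, ha, ha, hρ, map_add]
    abel

/-- Under `λ ↦ -λ-∂` the operator `λ+∂`, with `∂` acting on the inserted element, becomes
`-λ-∂`, with `∂` acting on the coefficients. -/
theorem negSub_arrow {d : Module.End F M} {d' : Module.End F P} {d'' : Module.End F Q}
    {β : M →ₗ[F] P →ₗ[F] Q} (h : ∀ m v, d'' (β m v) = β (d m) v + β m (d' v))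
    (p : LamPoly M) (v : P) :
    negSub d'' (arrow d' β p v) = pmap (β.flip v) (negSub d p) := by
  refine lamPoly_induction (F := F) (p := fun p => ∀ v, negSub d'' (arrow d' β p v) =
    pmap (β.flip v) (negSub d p)) p (fun m v => ?_) (fun a b ha hb v => ?_) (fun a ha v => ?_) v
  · rw [arrow_const, negSub_const, negSub_const, pmap_const, LinearMap.flip_apply]
  · simp only [map_add, LinearMap.add_apply, ha, hb]
  · have key : ∀ x : LamPoly M, pmap d'' (pmap (β.flip v) x) =
        pmap (β.flip v) (pmap d x) + pmap (β.flip (d' v)) x := by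
      intro x
      rw [pmap_pmap, pmap_pmap, ← LinearMap.add_apply, ← map_add]
      congr 2
      ext m
      exact h m v
    rw [arrow_lam, map_add, negSub_lam, ha, ha, negSub_lam, map_neg, lamAdd_apply, lamAdd_apply,
      map_add, pmap_lam, key]
    abel

/-! ### Polynomials in two variables -/

theorem swapVars_single_single (i j : ℕ) (m : M) :
    swapVars (F := F) (Finsupp.single i (Finsupp.single j m)) =
      Finsupp.single j (Finsupp.single i m) := by
  simp [swapVars, pmap_single]

@[elab_as_elim]
theorem lamPoly₂_induction_single {p : LamPoly₂ M → Prop} (P : LamPoly₂ M)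
    (ha : ∀ a b, p a → p b → p (a + b))
    (hs : ∀ i j m, p (Finsupp.single i (Finsupp.single j m))) : p P := by
  have h0 : p 0 := by simpa using hs 0 0 0
  induction P using Finsupp.induction_linear with
  | zero => exact h0
  | add a b iha ihb => exact ha a b iha ihb
  | single n x =>
    induction x using Finsupp.induction_linear with
    | zero => simpa using h0
    | add a b iha ihb =>
      rw [Finsupp.single_add]
      exact ha _ _ iha ihb
    | single j m => exact hs n j m

theorem swapVars_swapVars (p : LamPoly₂ M) : swapVars (F := F) (swapVars (F := F) p) = p := by
  refine lamPoly₂_induction_single p (fun a b ha hb => ?_) fun i j m => ?_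
  · rw [map_add, map_add, ha, hb]
  · rw [swapVars_single_single, swapVars_single_single]

theorem swapVars_lam (p : LamPoly₂ M) :
    swapVars (F := F) (lam (F := F) p) = pmap (lam (F := F)) (swapVars (F := F) p) := by
  refine lamPoly₂_induction_single p (fun a b ha hb => ?_) fun i j m => ?_
  · simp only [map_add, ha, hb]
  · rw [lam_single, swapVars_single_single, swapVars_single_single, pmap_single, lam_single]

theorem swapVars_pmap_lam (p : LamPoly₂ M) :
    swapVars (F := F) (pmap (lam (F := F)) p) = lam (F := F) (swapVars (F := F) p) := by
  rw [← swapVars_swapVars (F := F) (lam (F := F) _), swapVars_lam, swapVars_swapVars]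

theorem swapVars_pmap_pmap (f : M →ₗ[F] Q) (p : LamPoly₂ M) :
    swapVars (F := F) (pmap (pmap f) p) = pmap (pmap f) (swapVars (F := F) p) := by
  refine lamPoly₂_induction_single p (fun a b ha hb => ?_) fun i j m => ?_
  · simp only [map_add, ha, hb]
  · rw [pmap_single, pmap_single, swapVars_single_single, swapVars_single_single, pmap_single,
      pmap_single]

theorem swapVars_const (p : LamPoly M) :
    swapVars (F := F) (const (F := F) p) = pmap (const (F := F)) p := by
  induction p using Finsupp.induction_linear with
  | zero => simp
  | add a b iha ihb => simp only [map_add, iha, ihb]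
  | single n m => rw [const_apply, swapVars_single_single, pmap_single, const_apply]

theorem substAdd_const (m : M) :
    substAdd (F := F) (const (F := F) m) = const (F := F) (const (F := F) m) := by
  simp [substAdd, const]

theorem substAdd_lam (p : LamPoly M) :
    substAdd (F := F) (lam (F := F) p) =
      pmap (lam (F := F)) (substAdd (F := F) p) + lam (F := F) (substAdd (F := F) p) := by
  induction p using Finsupp.induction_linear with
  | zero => simp
  | add a b iha ihb =>
    simp only [map_add, iha, ihb]
    abel
  | single n m =>
    rw [lam_single, substAdd, Finsupp.lsum_single, Finsupp.lsum_single, LinearMap.comp_apply,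
      LinearMap.comp_apply, pow_succ', Module.End.mul_apply, LinearMap.add_apply]
    rfl

theorem substAdd_pmap (f : M →ₗ[F] Q) (p : LamPoly M) :
    substAdd (F := F) (pmap f p) = pmap (pmap f) (substAdd (F := F) p) := by
  refine lamPoly_induction (F := F) p (fun m => ?_) (fun a b ha hb => ?_) (fun a ha => ?_)
  · rw [pmap_const, substAdd_const, substAdd_const, pmap_const, pmap_const]
  · simp only [map_add, ha, hb]
  · rw [pmap_lam, substAdd_lam, substAdd_lam, ha, map_add, pmap_lam]
    congr 1
    exact pmap_comm (fun m => (pmap_lam f m).symm) _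

theorem nest_const (g : M →ₗ[F] LamPoly Q) (m : M) :
    nest g (const (F := F) m) = substAdd (F := F) (g m) := by
  simp [nest, const]

theorem nest_lam (g : M →ₗ[F] LamPoly Q) (p : LamPoly M) :
    nest g (lam (F := F) p) = pmap (lam (F := F)) (nest g p) := by
  induction p using Finsupp.induction_linear with
  | zero => simp
  | add a b iha ihb => simp only [map_add, iha, ihb]
  | single n m =>
    rw [lam_single, nest, Finsupp.lsum_single, Finsupp.lsum_single, LinearMap.comp_apply,
      LinearMap.comp_apply, pow_succ', Module.End.mul_apply]
    rfl

theorem nest_pmap (g : M →ₗ[F] LamPoly Q) (f : P →ₗ[F] M) (p : LamPoly P) :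
    nest g (pmap f p) = nest (g ∘ₗ f) p := by
  refine lamPoly_induction (F := F) p (fun m => ?_) (fun a b ha hb => ?_) (fun a ha => ?_)
  · rw [pmap_const, nest_const, nest_const, LinearMap.comp_apply]
  · simp only [map_add, ha, hb]
  · rw [pmap_lam, nest_lam, nest_lam, ha]

theorem pmap_nest (g : M →ₗ[F] LamPoly Q) (f : Q →ₗ[F] P) (p : LamPoly M) :
    nest (pmap f ∘ₗ g) p = pmap (pmap f) (nest g p) := by
  refine lamPoly_induction (F := F) p (fun m => ?_) (fun a b ha hb => ?_) (fun a ha => ?_)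
  · rw [nest_const, nest_const, LinearMap.comp_apply, substAdd_pmap]
  · simp only [map_add, ha, hb]
  · rw [nest_lam, nest_lam, ha]
    exact pmap_comm (fun m => (pmap_lam f m).symm) _

theorem nest_add (g g' : M →ₗ[F] LamPoly Q) (p : LamPoly M) :
    nest (g + g') p = nest g p + nest g' p := by
  refine lamPoly_induction (F := F) p (fun m => ?_) (fun a b ha hb => ?_) (fun a ha => ?_)
  · simp only [nest_const, LinearMap.add_apply, map_add]
  · simp only [map_add, ha, hb]
    abel
  · simp only [nest_lam, ha, map_add]

theorem nest_smul (c : F) (g : M →ₗ[F] LamPoly Q) (p : LamPoly M) :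
    nest (c • g) p = c • nest g p := by
  refine lamPoly_induction (F := F) p (fun m => ?_) (fun a b ha hb => ?_) (fun a ha => ?_)
  · simp only [nest_const, LinearMap.smul_apply, map_smul]
  · simp only [map_add, ha, hb, smul_add]
  · simp only [nest_lam, ha, map_smul]

theorem nest_neg (g : M →ₗ[F] LamPoly Q) (p : LamPoly M) : nest (-g) p = -nest g p := by
  rw [← neg_one_smul F g, nest_smul, neg_one_smul]

/-- If `g(∂h) = -ν g(h)`, then substituting `-λ-∂` for `λ` in `h(λ)` before applying `g` amounts
to exchanging `λ` and `μ`. -/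
theorem nest_negSub {d : Module.End F M} {g : M →ₗ[F] LamPoly Q}
    (h : ∀ m, g (d m) = -lam (F := F) (g m)) (p : LamPoly M) :
    nest g (negSub d p) = swapVars (F := F) (nest g p) := by
  have h1 : ∀ x : LamPoly M, nest g (pmap d x) =
      -(pmap (lam (F := F)) (nest g x) + lam (F := F) (nest g x)) := by
    intro x
    refine lamPoly_induction (F := F) x (fun m => ?_) (fun a b ha hb => ?_) (fun a ha => ?_)
    · rw [pmap_const, nest_const, nest_const, h, map_neg, substAdd_lam]
    · simp only [map_add, ha, hb]
      abel
    · rw [pmap_lam, nest_lam, nest_lam, ha, map_neg, map_add, pmap_lam]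
  have h2 : ∀ y : LamPoly Q, swapVars (F := F) (substAdd (F := F) y) = substAdd (F := F) y := by
    intro y
    refine lamPoly_induction (F := F) y (fun m => ?_) (fun a b ha hb => ?_) (fun a ha => ?_)
    · rw [substAdd_const, swapVars_const, pmap_const]
    · simp only [map_add, ha, hb]
    · rw [substAdd_lam, map_add, swapVars_lam, swapVars_pmap_lam, ha, add_comm]
  refine lamPoly_induction (F := F) p (fun m => ?_) (fun a b ha hb => ?_) (fun a ha => ?_)
  · rw [negSub_const, nest_const, h2]
  · simp only [map_add, ha, hb]
  · rw [negSub_lam, map_neg, lamAdd_apply, map_add, nest_lam, h1, ha, nest_lam, swapVars_pmap_lam]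
    abel

/-- In two variables, the substitution of `-λ-μ-∂` for `μ` turns `p(λ+μ)` into `p(-μ-∂)`. -/
theorem negSub_substAdd (d : Module.End F M) (p : LamPoly M) :
    negSub (lamAdd d) (substAdd (F := F) p) = pmap (const (F := F)) (negSub d p) := by
  refine lamPoly_induction (F := F) p (fun m => ?_) (fun a b ha hb => ?_) (fun a ha => ?_)
  · rw [substAdd_const, negSub_const, negSub_const, pmap_const]
  · simp only [map_add, ha, hb]
  · have h : ∀ m : LamPoly M, lam (F := F) (lamAdd d m) = lamAdd d (lam (F := F) m) := fun m => by
      rw [lamAdd_apply, lamAdd_apply, map_add, pmap_lam]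
    have h3 : ∀ x : LamPoly M, pmap (const (F := F)) (lamAdd d x) =
        lam (F := F) (pmap (const (F := F)) x) + pmap (pmap d) (pmap (const (F := F)) x) := by
      intro x
      rw [lamAdd_apply, map_add, pmap_lam]
      congr 1
      exact pmap_comm (fun m => (pmap_const d m).symm) _
    have h4 : ∀ x : LamPoly₂ M, pmap (lamAdd d) x =
        pmap (lam (F := F)) x + pmap (pmap d) x := fun x => by
      rw [lamAdd, map_add, LinearMap.add_apply]
    rw [substAdd_lam, map_add, negSub_lam, negSub_comm h, ha, negSub_lam, map_neg, h3,
      lamAdd_apply, h4]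
    abel

end PolyLemmas

/-! ### Brackets determined by the Leibniz rules -/

section Generation

variable {F : Type*} [Field F] {A : Type*} [Ring A] [Algebra F A]

/-- `A` is generated as a differential algebra by the set `G`. -/
def DiffGeneratedBy (d : Module.End F A) (G : Set A) : Prop :=
  Algebra.adjoin F {a | ∃ g ∈ G, ∃ n : ℕ, a = (d ^ n) g} = ⊤

@[elab_as_elim]
theorem adjoin_top_induction {G : Set A} (hG : Algebra.adjoin F G = ⊤) {p : A → Prop} (a : A)
    (gen : ∀ g ∈ G, p g) (one : p 1) (smul : ∀ (c : F) a, p a → p (c • a))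
    (add : ∀ a b, p a → p b → p (a + b)) (mul : ∀ a b, p a → p b → p (a * b)) : p a := by
  have ha : a ∈ Algebra.adjoin F G := hG ▸ Algebra.mem_top
  induction ha using Algebra.adjoin_induction with
  | mem x hx => exact gen x hx
  | algebraMap c =>
    rw [Algebra.algebraMap_eq_smul_one]
    exact smul c 1 one
  | add a b _ _ ha hb => exact add a b ha hb
  | mul a b _ _ ha hb => exact mul a b ha hb

@[elab_as_elim]
theorem DiffGeneratedBy.induction {d : Module.End F A} {G : Set A} (hG : DiffGeneratedBy d G)
    {p : A → Prop} (a : A) (gen : ∀ g ∈ G, p g) (der : ∀ a, p a → p (d a)) (one : p 1)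
    (smul : ∀ (c : F) a, p a → p (c • a)) (add : ∀ a b, p a → p b → p (a + b))
    (mul : ∀ a b, p a → p b → p (a * b)) : p a := by
  refine adjoin_top_induction hG a ?_ one smul add mul
  rintro _ ⟨g, hg, n, rfl⟩
  induction n with
  | zero => exact gen g hg
  | succ n ih =>
    rw [pow_succ', Module.End.mul_apply]
    exact der _ ih

end Generation

section Bimodule

variable {F : Type*} [Field F] {A : Type*} [Ring A] [Algebra F A]
variable {M : Type*} [AddCommGroup M] [Module F M]

/-- `l` and `r` are commuting actions of `A` on `M`, on the left and on the right. -/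
structure IsBimodule (l r : A →ₗ[F] Module.End F M) : Prop where
  l_one : ∀ x, l 1 x = x
  l_mul : ∀ a b x, l (a * b) x = l a (l b x)
  r_one : ∀ x, r 1 x = x
  r_mul : ∀ a b x, r (a * b) x = r b (r a x)
  comm : ∀ a b x, l a (r b x) = r b (l a x)

/-- Derivations of `A` with values in the bimodule `M` can be prescribed arbitrarily on the
family `g`. -/
def ExtendsDerivations {X : Type*} (g : X → A) (l r : A →ₗ[F] Module.End F M) : Prop :=
  ∀ f : X → M, ∃ D : A →ₗ[F] M, (∀ x, D (g x) = f x) ∧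
    ∀ a b, D (a * b) = r b (D a) + l a (D b)

/-- A derivation into a bimodule `M` of the free algebra is read off from an algebra map into the
square-zero extension by `M`. -/
theorem FreeAlgebra.extendsDerivations {X : Type*}
    {l r : FreeAlgebra F X →ₗ[F] Module.End F M} (h : IsBimodule l r) :
    ExtendsDerivations (FreeAlgebra.ι F) l r := by
  intro f
  let lm : FreeAlgebra F X →+* Module.End F M :=
    { toFun := l
      map_one' := LinearMap.ext h.l_one
      map_mul' := fun a b => LinearMap.ext fun x => h.l_mul a b x
      map_zero' := map_zero l
      map_add' := map_add l }
  let rm : (FreeAlgebra F X)ᵐᵒᵖ →+* Module.End F M :=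
    { toFun := fun a => r a.unop
      map_one' := LinearMap.ext h.r_one
      map_mul' := fun a b => LinearMap.ext fun x => h.r_mul b.unop a.unop x
      map_zero' := map_zero r
      map_add' := fun a b => map_add r a.unop b.unop }
  let _ : Module (FreeAlgebra F X) M := Module.compHom M lm
  let _ : Module (FreeAlgebra F X)ᵐᵒᵖ M := Module.compHom M rm
  have : SMulCommClass (FreeAlgebra F X) (FreeAlgebra F X)ᵐᵒᵖ M :=
    ⟨fun a b x => h.comm a b.unop x⟩
  have : IsScalarTower F (FreeAlgebra F X) M := ⟨fun c a x => by
    change l (c • a) x = c • l a x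
    rw [map_smul, LinearMap.smul_apply]⟩
  have : IsScalarTower F (FreeAlgebra F X)ᵐᵒᵖ M := ⟨fun c a x => by
    change r (c • a.unop) x = c • r a.unop x
    rw [map_smul, LinearMap.smul_apply]⟩
  let φ : FreeAlgebra F X →ₐ[F] TrivSqZeroExt (FreeAlgebra F X) M :=
    FreeAlgebra.lift F fun x => TrivSqZeroExt.inl (FreeAlgebra.ι F x) + TrivSqZeroExt.inr (f x)
  have hφ : ∀ a, (φ a).fst = a := by
    have h1 : (TrivSqZeroExt.fstHom F (FreeAlgebra F X) M).comp φ =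
        AlgHom.id F (FreeAlgebra F X) := by
      ext x
      simp [φ]
    exact fun a => DFunLike.congr_fun h1 a
  refine ⟨{ toFun := fun a => (φ a).snd, map_add' := fun a b => by simp,
            map_smul' := fun c a => by simp }, fun x => by simp [φ], fun a b => ?_⟩
  have h2 : (φ (a * b)).snd = l a (φ b).snd + r b (φ a).snd := by
    rw [map_mul, TrivSqZeroExt.snd_mul, hφ, hφ]
    rfl
  exact h2.trans (add_comm _ _)

/-- The actions on linear maps into a bimodule by composition. -/
def postcomp (N : Type*) [AddCommGroup N] [Module F N] (l : A →ₗ[F] Module.End F M) :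
    A →ₗ[F] Module.End F (N →ₗ[F] M) := LinearMap.llcomp F N M M ∘ₗ l

theorem IsBimodule.postcomp {N : Type*} [AddCommGroup N] [Module F N]
    {l r : A →ₗ[F] Module.End F M} (h : IsBimodule l r) :
    IsBimodule (postcomp N l) (postcomp N r) where
  l_one _ := LinearMap.ext fun _ => h.l_one _
  l_mul a b _ := LinearMap.ext fun _ => h.l_mul a b _
  r_one _ := LinearMap.ext fun _ => h.r_one _
  r_mul a b _ := LinearMap.ext fun _ => h.r_mul a b _
  comm a b _ := LinearMap.ext fun _ => h.comm a b _

end Bimodule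

/-- The data that enter the Leibniz rules of a bracket on `A` with values in `V[λ]`:
the actions `oL`, `oR` for products in the second argument, the products `sL`, `sR` for products
in the first argument, and the derivations.  For `V = A ⊗ A` with the outer actions and the products
`⋆₁` this gives 2-fold `λ`-brackets, and for commutative `A = V` it gives `λ`-brackets. -/
structure LeibnizData (F A V : Type*) [Field F] [Ring A] [Algebra F A] [AddCommGroup V]
    [Module F V] where
  /-- the derivation of `A` -/
  d : Module.End F A
  /-- the derivation of `V` -/
  dV : Module.End F V
  /-- the left action for the second argument -/
  oL : A →ₗ[F] Module.End F V
  /-- the right action for the second argument -/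
  oR : A →ₗ[F] Module.End F V
  /-- the left product for the first argument -/
  sL : V →ₗ[F] A →ₗ[F] V
  /-- the right product for the first argument -/
  sR : V →ₗ[F] A →ₗ[F] V
  d_mul : ∀ a b, d (a * b) = d a * b + a * d b
  dV_oL : ∀ a v, dV (oL a v) = oL (d a) v + oL a (dV v)
  dV_oR : ∀ a v, dV (oR a v) = oR (d a) v + oR a (dV v)
  dV_sL : ∀ v a, dV (sL v a) = sL (dV v) a + sL v (d a)
  dV_sR : ∀ v a, dV (sR v a) = sR (dV v) a + sR v (d a)
  outer : IsBimodule oL oR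
  inner : IsBimodule sL.flip sR.flip
  sL_oL : ∀ v a b, sL (oL a v) b = oL a (sL v b)
  sL_oR : ∀ v a b, sL (oR a v) b = oR a (sL v b)
  sR_oL : ∀ v a b, sR (oL a v) b = oL a (sR v b)
  sR_oR : ∀ v a b, sR (oR a v) b = oR a (sR v b)

namespace LeibnizData

variable {F A V : Type*} [Field F] [Ring A] [Algebra F A] [AddCommGroup V] [Module F V]
variable (S : LeibnizData F A V)

/-- Sesquilinearity and the Leibniz rules for a bracket with the given data. -/
structure IsBracket (B : A →ₗ[F] A →ₗ[F] LamPoly V) : Prop where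
  sesq_left : ∀ a b, B (S.d a) b = -lam (F := F) (B a b)
  sesq_right : ∀ a b, B a (S.d b) = lamAdd S.dV (B a b)
  leibniz_left : ∀ a b c, B a (b * c) = pmap (S.oR c) (B a b) + pmap (S.oL b) (B a c)
  leibniz_right : ∀ a b c, B (a * b) c = arrow S.d S.sR (B a c) b + arrow S.d S.sL (B b c) a

theorem d_one : S.d 1 = 0 := by simpa using S.d_mul 1 1

theorem coeff_isBimodule : IsBimodule (pmap ∘ₗ S.oL) (pmap ∘ₗ S.oR) where
  l_one x := by
    rw [LinearMap.comp_apply, show S.oL 1 = LinearMap.id from LinearMap.ext S.outer.l_one, pmap_id]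
  l_mul a b x := by
    simp only [LinearMap.comp_apply, pmap_pmap]
    congr 2
    exact LinearMap.ext (S.outer.l_mul a b)
  r_one x := by
    rw [LinearMap.comp_apply, show S.oR 1 = LinearMap.id from LinearMap.ext S.outer.r_one, pmap_id]
  r_mul a b x := by
    simp only [LinearMap.comp_apply, pmap_pmap]
    congr 2
    exact LinearMap.ext (S.outer.r_mul a b)
  comm a b x := pmap_comm (S.outer.comm a b) x

theorem arrow_one {d : Module.End F A} (h1 : d 1 = 0) {s : V →ₗ[F] A →ₗ[F] V}
    (hs : ∀ v, s v 1 = v) (p : LamPoly V) : arrow d s p 1 = p := by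
  refine lamPoly_induction (F := F) p (fun m => ?_) (fun a b ha hb => ?_) (fun a ha => ?_)
  · rw [arrow_const, hs]
  · rw [map_add, LinearMap.add_apply, ha, hb]
  · rw [arrow_lam, ha, h1, map_zero, add_zero]

/-- The products for the first argument of a bracket, corrected by `λ+∂`, are commuting actions on
`V[λ]`. -/
theorem arrow_isBimodule : IsBimodule (arrow S.d S.sL).flip (arrow S.d S.sR).flip where
  l_one x := arrow_one S.d_one S.inner.l_one x
  l_mul a b x := by
    simp only [LinearMap.flip_apply]
    refine (arrow_arrow (ρ := (LinearMap.mul F A).flip) (fun m v w => ?_) (fun v w => ?_)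
      x b a).symm
    · exact (S.inner.l_mul w v m).symm
    · simp only [LinearMap.flip_apply, LinearMap.mul_apply', S.d_mul]
      abel
  r_one x := arrow_one S.d_one S.inner.r_one x
  r_mul a b x := by
    simp only [LinearMap.flip_apply]
    refine (arrow_arrow (ρ := LinearMap.mul F A) (fun m v w => ?_) (fun v w => ?_) x a b).symm
    · exact (S.inner.r_mul v w m).symm
    · exact S.d_mul v w
  comm a b x := by
    simp only [LinearMap.flip_apply]
    let δ : V →ₗ[F] A ⊗[F] A →ₗ[F] V :=
      { toFun := fun v => TensorProduct.lift (LinearMap.compl₂ (S.sR ∘ₗ S.sL v) LinearMap.id)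
        map_add' := fun v w => by ext; simp
        map_smul' := fun c v => by ext; simp }
    have h1 : arrow S.d S.sL (arrow S.d S.sR x b) a =
        arrow (tensorD S.d) δ x ((TensorProduct.mk F A A).flip b a) :=
      arrow_arrow (fun v b a => by
        simpa [δ] using S.inner.comm a b v) (fun b a => by simp [tensorD, add_comm]) x b a
    have h2 : arrow S.d S.sR (arrow S.d S.sL x a) b =
        arrow (tensorD S.d) δ x (TensorProduct.mk F A A a b) :=
      arrow_arrow (fun v a b => by simp [δ]) (fun a b => by simp [tensorD]) x a b
    rw [h1, h2, LinearMap.flip_apply]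

theorem lamAdd_pmap_oL (a : A) (p : LamPoly V) :
    lamAdd S.dV (pmap (S.oL a) p) = pmap (S.oL (S.d a)) p + pmap (S.oL a) (lamAdd S.dV p) := by
  have h : pmap S.dV (pmap (S.oL a) p) = pmap (S.oL (S.d a)) p + pmap (S.oL a) (pmap S.dV p) := by
    rw [pmap_pmap, pmap_pmap, ← LinearMap.add_apply, ← map_add]
    congr 2
    exact LinearMap.ext (S.dV_oL a)
  rw [lamAdd_apply, lamAdd_apply, map_add, h, pmap_lam]
  abel

theorem lamAdd_pmap_oR (a : A) (p : LamPoly V) :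
    lamAdd S.dV (pmap (S.oR a) p) = pmap (S.oR (S.d a)) p + pmap (S.oR a) (lamAdd S.dV p) := by
  have h : pmap S.dV (pmap (S.oR a) p) = pmap (S.oR (S.d a)) p + pmap (S.oR a) (pmap S.dV p) := by
    rw [pmap_pmap, pmap_pmap, ← LinearMap.add_apply, ← map_add]
    congr 2
    exact LinearMap.ext (S.dV_oR a)
  rw [lamAdd_apply, lamAdd_apply, map_add, h, pmap_lam]
  abel

variable {S}

theorem derivation_one {M : Type*} [AddCommGroup M] [Module F M] {l r : A →ₗ[F] Module.End F M}
    (h : IsBimodule l r) {D : A →ₗ[F] M} (hD : ∀ a b, D (a * b) = r b (D a) + l a (D b)) :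
    D 1 = 0 := by
  have := hD 1 1
  rw [mul_one, h.r_one, h.l_one] at this
  exact left_eq_add.1 this

theorem IsBracket.one_left {B : A →ₗ[F] A →ₗ[F] LamPoly V} (hB : S.IsBracket B) (a : A) :
    B 1 a = 0 :=
  derivation_one S.arrow_isBimodule (D := B.flip a) fun x y => hB.leibniz_right x y a

theorem IsBracket.one_right {B : A →ₗ[F] A →ₗ[F] LamPoly V} (hB : S.IsBracket B) (a : A) :
    B a 1 = 0 :=
  derivation_one S.coeff_isBimodule (D := B a) fun x y => hB.leibniz_left a x y

theorem IsBracket.lin_comb {B B' : A →ₗ[F] A →ₗ[F] LamPoly V} (hB : S.IsBracket B)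
    (hB' : S.IsBracket B') (α β : F) : S.IsBracket (α • B + β • B') where
  sesq_left a b := by
    simp only [LinearMap.add_apply, LinearMap.smul_apply, hB.sesq_left, hB'.sesq_left, map_add,
      map_smul, smul_neg, neg_add]
  sesq_right a b := by
    simp only [LinearMap.add_apply, LinearMap.smul_apply, hB.sesq_right, hB'.sesq_right, map_add,
      map_smul]
  leibniz_left a b c := by
    simp only [LinearMap.add_apply, LinearMap.smul_apply, hB.leibniz_left, hB'.leibniz_left,
      map_add, map_smul, smul_add]
    abel
  leibniz_right a b c := by
    simp only [LinearMap.add_apply, LinearMap.smul_apply, hB.leibniz_right, hB'.leibniz_right,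
      map_add, map_smul, smul_add]
    abel

/-- A bracket is determined by its values on differential generators. -/
theorem IsBracket.ext {G : Set A} (hG : DiffGeneratedBy S.d G) {B B' : A →ₗ[F] A →ₗ[F] LamPoly V}
    (hB : S.IsBracket B) (hB' : S.IsBracket B') (h : ∀ a ∈ G, ∀ b ∈ G, B a b = B' a b) :
    B = B' := by
  refine LinearMap.ext fun a => LinearMap.ext fun b => ?_
  revert b
  refine hG.induction a (fun a ha b => ?_) (fun a ha b => ?_) (fun b => ?_) (fun c a ha b => ?_)
    (fun a a' ha ha' b => ?_) (fun a a' ha ha' b => ?_)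
  · refine hG.induction b (fun b hb => h a ha b hb) (fun b hb => ?_) ?_ (fun c b hb => ?_)
      (fun b b' hb hb' => ?_) (fun b b' hb hb' => ?_)
    · rw [hB.sesq_right, hB'.sesq_right, hb]
    · rw [hB.one_right, hB'.one_right]
    · rw [map_smul, map_smul, hb]
    · rw [map_add, map_add, hb, hb']
    · rw [hB.leibniz_left, hB'.leibniz_left, hb, hb']
  · rw [hB.sesq_left, hB'.sesq_left, ha]
  · rw [hB.one_left, hB'.one_left]
  · rw [map_smul, map_smul, LinearMap.smul_apply, LinearMap.smul_apply, ha]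
  · rw [map_add, map_add, LinearMap.add_apply, LinearMap.add_apply, ha, ha']
  · rw [hB.leibniz_right, hB'.leibniz_right, ha, ha']

variable (S) in
/-- If derivations can be prescribed on the elements `g x n = ∂^n (g x 0)`, then brackets can be
prescribed on the elements `g x 0`. -/
theorem exists_isBracket {X : Type*} (g : X × ℕ → A)
    (hgen : Algebra.adjoin F (Set.range g) = ⊤) (hd : ∀ x n, S.d (g (x, n)) = g (x, n + 1))
    (h₁ : ExtendsDerivations g (pmap ∘ₗ S.oL : A →ₗ[F] Module.End F (LamPoly V)) (pmap ∘ₗ S.oR))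
    (h₂ : ExtendsDerivations g (postcomp A (arrow S.d S.sL).flip)
      (postcomp A (arrow S.d S.sR).flip))
    (f : X → X → LamPoly V) :
    ∃ B : A →ₗ[F] A →ₗ[F] LamPoly V, S.IsBracket B ∧ ∀ x y, B (g (x, 0)) (g (y, 0)) = f x y := by
  -- `D x` is the prospective map `b ↦ {g_x λ b}`; the Leibniz rule for the second argument says
  -- that it is a derivation, and sesquilinearity determines it on the `g y`
  choose D hDg hDm using fun x : X × ℕ => h₁ fun y =>
    ((-lam : Module.End F (LamPoly V)) ^ x.2) (((lamAdd S.dV) ^ y.2) (f x.1 y.1))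
  -- the Leibniz rule for the first argument says that `a ↦ {a_λ · }` is a derivation with values in
  -- the linear maps `A → V[λ]`
  obtain ⟨B, hBg, hBm⟩ := h₂ D
  have D_one : ∀ x, D x 1 = 0 := fun x => derivation_one S.coeff_isBimodule (hDm x)
  have lamAdd_neg_lam : ∀ p : LamPoly V,
      lamAdd S.dV ((-lam : Module.End F (LamPoly V)) p) = -lam (F := F) (lamAdd S.dV p) := by
    intro p
    rw [LinearMap.neg_apply, map_neg, lamAdd_apply, lamAdd_apply, map_add, pmap_lam]
  have D_der : ∀ x b, D x (S.d b) = lamAdd S.dV (D x b) := by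
    intro x b
    refine adjoin_top_induction hgen b ?_ ?_ (fun c b hb => ?_) (fun b b' hb hb' => ?_)
      (fun b b' hb hb' => ?_)
    · rintro _ ⟨⟨y, k⟩, rfl⟩
      rw [hd, hDg, hDg, pow_succ', Module.End.mul_apply]
      exact (end_pow_comm (fun p => lamAdd_neg_lam p) _ _).symm
    · rw [S.d_one, D_one, map_zero, map_zero]
    · rw [map_smul, map_smul, map_smul, map_smul, hb]
    · rw [map_add, map_add, map_add, map_add, hb, hb']
    · rw [S.d_mul, map_add, hDm, hDm, hDm, map_add, hb, hb']
      simp only [LinearMap.comp_apply, lamAdd_pmap_oL, lamAdd_pmap_oR]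
      abel
  have D_succ : ∀ x n b, D (x, n + 1) b = -lam (F := F) (D (x, n) b) := by
    intro x n b
    refine adjoin_top_induction hgen b ?_ ?_ (fun c b hb => ?_) (fun b b' hb hb' => ?_)
      (fun b b' hb hb' => ?_)
    · rintro _ ⟨y, rfl⟩
      rw [hDg, hDg, pow_succ', Module.End.mul_apply]
      rfl
    · rw [D_one, D_one, map_zero, neg_zero]
    · rw [map_smul, map_smul, map_smul, hb, smul_neg]
    · rw [map_add, map_add, map_add, hb, hb', neg_add]
    · rw [hDm, hDm, hb, hb']
      simp only [LinearMap.comp_apply, map_neg, map_add, pmap_lam, neg_add]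
  have hBm' : ∀ a b c, B (a * b) c =
      arrow S.d S.sR (B a c) b + arrow S.d S.sL (B b c) a := by
    intro a b c
    rw [hBm]
    rfl
  have B_one : ∀ b, B 1 b = 0 := fun b =>
    derivation_one S.arrow_isBimodule (D := B.flip b) fun x y => hBm' x y b
  refine ⟨B, ⟨fun a => ?_, fun a => ?_, fun a => ?_, hBm'⟩, fun x y => ?_⟩
  · refine adjoin_top_induction hgen a ?_ (fun b => ?_) (fun c a ha b => ?_)
      (fun a a' ha ha' b => ?_) (fun a a' ha ha' b => ?_)
    · rintro _ ⟨⟨x, n⟩, rfl⟩ b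
      rw [hd, hBg, hBg, D_succ]
    · rw [S.d_one, B_one, map_zero, map_zero, LinearMap.zero_apply, neg_zero]
    · simp only [map_smul, LinearMap.smul_apply, ha, smul_neg]
    · simp only [map_add, LinearMap.add_apply, ha, ha', neg_add]
    · rw [S.d_mul, map_add, LinearMap.add_apply, hBm', hBm', hBm', ha, ha', map_neg, map_neg,
        LinearMap.neg_apply, LinearMap.neg_apply, arrow_lam, arrow_lam, map_add]
      abel
  · refine adjoin_top_induction hgen a ?_ (fun b => ?_) (fun c a ha b => ?_)
      (fun a a' ha ha' b => ?_) (fun a a' ha ha' b => ?_)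
    · rintro _ ⟨x, rfl⟩ b
      rw [hBg, D_der]
    · rw [B_one, B_one, map_zero]
    · simp only [map_smul, LinearMap.smul_apply, ha]
    · simp only [map_add, LinearMap.add_apply, ha, ha']
    · rw [hBm', hBm', ha, ha', arrow_lamAdd S.dV_sR, arrow_lamAdd S.dV_sL, map_add]
  · refine adjoin_top_induction hgen a ?_ (fun b c => ?_) (fun e a ha b c => ?_)
      (fun a a' ha ha' b c => ?_) (fun a a' ha ha' b c => ?_)
    · rintro _ ⟨x, rfl⟩ b c
      rw [hBg, hDm]
      rfl
    · rw [B_one, B_one, B_one, map_zero, map_zero, add_zero]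
    · simp only [map_smul, LinearMap.smul_apply, ha, smul_add]
    · simp only [map_add, LinearMap.add_apply, ha, ha']
      abel
    · have nRR : ∀ p, arrow S.d S.sR (pmap (S.oR c) p) a' = pmap (S.oR c) (arrow S.d S.sR p a') :=
        fun p => (arrow_naturality (d := S.d) (d' := S.d) (g := LinearMap.id)
          (fun v x => (S.sR_oR v c x).symm)
          (fun _ => rfl) p a').symm
      have nRL : ∀ p, arrow S.d S.sR (pmap (S.oL b) p) a' = pmap (S.oL b) (arrow S.d S.sR p a') :=
        fun p => (arrow_naturality (d := S.d) (d' := S.d) (g := LinearMap.id)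
          (fun v x => (S.sR_oL v b x).symm)
          (fun _ => rfl) p a').symm
      have nLR : ∀ p, arrow S.d S.sL (pmap (S.oR c) p) a = pmap (S.oR c) (arrow S.d S.sL p a) :=
        fun p => (arrow_naturality (d := S.d) (d' := S.d) (g := LinearMap.id)
          (fun v x => (S.sL_oR v c x).symm)
          (fun _ => rfl) p a).symm
      have nLL : ∀ p, arrow S.d S.sL (pmap (S.oL b) p) a = pmap (S.oL b) (arrow S.d S.sL p a) :=
        fun p => (arrow_naturality (d := S.d) (d' := S.d) (g := LinearMap.id)
          (fun v x => (S.sL_oL v b x).symm)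
          (fun _ => rfl) p a).symm
      rw [hBm', hBm', hBm', ha, ha']
      simp only [map_add, LinearMap.add_apply, nRR, nRL, nLR, nLL]
      abel
  · rw [hBg, hDg]
    rfl

/-- `σ` stands for the exchange of the tensor factors; it exchanges the products for the two
arguments. Skewsymmetry holds everywhere if it holds on differential generators. -/
theorem IsBracket.skew_of_generators {G : Set A} (hG : DiffGeneratedBy S.d G)
    {B : A →ₗ[F] A →ₗ[F] LamPoly V} (hB : S.IsBracket B) {σ : V →ₗ[F] V}
    (hσ : ∀ v, σ (σ v) = v) (hσd : ∀ v, σ (S.dV v) = S.dV (σ v))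
    (hσR : ∀ v b, σ (S.sR v b) = S.oR b (σ v)) (hσL : ∀ v b, σ (S.sL v b) = S.oL b (σ v))
    (h : ∀ a ∈ G, ∀ b ∈ G, B a b = -negSub S.dV (pmap σ (B b a))) (a b : A) :
    B a b = -negSub S.dV (pmap σ (B b a)) := by
  have ext : ∀ a, (∀ b ∈ G, B a b = -negSub S.dV (pmap σ (B b a))) →
      ∀ b, B a b = -negSub S.dV (pmap σ (B b a)) := by
    intro a ha b
    refine hG.induction b ha (fun b hb => ?_) ?_ (fun c b hb => ?_) (fun b b' hb hb' => ?_)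
      (fun b b' hb hb' => ?_)
    · rw [hB.sesq_left, hB.sesq_right, hb, map_neg, map_neg, map_neg, pmap_lam, negSub_lam]
      rw [neg_neg]
    · rw [hB.one_left, hB.one_right, map_zero, map_zero, neg_zero]
    · simp only [map_smul, LinearMap.smul_apply, hb, smul_neg]
    · simp only [map_add, LinearMap.add_apply, neg_add]
      rw [← hb, ← hb']
    · have e1 : ∀ p, pmap σ (pmap (S.sR.flip b') p) = pmap (S.oR b') (pmap σ p) :=
        pmap_comm fun v => hσR v b'
      have e2 : ∀ p, pmap σ (pmap (S.sL.flip b) p) = pmap (S.oL b) (pmap σ p) :=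
        pmap_comm fun v => hσL v b
      rw [hB.leibniz_left, hB.leibniz_right, map_add, map_add, negSub_comm hσd, negSub_comm hσd,
        negSub_arrow S.dV_sR, negSub_arrow S.dV_sL, e1, e2, hb, hb', negSub_comm hσd,
        negSub_comm hσd, map_neg, map_neg, neg_add]
  have flip : ∀ a b, B a b = -negSub S.dV (pmap σ (B b a)) →
      B b a = -negSub S.dV (pmap σ (B a b)) := by
    intro a b hab
    have hid : σ ∘ₗ σ = LinearMap.id := LinearMap.ext hσ
    rw [hab, map_neg, map_neg, neg_neg, ← negSub_comm hσd, pmap_pmap, hid, pmap_id,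
      negSub_negSub]
  exact ext a (fun b hb => flip b a (ext b (fun c hc => h b hb c hc) a)) b

end LeibnizData

/-! ### Formal properties of the Jacobi identity -/

section JacobiTools

variable {F : Type*} [Field F]
variable {M N Q : Type*} [AddCommGroup M] [Module F M] [AddCommGroup N] [Module F N]
  [AddCommGroup Q] [Module F Q]

/-- The product of a polynomial in `λ` and a polynomial in `μ` for a bilinear map `τ`, computed in
the two possible orders. -/
theorem pmap_pmap_flip (τ : M →ₗ[F] N →ₗ[F] Q) (p : LamPoly M) (q : LamPoly N) :
    pmap ((pmap.flip p) ∘ₗ τ.flip) q = swapVars (F := F) (pmap ((pmap.flip q) ∘ₗ τ) p) := by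
  induction p using Finsupp.induction_linear with
  | zero => simp
  | add a b iha ihb =>
    simp only [map_add, LinearMap.add_comp, LinearMap.add_apply, iha, ihb]
  | single i m =>
    induction q using Finsupp.induction_linear with
    | zero => simp
    | add a b iha ihb =>
      rw [map_add, iha, ihb, ← map_add, ← LinearMap.add_apply, ← map_add, ← LinearMap.add_comp,
        ← map_add]
    | single j n =>
      simp only [pmap_single, LinearMap.comp_apply, LinearMap.flip_apply, swapVars_single_single]

theorem swapVars_lamAdd_lamAdd (d : Module.End F M) (p : LamPoly₂ M) :
    swapVars (F := F) (lamAdd (lamAdd d) p) = lamAdd (lamAdd d) (swapVars (F := F) p) := by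
  have h : ∀ x : LamPoly₂ M, pmap (lamAdd d) x = pmap (lam (F := F)) x + pmap (pmap d) x :=
    fun x => by rw [lamAdd, map_add, LinearMap.add_apply]
  rw [lamAdd_apply (lamAdd d), lamAdd_apply (lamAdd d), h, h, map_add, map_add, swapVars_lam,
    swapVars_pmap_lam, swapVars_pmap_pmap]
  abel

theorem lam_lamAdd (d : Module.End F M) (p : LamPoly M) :
    lam (F := F) (lamAdd d p) = lamAdd d (lam (F := F) p) := by
  rw [lamAdd_apply, lamAdd_apply, map_add, pmap_lam]

theorem swapVars_substAdd (p : LamPoly M) :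
    swapVars (F := F) (substAdd (F := F) p) = substAdd (F := F) p := by
  refine lamPoly_induction (F := F) p (fun m => ?_) (fun a b ha hb => ?_) (fun a ha => ?_)
  · rw [substAdd_const, swapVars_const, pmap_const]
  · simp only [map_add, ha, hb]
  · rw [substAdd_lam, map_add, swapVars_lam, swapVars_pmap_lam, ha, add_comm]

theorem nest_lamAdd (g : M →ₗ[F] LamPoly Q) (d : Module.End F Q) (p : LamPoly M) :
    nest (lamAdd d ∘ₗ g) p = lamAdd (lamAdd d) (nest g p) := by
  refine lamPoly_induction (F := F) p (fun m => ?_) (fun a b ha hb => ?_) (fun a ha => ?_)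
  · rw [nest_const, nest_const, LinearMap.comp_apply, lamAdd_apply, map_add, substAdd_lam,
      substAdd_pmap, lamAdd_apply (lamAdd d), lamAdd, map_add, LinearMap.add_apply]
    abel
  · simp only [map_add, ha, hb]
  · rw [nest_lam, nest_lam, ha, pmap_lamAdd (lam_lamAdd d)]

/-- The effect of the substitution `μ ↦ -λ-μ-∂` on `{{a_λ b}_{λ+μ} c}`-like expressions. -/
theorem negSub_swapVars_pmap {d : Module.End F Q} {g g' : M →ₗ[F] LamPoly Q}
    (h : ∀ m, g m = negSub d (g' m)) (p : LamPoly M) :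
    negSub (lamAdd d) (swapVars (F := F) (pmap g' p)) = nest g p := by
  refine lamPoly_induction (F := F) p (fun m => ?_) (fun a b ha hb => ?_) (fun a ha => ?_)
  · have h1 : negSub (lamAdd d) (negSub (lamAdd d) (substAdd (F := F) (negSub d (g' m)))) =
        substAdd (F := F) (negSub d (g' m)) := negSub_negSub _ _
    rw [negSub_substAdd, negSub_negSub] at h1
    rw [pmap_const, nest_const, swapVars_const, h, h1]
  · simp only [map_add, ha, hb]
  · rw [pmap_lam, swapVars_lam, nest_lam, negSub_comm (lam_lamAdd d), ha]

theorem swapVars_negSub_pmap {d : Module.End F Q} {f g : M →ₗ[F] LamPoly Q}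
    (h : ∀ m, f m = -negSub d (g m)) (p : LamPoly M) :
    swapVars (F := F) (negSub (lamAdd d) (pmap f p)) =
      -negSub (lamAdd d) (swapVars (F := F) (nest g p)) := by
  refine lamPoly_induction (F := F) p (fun m => ?_) (fun a b ha hb => ?_) (fun a ha => ?_)
  · rw [pmap_const, negSub_const, swapVars_const, nest_const, swapVars_substAdd, negSub_substAdd,
      h, map_neg]
  · simp only [map_add, ha, hb, neg_add]
  · rw [pmap_lam, negSub_lam, map_neg, swapVars_lamAdd_lamAdd, ha, nest_lam, swapVars_pmap_lam,
      negSub_lam, map_neg]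

/-- The formal mechanism by which the Jacobi expression is a derivation in its last argument:
`La`, `Rb`, `T` stand for `{a_λ · }`, `{b_μ · }`, `{ · _λ c}`, and `r`, `l` for the multiplications
on either side.  The cross terms cancel by `pmap_pmap_flip`. -/
theorem jacobi_derivation {V W : Type*} [AddCommGroup V] [Module F V] [AddCommGroup W] [Module F W]
    {La Rb T T' : V →ₗ[F] LamPoly W} {r l : Module.End F V} {r' l' : Module.End F W}
    {τ τ' : V →ₗ[F] V →ₗ[F] W} {ac bc ac' bc' ab : LamPoly V}
    (h1 : ∀ v, La (r v) = pmap r' (La v) + pmap (τ'.flip v) ac')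
    (h2 : ∀ v, La (l v) = pmap l' (La v) + pmap (τ.flip v) ac)
    (h3 : ∀ v, Rb (l v) = pmap l' (Rb v) + pmap (τ' v) bc)
    (h4 : ∀ v, Rb (r v) = pmap r' (Rb v) + pmap (τ v) bc') :
    pmap La (pmap r bc + pmap l bc') - swapVars (F := F) (pmap Rb (pmap r ac + pmap l ac')) -
        nest (pmap r' ∘ₗ T + pmap l' ∘ₗ T') ab =
      pmap (pmap r') (pmap La bc - swapVars (F := F) (pmap Rb ac) - nest T ab) +
        pmap (pmap l') (pmap La bc' - swapVars (F := F) (pmap Rb ac') - nest T' ab) := by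
  have key : ∀ {S : V →ₗ[F] LamPoly W} {m : Module.End F V} {m' : Module.End F W}
      {t : V →ₗ[F] LamPoly W} (_ : ∀ v, S (m v) = pmap m' (S v) + t v) (p : LamPoly V),
      pmap S (pmap m p) = pmap (pmap m') (pmap S p) + pmap t p := by
    intro S m m' t h p
    rw [pmap_pmap, pmap_pmap, ← LinearMap.add_apply, ← map_add]
    congr 2
    exact LinearMap.ext h
  have e1 := key (t := pmap.flip ac' ∘ₗ τ'.flip) h1 bc
  have e2 := key (t := pmap.flip ac ∘ₗ τ.flip) h2 bc'
  have e3 := key (t := pmap.flip bc ∘ₗ τ') h3 ac'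
  have e4 := key (t := pmap.flip bc' ∘ₗ τ) h4 ac
  rw [map_add, map_add, map_add, e1, e2, e4, e3, pmap_pmap_flip, pmap_pmap_flip, map_add, map_add,
    swapVars_pmap_pmap, swapVars_pmap_pmap, nest_add, pmap_nest, pmap_nest, map_sub, map_sub,
    map_sub, map_sub]
  abel

/-- The formal mechanism behind the symmetry of the Jacobi expression under cyclic permutations of
its arguments: `σ` and `ρ` stand for the cyclic permutations of the tensor factors of `A ⊗ A` and
`A ⊗ A ⊗ A`, and the third variable is `ν = -λ-μ-∂`. -/
theorem jacobi_cyclic {V W : Type*} [AddCommGroup V] [Module F V] [AddCommGroup W] [Module F W]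
    {dV σ : Module.End F V} {dW ρ : Module.End F W} {La Lc Rb Ra Tb Tc : V →ₗ[F] LamPoly W}
    {bc cb ac ca ab : LamPoly V}
    (hbc : bc = -negSub dV (pmap σ cb)) (hac : ac = -negSub dV (pmap σ ca))
    (hLa : ∀ v, La (dV v) = lamAdd dW (La v)) (hRb : ∀ v, Rb (dV v) = lamAdd dW (Rb v))
    (h1 : ∀ v, La (σ v) = pmap ρ (Ra v)) (h2 : ∀ v, Rb (σ v) = -negSub dW (pmap ρ (Tb v)))
    (h3 : ∀ v, Tc v = -negSub dW (pmap ρ (Lc v))) :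
    pmap La bc - swapVars (F := F) (pmap Rb ac) - nest Tc ab =
      negSub (lamAdd dW) (swapVars (F := F) (pmap (pmap ρ)
        (pmap Lc ab - swapVars (F := F) (pmap Ra cb) - nest Tb ca))) := by
  have e1 : pmap La bc = -negSub (lamAdd dW) (pmap (pmap ρ) (pmap Ra cb)) := by
    rw [hbc, map_neg, pmap_negSub hLa, pmap_comm h1]
  have e2 : swapVars (F := F) (pmap Rb ac) =
      negSub (lamAdd dW) (swapVars (F := F) (pmap (pmap ρ) (nest Tb ca))) := by
    have h2' : ∀ v, (Rb ∘ₗ σ) v = -negSub dW ((pmap ρ ∘ₗ Tb) v) := h2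
    rw [hac, map_neg, pmap_negSub hRb, pmap_pmap, map_neg, swapVars_negSub_pmap h2', neg_neg,
      pmap_nest]
  have e3 : nest Tc ab =
      -negSub (lamAdd dW) (swapVars (F := F) (pmap (pmap ρ) (pmap Lc ab))) := by
    have h3' : ∀ v, (-Tc) v = negSub dW ((pmap ρ ∘ₗ Lc) v) := fun v => by
      rw [LinearMap.neg_apply, h3, neg_neg]
      rfl
    rw [pmap_pmap, negSub_swapVars_pmap h3', nest_neg, neg_neg]
  rw [e1, e2, e3, map_sub, map_sub, map_sub, map_sub, map_sub, map_sub, ← swapVars_pmap_pmap,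
    swapVars_swapVars]
  abel

theorem jacobi_mul_zero {V W : Type*} [AddCommGroup V] [Module F V] [AddCommGroup W] [Module F W]
    {La Rb T T' : V →ₗ[F] LamPoly W} {r l : Module.End F V} {r' l' : Module.End F W}
    {τ : V →ₗ[F] V →ₗ[F] W} {ac bc ac' bc' ab : LamPoly V}
    (h1 : ∀ v, La (r v) = pmap r' (La v)) (h2 : ∀ v, La (l v) = pmap l' (La v) + pmap (τ.flip v) ac)
    (h3 : ∀ v, Rb (l v) = pmap l' (Rb v)) (h4 : ∀ v, Rb (r v) = pmap r' (Rb v) + pmap (τ v) bc')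
    (h : pmap La bc - swapVars (F := F) (pmap Rb ac) - nest T ab = 0)
    (h' : pmap La bc' - swapVars (F := F) (pmap Rb ac') - nest T' ab = 0) :
    pmap La (pmap r bc + pmap l bc') - swapVars (F := F) (pmap Rb (pmap r ac + pmap l ac')) -
        nest (pmap r' ∘ₗ T + pmap l' ∘ₗ T') ab = 0 := by
  have z : ∀ v, pmap ((0 : V →ₗ[F] V →ₗ[F] W) v) = 0 := fun v => by
    rw [LinearMap.zero_apply, map_zero]
  rw [jacobi_derivation (τ' := 0) (fun v => ?_) h2 (fun v => ?_) h4, h, h', map_zero, map_zero,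
    add_zero]
  · rw [h1, show (0 : V →ₗ[F] V →ₗ[F] W).flip v = 0 from rfl, map_zero, LinearMap.zero_apply,
      add_zero]
  · rw [h3, z, LinearMap.zero_apply, add_zero]

section

variable {A V W : Type*} [AddCommGroup A] [Module F A] [AddCommGroup V] [Module F V]
  [AddCommGroup W] [Module F W]

theorem jacobi_add_zero {La Rb : V →ₗ[F] LamPoly W} {T : A → V →ₗ[F] LamPoly W}
    (hT : ∀ c c' v, T (c + c') v = T c v + T c' v) (Bb Ba : A →ₗ[F] LamPoly V) (ab : LamPoly V)
    {c c' : A} (h : pmap La (Bb c) - swapVars (F := F) (pmap Rb (Ba c)) - nest (T c) ab = 0)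
    (h' : pmap La (Bb c') - swapVars (F := F) (pmap Rb (Ba c')) - nest (T c') ab = 0) :
    pmap La (Bb (c + c')) - swapVars (F := F) (pmap Rb (Ba (c + c'))) - nest (T (c + c')) ab =
      0 := by
  have e : T (c + c') = T c + T c' := LinearMap.ext (hT c c')
  rw [e, map_add, map_add, map_add, map_add, map_add, nest_add, add_sub_add_comm,
    add_sub_add_comm, h, h', add_zero]

theorem jacobi_smul_zero {La Rb : V →ₗ[F] LamPoly W} {T : A → V →ₗ[F] LamPoly W} {e : F}
    (hT : ∀ c v, T (e • c) v = e • T c v) (Bb Ba : A →ₗ[F] LamPoly V) (ab : LamPoly V)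
    {c : A} (h : pmap La (Bb c) - swapVars (F := F) (pmap Rb (Ba c)) - nest (T c) ab = 0) :
    pmap La (Bb (e • c)) - swapVars (F := F) (pmap Rb (Ba (e • c))) - nest (T (e • c)) ab =
      0 := by
  have e : T (e • c) = e • T c := LinearMap.ext (hT c)
  rw [e, map_smul, map_smul, map_smul, map_smul, map_smul, nest_smul, ← smul_sub, ← smul_sub, h,
    smul_zero]

theorem jacobi_zero_zero {La Rb : V →ₗ[F] LamPoly W} {T : A → V →ₗ[F] LamPoly W}
    (hT : ∀ v, T 0 v = 0) (Bb Ba : A →ₗ[F] LamPoly V) (ab : LamPoly V) :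
    pmap La (Bb 0) - swapVars (F := F) (pmap Rb (Ba 0)) - nest (T 0) ab = 0 := by
  have e : T 0 = (0 : F) • T 0 := LinearMap.ext fun v => by rw [hT, zero_smul]; rfl
  rw [e, map_zero, map_zero, map_zero, map_zero, map_zero, nest_smul, zero_smul, sub_zero, sub_zero]

end

end JacobiTools

/-! ### 2-fold brackets and double Poisson vertex algebras -/

section Double

variable {F : Type*} [Field F] {A : Type*} [Ring A] [Algebra F A]

theorem tensorD_tmul (d : Module.End F A) (x y : A) :
    tensorD d (x ⊗ₜ[F] y) = d x ⊗ₜ y + x ⊗ₜ d y := by simp [tensorD]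

theorem outerL_tmul (b x y : A) : outerL (F := F) b (x ⊗ₜ y) = (b * x) ⊗ₜ y := by simp [outerL]

theorem outerR_tmul (b x y : A) : outerR (F := F) b (x ⊗ₜ y) = x ⊗ₜ (y * b) := by simp [outerR]

theorem star₁R_tmul (x y b : A) : star₁R (F := F) (x ⊗ₜ y) b = (x * b) ⊗ₜ y := by simp [star₁R]

theorem star₁L_tmul (x y b : A) : star₁L (F := F) (x ⊗ₜ y) b = x ⊗ₜ (b * y) := by simp [star₁L]

theorem insertMid_tmul (x y b : A) :
    insertMid (F := F) (x ⊗ₜ y) b = x ⊗ₜ (b ⊗ₜ y) := by simp [insertMid]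

theorem appendR_tmul (x y z : A) : appendR (F := F) z (x ⊗ₜ y) = x ⊗ₜ (y ⊗ₜ z) := by
  simp [appendR]

/-- The data for 2-fold `λ`-brackets. -/
def doubleData (d : NCDerivation F A) : LeibnizData F A (A ⊗[F] A) where
  d := d.toEnd
  dV := tensorD d.toEnd
  oL := LinearMap.rTensorHom A ∘ₗ LinearMap.mul F A
  oR := LinearMap.lTensorHom A ∘ₗ (LinearMap.mul F A).flip
  sL := star₁L
  sR := star₁R
  d_mul := d.leibniz
  dV_oL a v := by
    induction v with
    | zero => simp
    | add v w hv hw =>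
      simp only [map_add, hv, hw]
      abel
    | tmul x y =>
      simp [tensorD_tmul, d.leibniz, TensorProduct.add_tmul]
      abel
  dV_oR a v := by
    induction v with
    | zero => simp
    | add v w hv hw =>
      simp only [map_add, hv, hw]
      abel
    | tmul x y =>
      simp [tensorD_tmul, d.leibniz, TensorProduct.tmul_add]
      abel
  dV_sL v a := by
    induction v with
    | zero => simp
    | add v w hv hw =>
      simp only [map_add, LinearMap.add_apply, hv, hw]
      abel
    | tmul x y =>
      simp [tensorD_tmul, star₁L_tmul, d.leibniz, TensorProduct.tmul_add]
      abel
  dV_sR v a := by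
    induction v with
    | zero => simp
    | add v w hv hw =>
      simp only [map_add, LinearMap.add_apply, hv, hw]
      abel
    | tmul x y =>
      simp [tensorD_tmul, star₁R_tmul, d.leibniz, TensorProduct.add_tmul]
      abel
  outer :=
    { l_one := fun v => by induction v <;> simp_all
      l_mul := fun a b v => by induction v <;> simp_all [mul_assoc]
      r_one := fun v => by induction v <;> simp_all
      r_mul := fun a b v => by induction v <;> simp_all [mul_assoc]
      comm := fun a b v => by induction v <;> simp_all }
  inner :=
    { l_one := fun v => by induction v <;> simp_all [star₁L_tmul]
      l_mul := fun a b v => by induction v <;> simp_all [star₁L_tmul, mul_assoc]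
      r_one := fun v => by induction v <;> simp_all [star₁R_tmul]
      r_mul := fun a b v => by induction v <;> simp_all [star₁R_tmul, mul_assoc]
      comm := fun a b v => by induction v <;> simp_all [star₁L_tmul, star₁R_tmul] }
  sL_oL v a b := by induction v <;> simp_all [star₁L_tmul]
  sL_oR v a b := by induction v <;> simp_all [star₁L_tmul, mul_assoc]
  sR_oL v a b := by induction v <;> simp_all [star₁R_tmul, mul_assoc]
  sR_oR v a b := by induction v <;> simp_all [star₁R_tmul]

theorem isTwoFoldBracket_iff (d : NCDerivation F A) (B : DoubleBracket F A) :
    IsTwoFoldBracket d B ↔ (doubleData d).IsBracket B :=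
  ⟨fun h => ⟨h.sesq_left, h.sesq_right, h.leibniz_left, h.leibniz_right⟩,
    fun h => ⟨h.sesq_left, h.sesq_right, h.leibniz_left, h.leibniz_right⟩⟩

theorem brL_tmul (B : DoubleBracket F A) (a x y : A) :
    brL B a (x ⊗ₜ y) = pmap (appendR y) (B a x) := rfl

theorem brR_tmul (B : DoubleBracket F A) (a x y : A) :
    brR B a (x ⊗ₜ y) = pmap (TensorProduct.mk F A (A ⊗[F] A) x) (B a y) := rfl

theorem brFstL_tmul (d : NCDerivation F A) (B : DoubleBracket F A) (c x y : A) :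
    brFstL d B c (x ⊗ₜ y) = arrow d.toEnd insertMid (B x c) y := rfl

/-- The action of a derivation on `A ⊗ A ⊗ A`. -/
def tensorD₃ (d : Module.End F A) : Module.End F (A ⊗[F] (A ⊗[F] A)) :=
  LinearMap.rTensor (A ⊗[F] A) d + LinearMap.lTensor A (tensorD d)

theorem tensorD₃_tmul (d : Module.End F A) (x : A) (v : A ⊗[F] A) :
    tensorD₃ d (x ⊗ₜ v) = d x ⊗ₜ v + x ⊗ₜ tensorD d v := by simp [tensorD₃]

/-- The left action of `A` on the first factor of `A ⊗ A ⊗ A`. -/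
def outerL₃ (b : A) : Module.End F (A ⊗[F] (A ⊗[F] A)) :=
  LinearMap.rTensor (A ⊗[F] A) (LinearMap.mulLeft F b)

/-- The right action of `A` on the last factor of `A ⊗ A ⊗ A`. -/
def outerR₃ (c : A) : Module.End F (A ⊗[F] (A ⊗[F] A)) :=
  LinearMap.lTensor A (outerR c)

theorem outerL₃_tmul (b x : A) (v : A ⊗[F] A) : outerL₃ (F := F) b (x ⊗ₜ v) = (b * x) ⊗ₜ v := by
  simp [outerL₃]

theorem outerR₃_tmul (b x : A) (v : A ⊗[F] A) :
    outerR₃ (F := F) b (x ⊗ₜ v) = x ⊗ₜ outerR b v := by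
  simp [outerR₃]

/-- The cyclic permutation `x ⊗ y ⊗ z ↦ y ⊗ z ⊗ x`. -/
def rotate₃ : Module.End F (A ⊗[F] (A ⊗[F] A)) :=
  (TensorProduct.assoc F A A A).toLinearMap ∘ₗ (TensorProduct.comm F A (A ⊗[F] A)).toLinearMap

theorem rotate₃_tmul (x y z : A) :
    rotate₃ (F := F) (x ⊗ₜ (y ⊗ₜ z)) = y ⊗ₜ (z ⊗ₜ x) := by simp [rotate₃]

/-- `(x ⊗ y) · (z ⊗ t) = x ⊗ y z ⊗ t`. -/
def midMul : A ⊗[F] A →ₗ[F] A ⊗[F] A →ₗ[F] A ⊗[F] (A ⊗[F] A) :=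
  TensorProduct.lift (LinearMap.mk₂ F
    (fun x y => (TensorProduct.mk F A (A ⊗[F] A) x) ∘ₗ outerL y)
    (fun _ _ _ => by ext; simp)
    (fun _ _ _ => by ext; simp [TensorProduct.smul_tmul'])
    (fun _ _ _ => by
      ext; simp [outerL_tmul, add_mul, TensorProduct.tmul_add, TensorProduct.add_tmul])
    (fun _ _ _ => by ext; simp [outerL_tmul, ← TensorProduct.smul_tmul']))

theorem midMul_tmul (x y : A) (v : A ⊗[F] A) :
    midMul (F := F) (x ⊗ₜ y) v = x ⊗ₜ outerL y v := by simp [midMul]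

theorem tensorD₃_rotate₃ (d : Module.End F A) (t : A ⊗[F] (A ⊗[F] A)) :
    rotate₃ (F := F) (tensorD₃ d t) = tensorD₃ d (rotate₃ (F := F) t) := by
  have h : rotate₃ ∘ₗ tensorD₃ d = tensorD₃ d ∘ₗ (rotate₃ : Module.End F (A ⊗[F] (A ⊗[F] A))) := by
    ext x y z
    simp [tensorD₃_tmul, tensorD_tmul, rotate₃_tmul, TensorProduct.tmul_add]
    abel
  exact LinearMap.congr_fun h t

theorem tensorD₃_insertMid (d : Module.End F A) (v : A ⊗[F] A) (b : A) :
    tensorD₃ d (insertMid v b) = insertMid (tensorD d v) b + insertMid v (d b) := by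
  induction v with
  | zero => simp
  | add v w hv hw =>
    simp only [map_add, LinearMap.add_apply, hv, hw]
    abel
  | tmul x y =>
    simp [tensorD₃_tmul, tensorD_tmul, insertMid_tmul, TensorProduct.tmul_add]
    abel

theorem tensorD_comm (d : Module.End F A) (v : A ⊗[F] A) :
    (TensorProduct.comm F A A).toLinearMap (tensorD d v) =
      tensorD d ((TensorProduct.comm F A A).toLinearMap v) := by
  induction v with
  | zero => simp
  | add v w hv hw => simp only [map_add, hv, hw]
  | tmul x y =>
    simp [tensorD_tmul]
    abel

namespace IsTwoFoldBracket

variable {d : NCDerivation F A} {B : DoubleBracket F A}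

theorem brL_tensorD (hB : IsTwoFoldBracket d B) (a : A) (v : A ⊗[F] A) :
    brL B a (tensorD d.toEnd v) = lamAdd (tensorD₃ d.toEnd) (brL B a v) := by
  induction v with
  | zero => simp
  | add v w hv hw => simp only [map_add, hv, hw]
  | tmul x y =>
    have h : ∀ p : LamPoly (A ⊗[F] A), pmap (tensorD₃ d.toEnd) (pmap (appendR (F := F) y) p) =
        pmap (appendR (F := F) y) (pmap (tensorD d.toEnd) p) +
          pmap (appendR (F := F) (d.toEnd y)) p := by
      intro p
      rw [pmap_pmap, pmap_pmap, ← LinearMap.add_apply, ← map_add]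
      congr 2
      ext s t
      simp [tensorD₃_tmul, tensorD_tmul, appendR_tmul, TensorProduct.tmul_add]
      abel
    rw [tensorD_tmul, map_add, brL_tmul, brL_tmul, brL_tmul, hB.sesq_right, lamAdd_apply,
      lamAdd_apply, map_add, pmap_lam, h]
    abel

theorem brR_tensorD (hB : IsTwoFoldBracket d B) (a : A) (v : A ⊗[F] A) :
    brR B a (tensorD d.toEnd v) = lamAdd (tensorD₃ d.toEnd) (brR B a v) := by
  induction v with
  | zero => simp
  | add v w hv hw => simp only [map_add, hv, hw]
  | tmul x y =>
    have h : ∀ p : LamPoly (A ⊗[F] A),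
        pmap (tensorD₃ d.toEnd) (pmap (TensorProduct.mk F A (A ⊗[F] A) x) p) =
        pmap (TensorProduct.mk F A (A ⊗[F] A) x) (pmap (tensorD d.toEnd) p) +
          pmap (TensorProduct.mk F A (A ⊗[F] A) (d.toEnd x)) p := by
      intro p
      rw [pmap_pmap, pmap_pmap, ← LinearMap.add_apply, ← map_add]
      congr 2
      ext s t
      simp [tensorD₃_tmul, tensorD_tmul, TensorProduct.tmul_add]
      abel
    rw [tensorD_tmul, map_add, brR_tmul, brR_tmul, brR_tmul, hB.sesq_right, lamAdd_apply,
      lamAdd_apply, map_add, pmap_lam, h]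
    abel

theorem brFstL_tensorD (hB : IsTwoFoldBracket d B) (c : A) (v : A ⊗[F] A) :
    brFstL d B c (tensorD d.toEnd v) = -lam (F := F) (brFstL d B c v) := by
  induction v with
  | zero => simp
  | add v w hv hw => simp only [map_add, hv, hw, neg_add]
  | tmul x y =>
    rw [tensorD_tmul, map_add, brFstL_tmul, brFstL_tmul, brFstL_tmul, hB.sesq_left, map_neg,
      LinearMap.neg_apply, arrow_lam]
    abel

theorem brFstL_der (hB : IsTwoFoldBracket d B) (c : A) :
    brFstL d B (d.toEnd c) = lamAdd (tensorD₃ d.toEnd) ∘ₗ brFstL d B c := by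
  ext1
  ext1 x
  ext1 y
  change brFstL d B (d.toEnd c) (x ⊗ₜ y) = lamAdd (tensorD₃ d.toEnd) (brFstL d B c (x ⊗ₜ y))
  rw [brFstL_tmul, brFstL_tmul, hB.sesq_right, arrow_lamAdd (tensorD₃_insertMid d.toEnd)]

theorem brL_outerR (B : DoubleBracket F A) (a c : A) (v : A ⊗[F] A) :
    brL B a (outerR c v) = pmap (outerR₃ c) (brL B a v) := by
  induction v with
  | zero => simp
  | add v w hv hw => simp only [map_add, hv, hw]
  | tmul x y =>
    rw [outerR_tmul, brL_tmul, brL_tmul, pmap_pmap]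
    congr 2
    ext s t
    simp [appendR_tmul, outerR₃_tmul, outerR_tmul]

theorem brR_outerL (B : DoubleBracket F A) (a c : A) (v : A ⊗[F] A) :
    brR B a (outerL c v) = pmap (outerL₃ c) (brR B a v) := by
  induction v with
  | zero => simp
  | add v w hv hw => simp only [map_add, hv, hw]
  | tmul x y =>
    rw [outerL_tmul, brR_tmul, brR_tmul, pmap_pmap]
    congr 2

theorem brL_outerL (hB : IsTwoFoldBracket d B) (a c : A) (v : A ⊗[F] A) :
    brL B a (outerL c v) = pmap (outerL₃ c) (brL B a v) + pmap (midMul.flip v) (B a c) := by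
  induction v with
  | zero => simp
  | add v w hv hw =>
    simp only [map_add, LinearMap.add_apply, hv, hw]
    abel
  | tmul x y =>
    rw [outerL_tmul, brL_tmul, brL_tmul, hB.leibniz_left, map_add, pmap_pmap, pmap_pmap, pmap_pmap,
      add_comm]
    congr 3
    · ext s t
      simp [appendR_tmul, outerL₃_tmul, outerL_tmul]
    · ext s t
      simp [appendR_tmul, outerR_tmul, midMul_tmul, outerL_tmul]

theorem brR_outerR (hB : IsTwoFoldBracket d B) (b c : A) (v : A ⊗[F] A) :
    brR B b (outerR c v) = pmap (outerR₃ c) (brR B b v) + pmap (midMul v) (B b c) := by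
  induction v with
  | zero => simp
  | add v w hv hw =>
    simp only [map_add, LinearMap.add_apply, hv, hw]
    abel
  | tmul x y =>
    rw [outerR_tmul, brR_tmul, brR_tmul, hB.leibniz_left, map_add, pmap_pmap, pmap_pmap, pmap_pmap]
    rfl

theorem brFstL_mul (hB : IsTwoFoldBracket d B) (c c' : A) :
    brFstL d B (c * c') =
      pmap (outerR₃ c') ∘ₗ brFstL d B c + pmap (outerL₃ c) ∘ₗ brFstL d B c' := by
  ext1
  ext1 x
  ext1 y
  change brFstL d B (c * c') (x ⊗ₜ y) = pmap (outerR₃ c') (brFstL d B c (x ⊗ₜ y)) +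
    pmap (outerL₃ c) (brFstL d B c' (x ⊗ₜ y))
  have h1 : ∀ v a, outerR₃ c' (insertMid v a) = insertMid (F := F) (outerR c' v) a := fun v a => by
    induction v <;> simp_all [insertMid_tmul, outerR₃_tmul, outerR_tmul]
  have h2 : ∀ v a, outerL₃ c (insertMid v a) = insertMid (F := F) (outerL c v) a := fun v a => by
    induction v <;> simp_all [insertMid_tmul, outerL₃_tmul, outerL_tmul]
  rw [brFstL_tmul, brFstL_tmul, brFstL_tmul, hB.leibniz_left, map_add, LinearMap.add_apply,
    arrow_naturality (d := d.toEnd) (d' := d.toEnd) (g := LinearMap.id) h1 (fun _ => rfl),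
    arrow_naturality (d := d.toEnd) (d' := d.toEnd) (g := LinearMap.id) h2 (fun _ => rfl)]
  rfl

end IsTwoFoldBracket

/-- The difference of the two sides of the Jacobi identity. -/
def doubleJacobi (d : NCDerivation F A) (B : DoubleBracket F A) (a b c : A) :
    LamPoly₂ (A ⊗[F] (A ⊗[F] A)) :=
  pmap (brL B a) (B b c) - swapVars (F := F) (pmap (brR B b) (B a c)) -
    nest (brFstL d B c) (B a b)

section

variable {d : NCDerivation F A} {B : DoubleBracket F A}

theorem doubleJacobi_der (hB : IsTwoFoldBracket d B) (a b c : A) :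
    doubleJacobi d B a b (d.toEnd c) =
      lamAdd (lamAdd (tensorD₃ d.toEnd)) (doubleJacobi d B a b c) := by
  rw [doubleJacobi, hB.sesq_right, hB.sesq_right, pmap_lamAdd (hB.brL_tensorD a),
    pmap_lamAdd (hB.brR_tensorD b), swapVars_lamAdd_lamAdd, hB.brFstL_der, nest_lamAdd,
    doubleJacobi, map_sub, map_sub]

/-- A consequence of the Jacobi expression being a derivation in its last argument. -/
theorem doubleJacobi_mul (hB : IsTwoFoldBracket d B) {a b c c' : A}
    (h : doubleJacobi d B a b c = 0) (h' : doubleJacobi d B a b c' = 0) :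
    doubleJacobi d B a b (c * c') = 0 := by
  rw [doubleJacobi, hB.leibniz_left, hB.leibniz_left, hB.brFstL_mul]
  exact jacobi_mul_zero (IsTwoFoldBracket.brL_outerR B a c') (hB.brL_outerL a c)
    (IsTwoFoldBracket.brR_outerL B b c) (hB.brR_outerR b c') h h'

theorem doubleJacobi_smul {e : F} {a b c : A} (h : doubleJacobi d B a b c = 0) :
    doubleJacobi d B a b (e • c) = 0 := by
  refine jacobi_smul_zero (T := brFstL d B) (fun c v => ?_) (B b) (B a) (B a b) h
  have e1 : brFstL d B (e • c) = e • brFstL d B c := by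
    ext1
    ext1 x
    ext1 y
    change brFstL d B (e • c) (x ⊗ₜ y) = e • brFstL d B c (x ⊗ₜ y)
    simp only [brFstL_tmul, map_smul, LinearMap.smul_apply]
  rw [e1, LinearMap.smul_apply]

theorem doubleJacobi_add {a b c c' : A} (h : doubleJacobi d B a b c = 0)
    (h' : doubleJacobi d B a b c' = 0) : doubleJacobi d B a b (c + c') = 0 := by
  refine jacobi_add_zero (T := brFstL d B) (fun c c' v => ?_) (B b) (B a) (B a b) h h'
  have e1 : brFstL d B (c + c') = brFstL d B c + brFstL d B c' := by
    ext1
    ext1 x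
    ext1 y
    change brFstL d B (c + c') (x ⊗ₜ y) = brFstL d B c (x ⊗ₜ y) + brFstL d B c' (x ⊗ₜ y)
    simp only [brFstL_tmul, map_add, LinearMap.add_apply]
  rw [e1, LinearMap.add_apply]

theorem doubleJacobi_one (hB : IsTwoFoldBracket d B) (a b : A) :
    doubleJacobi d B a b 1 = 0 := by
  have h1 : ∀ a, B a 1 = 0 := ((isTwoFoldBracket_iff d B).1 hB).one_right
  have h2 : brFstL d B 1 = brFstL d B 0 := by
    ext1
    ext1 x
    ext1 y
    change brFstL d B 1 (x ⊗ₜ y) = brFstL d B 0 (x ⊗ₜ y)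
    rw [brFstL_tmul, brFstL_tmul, h1, map_zero (B x)]
  have h3 : ∀ v, brFstL d B 0 v = 0 := fun v => by
    induction v with
    | zero => simp
    | add v w hv hw => rw [map_add, hv, hw, add_zero]
    | tmul x y => rw [brFstL_tmul, map_zero, map_zero, LinearMap.zero_apply]
  have e1 : B b 1 = B b 0 := by rw [h1, map_zero]
  have e2 : B a 1 = B a 0 := by rw [h1, map_zero]
  rw [doubleJacobi, e1, e2, h2]
  exact jacobi_zero_zero (T := brFstL d B) h3 (B b) (B a) (B a b)

theorem brL_comm (B : DoubleBracket F A) (a : A) (v : A ⊗[F] A) :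
    brL B a ((TensorProduct.comm F A A).toLinearMap v) =
      pmap (rotate₃ (F := F)) (brR B a v) := by
  induction v with
  | zero => simp
  | add v w hv hw => simp only [map_add, hv, hw]
  | tmul x y =>
    change brL B a (y ⊗ₜ x) = _
    rw [brL_tmul, brR_tmul, pmap_pmap]
    rfl

theorem brR_comm
    (skew : ∀ a b, B a b = -negSub (tensorD d.toEnd)
      (pmap (TensorProduct.comm F A A).toLinearMap (B b a))) (b : A) (v : A ⊗[F] A) :
    brR B b ((TensorProduct.comm F A A).toLinearMap v) =
      -negSub (tensorD₃ d.toEnd) (pmap (rotate₃ (F := F)) (brFstL d B b v)) := by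
  induction v with
  | zero => simp
  | add v w hv hw => simp only [map_add, hv, hw, neg_add]
  | tmul x y =>
    change brR B b (y ⊗ₜ x) = _
    rw [brR_tmul, brFstL_tmul, skew b x, negSub_comm (tensorD₃_rotate₃ d.toEnd),
      negSub_arrow (tensorD₃_insertMid d.toEnd), map_neg, negSub_comm (tensorD_comm d.toEnd),
      pmap_pmap, pmap_pmap]
    congr 3
    ext s t
    simp [rotate₃_tmul, insertMid_tmul]

theorem brFstL_eq
    (skew : ∀ a b, B a b = -negSub (tensorD d.toEnd)
      (pmap (TensorProduct.comm F A A).toLinearMap (B b a))) (c : A) (v : A ⊗[F] A) :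
    brFstL d B c v = -negSub (tensorD₃ d.toEnd) (pmap (rotate₃ (F := F)) (brL B c v)) := by
  induction v with
  | zero => simp
  | add v w hv hw => simp only [map_add, hv, hw, neg_add]
  | tmul x y =>
    have e : pmap (rotate₃ (F := F)) (brL B c (x ⊗ₜ y)) = pmap (insertMid.flip y)
        (pmap (TensorProduct.comm F A A).toLinearMap (B c x)) := by
      rw [brL_tmul, pmap_pmap, pmap_pmap]
      congr 2
      ext s t
      simp [rotate₃_tmul, insertMid_tmul, appendR_tmul]
    rw [brFstL_tmul, e, skew x c, map_neg, LinearMap.neg_apply,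
      ← negSub_negSub (tensorD₃ d.toEnd) (arrow _ _ _ _),
      negSub_arrow (tensorD₃_insertMid d.toEnd), negSub_negSub]

/-- The symmetry of the Jacobi expression under cyclic permutations of its arguments.  It carries a
verification of the Jacobi identity in the last argument over to the other two. -/
theorem doubleJacobi_cyclic (hB : IsTwoFoldBracket d B)
    (skew : ∀ a b, B a b = -negSub (tensorD d.toEnd)
      (pmap (TensorProduct.comm F A A).toLinearMap (B b a))) (a b c : A) :
    doubleJacobi d B a b c = negSub (lamAdd (tensorD₃ d.toEnd))
      (swapVars (F := F) (pmap (pmap (rotate₃ (F := F))) (doubleJacobi d B c a b))) := by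
  refine jacobi_cyclic (σ := (TensorProduct.comm F A A).toLinearMap) (skew b c) (skew a c)
    (hB.brL_tensorD a) (hB.brR_tensorD b) (brL_comm B a) (fun v => ?_) (fun v => ?_)
  · exact brR_comm skew b v
  · exact brFstL_eq skew c v

theorem IsTwoFoldBracket.skew_of_generators {G : Set A} (hG : DiffGeneratedBy d.toEnd G)
    (hB : IsTwoFoldBracket d B)
    (hskew : ∀ a ∈ G, ∀ b ∈ G, B a b = -negSub (tensorD d.toEnd)
      (pmap (TensorProduct.comm F A A).toLinearMap (B b a))) (a b : A) :
    B a b = -negSub (tensorD d.toEnd) (pmap (TensorProduct.comm F A A).toLinearMap (B b a)) := by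
  have h1 : ∀ v : A ⊗[F] A, (TensorProduct.comm F A A).toLinearMap
      ((TensorProduct.comm F A A).toLinearMap v) = v := fun v => by simp
  have h2 : ∀ (v : A ⊗[F] A) (b : A), (TensorProduct.comm F A A).toLinearMap (star₁R v b) =
      outerR b ((TensorProduct.comm F A A).toLinearMap v) := fun v b => by
    induction v with
    | zero => simp
    | add v w hv hw => simp only [map_add, LinearMap.add_apply, hv, hw]
    | tmul x y => simp [star₁R_tmul, outerR_tmul]
  have h3 : ∀ (v : A ⊗[F] A) (b : A), (TensorProduct.comm F A A).toLinearMap (star₁L v b) =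
      outerL b ((TensorProduct.comm F A A).toLinearMap v) := fun v b => by
    induction v with
    | zero => simp
    | add v w hv hw => simp only [map_add, LinearMap.add_apply, hv, hw]
    | tmul x y => simp [star₁L_tmul, outerL_tmul]
  exact LeibnizData.IsBracket.skew_of_generators (S := doubleData d) hG
    ((isTwoFoldBracket_iff d B).1 hB) h1 (tensorD_comm d.toEnd) h2 h3 hskew a b

/-- A 2-fold bracket is a double PVA structure if skewsymmetry and the Jacobi identity hold on
differential generators. -/
theorem IsTwoFoldBracket.isDoublePVA {G : Set A} (hG : DiffGeneratedBy d.toEnd G)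
    (hB : IsTwoFoldBracket d B)
    (hskew : ∀ a ∈ G, ∀ b ∈ G, B a b = -negSub (tensorD d.toEnd)
      (pmap (TensorProduct.comm F A A).toLinearMap (B b a)))
    (hjac : ∀ a ∈ G, ∀ b ∈ G, ∀ c ∈ G, doubleJacobi d B a b c = 0) : IsDoublePVA d B := by
  have skew := hB.skew_of_generators hG hskew
  have ext : ∀ a b, (∀ c ∈ G, doubleJacobi d B a b c = 0) → ∀ c, doubleJacobi d B a b c = 0 := by
    intro a b h c
    refine hG.induction c h (fun c hc => ?_) ?_ (fun e c hc => ?_) (fun c c' hc hc' => ?_)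
      (fun c c' hc hc' => ?_)
    · rw [doubleJacobi_der hB, hc, map_zero]
    · exact doubleJacobi_one hB a b
    · exact doubleJacobi_smul hc
    · exact doubleJacobi_add hc hc'
    · exact doubleJacobi_mul hB hc hc'
  have cyc : ∀ a b c, doubleJacobi d B c a b = 0 → doubleJacobi d B a b c = 0 := fun a b c h => by
    rw [doubleJacobi_cyclic hB skew, h, map_zero, map_zero, map_zero]
  have h1 : ∀ a ∈ G, ∀ b ∈ G, ∀ c, doubleJacobi d B a b c = 0 := fun a ha b hb =>
    ext a b (hjac a ha b hb)
  have h2 : ∀ a ∈ G, ∀ b c, doubleJacobi d B a b c = 0 := fun a ha b =>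
    ext a b fun c hc => cyc a b c (h1 c hc a ha b)
  have h3 : ∀ a b c, doubleJacobi d B a b c = 0 := fun a b =>
    ext a b fun c hc => cyc a b c (h2 c hc a b)
  exact { toIsTwoFoldBracket := hB, skew := skew, jacobi := fun a b c => sub_eq_zero.1 (h3 a b c) }

end

end Double

/-! ### Poisson vertex algebras -/

section Commutative

variable {F : Type*} [Field F] {A : Type*} [CommRing A] [Algebra F A]

/-- The data for `λ`-brackets on a commutative differential algebra. -/
def commData (d : Derivation F A A) : LeibnizData F A A where
  d := d.toLinearMap
  dV := d.toLinearMap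
  oL := LinearMap.mul F A
  oR := LinearMap.mul F A
  sL := LinearMap.mul F A
  sR := LinearMap.mul F A
  d_mul a b := by simp [mul_comm, add_comm]
  dV_oL a b := by simp [mul_comm, add_comm]
  dV_oR a b := by simp [mul_comm, add_comm]
  dV_sL a b := by simp [mul_comm, add_comm]
  dV_sR a b := by simp [mul_comm, add_comm]
  outer :=
    { l_one := fun v => by simp
      l_mul := fun a b v => by simp [mul_assoc]
      r_one := fun v => by simp
      r_mul := fun a b v => by simp [mul_left_comm, mul_assoc]
      comm := fun a b v => by simp [mul_left_comm] }
  inner :=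
    { l_one := fun v => by simp
      l_mul := fun a b v => by
        change v * (a * b) = v * b * a
        ring
      r_one := fun v => by simp
      r_mul := fun a b v => (mul_assoc v a b).symm
      comm := fun a b v => mul_right_comm v b a }
  sL_oL v a b := by simp [mul_assoc]
  sL_oR v a b := by simp [mul_assoc]
  sR_oL v a b := by simp [mul_assoc]
  sR_oR v a b := by simp [mul_assoc]

theorem mulRight_eq_mul (a : A) : LinearMap.mulRight F a = LinearMap.mul F A a :=
  LinearMap.ext fun b => mul_comm b a

theorem isLambdaBracket_iff (d : Derivation F A A) (B : LambdaBracket F A) :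
    IsLambdaBracket d B ↔ (commData d).IsBracket B := by
  refine ⟨fun h => ⟨h.sesq_left, h.sesq_right, fun a b c => ?_, h.leibniz_right⟩,
    fun h => ⟨h.sesq_left, h.sesq_right, fun a b c => ?_, h.leibniz_right⟩⟩
  · rw [h.leibniz_left, mulRight_eq_mul, mulRight_eq_mul]
    rfl
  · rw [h.leibniz_left, mulRight_eq_mul, mulRight_eq_mul]
    rfl

/-- The difference of the two sides of the Jacobi identity. -/
def commJacobi (B : LambdaBracket F A) (a b c : A) : LamPoly₂ A :=
  pmap (B a) (B b c) - swapVars (F := F) (pmap (B b) (B a c)) - nest (B.flip c) (B a b)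

variable {d : Derivation F A A} {B : LambdaBracket F A}

theorem commJacobi_der (hB : IsLambdaBracket d B) (a b c : A) :
    commJacobi B a b (d c) = lamAdd (lamAdd d.toLinearMap) (commJacobi B a b c) := by
  have h : B.flip (d c) = lamAdd d.toLinearMap ∘ₗ B.flip c :=
    LinearMap.ext fun x => hB.sesq_right x c
  rw [commJacobi, hB.sesq_right, hB.sesq_right, pmap_lamAdd (f := B a) (hB.sesq_right a),
    pmap_lamAdd (f := B b) (hB.sesq_right b), swapVars_lamAdd_lamAdd, h, nest_lamAdd, commJacobi,
    map_sub, map_sub]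

theorem commJacobi_mul (hB : IsLambdaBracket d B) (a b c c' : A) :
    commJacobi B a b (c * c') =
      pmap (pmap (LinearMap.mulRight F c')) (commJacobi B a b c) +
        pmap (pmap (LinearMap.mulRight F c)) (commJacobi B a b c') := by
  have h : B.flip (c * c') = pmap (LinearMap.mulRight F c') ∘ₗ B.flip c +
      pmap (LinearMap.mulRight F c) ∘ₗ B.flip c' :=
    LinearMap.ext fun x => hB.leibniz_left x c c'
  have h2 : ∀ v : A, LinearMap.mulRight F v = (LinearMap.mul F A).flip v := fun v => rfl
  rw [commJacobi, hB.leibniz_left, hB.leibniz_left, h]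
  refine jacobi_derivation (τ := LinearMap.mul F A) (τ' := LinearMap.mul F A) (fun v => ?_)
    (fun v => ?_) (fun v => ?_) (fun v => ?_)
  · exact hB.leibniz_left a v c'
  · exact hB.leibniz_left a v c
  · rw [← mulRight_eq_mul]
    exact hB.leibniz_left b v c
  · rw [← mulRight_eq_mul]
    exact hB.leibniz_left b v c'

theorem commJacobi_one (hB : IsLambdaBracket d B) (a b : A) : commJacobi B a b 1 = 0 := by
  have h := commJacobi_mul hB a b 1 1
  have e : LinearMap.mulRight F (1 : A) = LinearMap.id := LinearMap.ext mul_one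
  have e' : pmap (LinearMap.id : A →ₗ[F] A) = LinearMap.id := LinearMap.ext pmap_id
  rw [mul_one, e, e', pmap_id] at h
  exact left_eq_add.1 h

theorem commJacobi_smul {a b c : A} (e : F) (h : commJacobi B a b c = 0) :
    commJacobi B a b (e • c) = 0 :=
  jacobi_smul_zero (T := fun c => B.flip c)
    (fun c v => by rw [map_smul, LinearMap.smul_apply]) (B b) (B a) (B a b) h

theorem commJacobi_add (a b c c' : A) :
    commJacobi B a b (c + c') = commJacobi B a b c + commJacobi B a b c' := by
  rw [commJacobi, commJacobi, commJacobi, map_add, map_add, map_add, map_add, map_add, map_add,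
    nest_add]
  abel

/-- The symmetry of the Jacobi expression in its last two arguments. -/
theorem commJacobi_right_comm (hB : IsLambdaBracket d B)
    (skew : ∀ a b, B a b = -negSub d.toLinearMap (B b a)) (a b c : A) :
    commJacobi B a b c = -negSub (lamAdd d.toLinearMap) (commJacobi B a c b) := by
  have key : ∀ (b : A) (p : LamPoly A), nest (B.flip b) p =
      -negSub (lamAdd d.toLinearMap) (swapVars (F := F) (pmap (B b) p)) := by
    intro b p
    rw [negSub_swapVars_pmap (g := -B.flip b) (fun m => ?_), nest_neg, neg_neg]
    rw [LinearMap.neg_apply, LinearMap.flip_apply, skew m b, neg_neg]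
  rw [commJacobi, commJacobi, skew b c, map_neg, pmap_negSub (f := B a) (hB.sesq_right a), key c,
    map_sub, map_sub, key b, map_neg, negSub_negSub]
  abel

/-- The symmetry of the Jacobi expression in its first two arguments. -/
theorem commJacobi_left_comm (hB : IsLambdaBracket d B)
    (skew : ∀ a b, B a b = -negSub d.toLinearMap (B b a)) (a b c : A) :
    commJacobi B b a c = -swapVars (F := F) (commJacobi B a b c) := by
  rw [commJacobi, commJacobi, skew b a, map_neg,
    nest_negSub (d := d.toLinearMap) (g := B.flip c) (fun m => hB.sesq_left m c),
    map_sub, map_sub, swapVars_swapVars]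
  abel

/-- A `λ`-bracket is a PVA structure if skewsymmetry and the Jacobi identity hold on differential
generators. -/
theorem IsLambdaBracket.isPVA {G : Set A} (hG : DiffGeneratedBy d.toLinearMap G)
    (hB : IsLambdaBracket d B)
    (hskew : ∀ a ∈ G, ∀ b ∈ G, B a b = -negSub d.toLinearMap (B b a))
    (hjac : ∀ a ∈ G, ∀ b ∈ G, ∀ c ∈ G, commJacobi B a b c = 0) : IsPVA d B := by
  have skew : ∀ a b, B a b = -negSub d.toLinearMap (B b a) := by
    intro a b
    have := LeibnizData.IsBracket.skew_of_generators (S := commData d) hG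
      ((isLambdaBracket_iff d B).1 hB) (σ := LinearMap.id) (fun _ => rfl) (fun _ => rfl)
      (fun v b => mul_comm v b) (fun v b => mul_comm v b)
      (fun a ha b hb => by rw [pmap_id]; exact hskew a ha b hb) a b
    rw [pmap_id] at this
    exact this
  have ext : ∀ a b, (∀ c ∈ G, commJacobi B a b c = 0) → ∀ c, commJacobi B a b c = 0 := by
    intro a b h c
    refine hG.induction c h (fun c hc => ?_) ?_ (fun e c hc => ?_) (fun c c' hc hc' => ?_)
      (fun c c' hc hc' => ?_)
    · exact (commJacobi_der hB a b c).trans (by rw [hc, map_zero])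
    · exact commJacobi_one hB a b
    · exact commJacobi_smul e hc
    · rw [commJacobi_add, hc, hc', add_zero]
    · rw [commJacobi_mul hB, hc, hc', map_zero, map_zero, add_zero]
  have rc : ∀ a b c, commJacobi B a c b = 0 → commJacobi B a b c = 0 := fun a b c h => by
    rw [commJacobi_right_comm hB skew, h, map_zero, neg_zero]
  have lc : ∀ a b c, commJacobi B a b c = 0 → commJacobi B b a c = 0 := fun a b c h => by
    rw [commJacobi_left_comm hB skew, h, map_zero, neg_zero]
  have h2 : ∀ a ∈ G, ∀ b c, commJacobi B a b c = 0 := fun a ha b =>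
    ext a b fun c hc => rc a b c (ext a c (hjac a ha c hc) b)
  have h3 : ∀ a b c, commJacobi B a b c = 0 := fun a b =>
    ext a b fun c hc => rc a b c (lc c a b (h2 c hc a b))
  exact { toIsLambdaBracket := hB, skew := skew, jacobi := fun a b c => sub_eq_zero.1 (h3 a b c) }

end Commutative

/-! ### Induced brackets on the representation algebras -/

section JacobiInduced

variable {F : Type*} [Field F]
variable {M M' P P' Q Q' : Type*} [AddCommGroup M] [Module F M] [AddCommGroup M'] [Module F M']
  [AddCommGroup P] [Module F P] [AddCommGroup P'] [Module F P'] [AddCommGroup Q] [Module F Q]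
  [AddCommGroup Q'] [Module F Q']

theorem arrow_naturality_sum {ι : Type*} (s : Finset ι) {d : Module.End F P} {d' : Module.End F P'}
    {β : M →ₗ[F] P →ₗ[F] Q} {β' : M' →ₗ[F] P' →ₗ[F] Q'} {f : ι → M →ₗ[F] M'}
    {g : ι → P →ₗ[F] P'} {h : Q →ₗ[F] Q'}
    (hβ : ∀ m v, h (β m v) = ∑ l ∈ s, β' (f l m) (g l v)) (hd : ∀ l v, g l (d v) = d' (g l v))
    (p : LamPoly M) (v : P) :
    pmap h (arrow d β p v) = ∑ l ∈ s, arrow d' β' (pmap (f l) p) (g l v) := by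
  refine lamPoly_induction (F := F) (p := fun p => ∀ v, pmap h (arrow d β p v) =
    ∑ l ∈ s, arrow d' β' (pmap (f l) p) (g l v)) p (fun m v => ?_) (fun a b ha hb v => ?_)
    (fun a ha v => ?_) v
  · simp only [arrow_const, pmap_const, hβ, map_sum]
  · simp only [map_add, LinearMap.add_apply, ha, hb, Finset.sum_add_distrib]
  · simp only [arrow_lam, pmap_lam, map_add, ha, hd, Finset.sum_add_distrib, map_sum]

/-- The formal mechanism by which a double Jacobi identity induces a Jacobi identity on the
representation algebras.  The three terms of the induced identity for `a`, `b`, `c` are sums of two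
terms each, corresponding to the two factors of `x_{ij} y_{hk}`; those with `φ₁` are the double
Jacobi identity for `(a, b, c)`, and those with `φ₂` are the one for `(b, a, c)`. -/
theorem jacobi_induced {V W C : Type*} [AddCommGroup V] [Module F V] [AddCommGroup W] [Module F W]
    [AddCommGroup C] [Module F C] {La Lb Ra Rb T : V →ₗ[F] LamPoly W} {φ₁ φ₂ : W →ₗ[F] C}
    {ι₁ ι₂ ι₃ : V →ₗ[F] C} {Ma Mb Mc : C →ₗ[F] LamPoly C} {σ dV : Module.End F V}
    {ac bc ab ba : LamPoly V}
    (hA : ∀ v, Ma (ι₁ v) = pmap φ₁ (La v) + pmap φ₂ (Ra v))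
    (hB : ∀ v, Mb (ι₂ v) = pmap φ₂ (Lb v) + pmap φ₁ (Rb v))
    (hC : ∀ v, Mc (ι₃ v) = pmap φ₁ (T v) + pmap φ₂ (T (σ v)))
    (hT : ∀ v, T (dV v) = -lam (F := F) (T v)) (hσ : pmap σ ab = -negSub dV ba)
    (J₁ : pmap La bc - swapVars (F := F) (pmap Rb ac) = nest T ab)
    (J₂ : pmap Lb ac - swapVars (F := F) (pmap Ra bc) = nest T ba) :
    pmap Ma (pmap ι₁ bc) - swapVars (F := F) (pmap Mb (pmap ι₂ ac)) - nest Mc (pmap ι₃ ab) = 0 := by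
  have key : ∀ {M : C →ₗ[F] LamPoly C} {ι : V →ₗ[F] C} {φ φ' : W →ₗ[F] C}
      {X Y : V →ₗ[F] LamPoly W}
      (_ : ∀ v, M (ι v) = pmap φ (X v) + pmap φ' (Y v)),
      M ∘ₗ ι = pmap φ ∘ₗ X + pmap φ' ∘ₗ Y := fun h => LinearMap.ext h
  have eA : pmap Ma (pmap ι₁ bc) =
      pmap (pmap φ₁) (pmap La bc) + pmap (pmap φ₂) (pmap Ra bc) := by
    rw [pmap_pmap, pmap_pmap, pmap_pmap, key hA, map_add, LinearMap.add_apply]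
  have eB : swapVars (F := F) (pmap Mb (pmap ι₂ ac)) =
      pmap (pmap φ₂) (swapVars (F := F) (pmap Lb ac)) +
        pmap (pmap φ₁) (swapVars (F := F) (pmap Rb ac)) := by
    rw [← swapVars_pmap_pmap, ← swapVars_pmap_pmap, ← map_add, pmap_pmap, pmap_pmap, pmap_pmap,
      key hB, map_add, LinearMap.add_apply]
  have eC : nest Mc (pmap ι₃ ab) = pmap (pmap φ₁) (nest T ab) -
      pmap (pmap φ₂) (swapVars (F := F) (nest T ba)) := by
    have hC' : Mc ∘ₗ ι₃ = pmap φ₁ ∘ₗ T + pmap φ₂ ∘ₗ (T ∘ₗ σ) := LinearMap.ext hC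
    rw [nest_pmap, hC', nest_add, pmap_nest, pmap_nest, ← nest_pmap, hσ, map_neg, nest_negSub hT,
      map_neg, sub_eq_add_neg]
  rw [eA, eB, eC, ← J₁, ← J₂, map_sub, map_sub, map_sub, swapVars_swapVars]
  abel

end JacobiInduced

section Rep

variable {F : Type*} [Field F] {A : Type*} [Ring A] [Algebra F A] {m : ℕ}

theorem inducedMap_tmul (i j h k : Fin m) (x y : A) :
    inducedMap i j h k (x ⊗ₜ[F] y) = coord (F := F) h j x * coord (F := F) i k y := rfl

theorem inducedMap_tensorD (d : NCDerivation F A) (i j h k : Fin m) (v : A ⊗[F] A) :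
    inducedMap i j h k (tensorD d.toEnd v) = (repD d).toLinearMap (inducedMap i j h k v) := by
  induction v with
  | zero => simp
  | add v w hv hw => simp only [map_add, hv, hw]
  | tmul x y =>
    change _ = repD d (coord (F := F) h j x * coord (F := F) i k y)
    simp only [tensorD_tmul, map_add, inducedMap_tmul, Derivation.leibniz, repD_coord, smul_eq_mul]
    ring

theorem inducedMap_outerR (i j h k : Fin m) (c : A) (v : A ⊗[F] A) :
    inducedMap i j h k (outerR c v) =
      ∑ l, LinearMap.mulRight F (coord (F := F) l k c) (inducedMap i j h l v) := by
  induction v with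
  | zero => simp
  | add v w hv hw => simp only [map_add, hv, hw, Finset.sum_add_distrib]
  | tmul x y =>
    simp only [outerR_tmul, inducedMap_tmul, coord_mul, Finset.mul_sum, LinearMap.mulRight_apply,
      mul_assoc]

theorem inducedMap_outerL (i j h k : Fin m) (b : A) (v : A ⊗[F] A) :
    inducedMap i j h k (outerL b v) =
      ∑ l, LinearMap.mulRight F (coord (F := F) h l b) (inducedMap i j l k v) := by
  induction v with
  | zero => simp
  | add v w hv hw => simp only [map_add, hv, hw, Finset.sum_add_distrib]
  | tmul x y =>
    simp only [outerL_tmul, inducedMap_tmul, coord_mul, Finset.sum_mul, LinearMap.mulRight_apply]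
    exact Finset.sum_congr rfl fun l _ => by ring

theorem inducedMap_star₁R (i j h k : Fin m) (v : A ⊗[F] A) (b : A) :
    inducedMap i j h k (star₁R v b) =
      ∑ l, LinearMap.mul F _ (inducedMap i l h k v) (coord (F := F) l j b) := by
  induction v with
  | zero => simp
  | add v w hv hw => simp only [map_add, LinearMap.add_apply, hv, hw, Finset.sum_add_distrib]
  | tmul x y =>
    simp only [star₁R_tmul, inducedMap_tmul, coord_mul, Finset.sum_mul, LinearMap.mul_apply']
    exact Finset.sum_congr rfl fun l _ => by ring

theorem inducedMap_star₁L (i j h k : Fin m) (v : A ⊗[F] A) (b : A) :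
    inducedMap i j h k (star₁L v b) =
      ∑ l, LinearMap.mul F _ (inducedMap l j h k v) (coord (F := F) i l b) := by
  induction v with
  | zero => simp
  | add v w hv hw => simp only [map_add, LinearMap.add_apply, hv, hw, Finset.sum_add_distrib]
  | tmul x y =>
    simp only [star₁L_tmul, inducedMap_tmul, coord_mul, Finset.mul_sum, LinearMap.mul_apply']
    exact Finset.sum_congr rfl fun l _ => by ring

theorem inducedMap_comm (i j h k : Fin m) (v : A ⊗[F] A) :
    inducedMap i j h k ((TensorProduct.comm F A A).toLinearMap v) = inducedMap h k i j v := by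
  induction v with
  | zero => simp
  | add v w hv hw => simp only [map_add, hv, hw]
  | tmul x y => exact mul_comm (coord (F := F) h j y) (coord (F := F) i k x)

/-- An induced bracket can be recognized on differential generators. -/
theorem isInduced_of_generators {d : NCDerivation F A} {G : Set A} (hG : DiffGeneratedBy d.toEnd G)
    {B : DoubleBracket F A} (hB : IsTwoFoldBracket d B)
    {Bm : LambdaBracket F (RepAlg F A m)} (hBm : IsLambdaBracket (repD d) Bm)
    (hG' : ∀ a ∈ G, ∀ b ∈ G, ∀ i j h k : Fin m,
      Bm (coord (F := F) i j a) (coord (F := F) h k b) = pmap (inducedMap i j h k) (B a b)) :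
    IsInduced B Bm := by
  have hB' := (isTwoFoldBracket_iff d B).1 hB
  have hBm' := (isLambdaBracket_iff (repD d) Bm).1 hBm
  have ext : ∀ a, (∀ b ∈ G, ∀ i j h k : Fin m,
      Bm (coord (F := F) i j a) (coord (F := F) h k b) = pmap (inducedMap i j h k) (B a b)) →
      ∀ b, ∀ i j h k : Fin m,
      Bm (coord (F := F) i j a) (coord (F := F) h k b) = pmap (inducedMap i j h k) (B a b) := by
    intro a ha b
    refine hG.induction b ha (fun b hb i j h k => ?_) (fun i j h k => ?_) (fun e b hb i j h k => ?_)
      (fun b b' hb hb' i j h k => ?_) (fun b b' hb hb' i j h k => ?_)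
    · rw [← repD_coord, hBm.sesq_right, hb, hB.sesq_right,
        pmap_lamAdd (inducedMap_tensorD d i j h k)]
    · rw [coord_one, hB'.one_right, map_zero]
      split_ifs
      · exact hBm'.one_right _
      · exact map_zero _
    · rw [map_smul, map_smul, hb, map_smul, map_smul]
    · rw [map_add, map_add, hb, hb', map_add, map_add]
    · have e1 : inducedMap i j h k ∘ₗ outerR b' =
          ∑ l, LinearMap.mulRight F (coord (F := F) l k b') ∘ₗ inducedMap i j h l :=
        LinearMap.ext fun v => by simpa using inducedMap_outerR i j h k b' v
      have e2 : inducedMap i j h k ∘ₗ outerL b =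
          ∑ l, LinearMap.mulRight F (coord (F := F) h l b) ∘ₗ inducedMap i j l k :=
        LinearMap.ext fun v => by simpa using inducedMap_outerL i j h k b v
      rw [coord_mul, map_sum, hB.leibniz_left, map_add, pmap_pmap, pmap_pmap, e1, e2, map_sum,
        map_sum, LinearMap.sum_apply, LinearMap.sum_apply, ← Finset.sum_add_distrib]
      refine Finset.sum_congr rfl fun l _ => ?_
      rw [hBm.leibniz_left, hb, hb', pmap_pmap, pmap_pmap]
  intro a b i j h k
  revert b i j h k
  refine hG.induction a (fun a ha => ext a (hG' a ha)) (fun a ha b i j h k => ?_)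
    (fun b i j h k => ?_) (fun e a ha b i j h k => ?_) (fun a a' ha ha' b i j h k => ?_)
    (fun a a' ha ha' b i j h k => ?_)
  · rw [← repD_coord, hBm.sesq_left, ha, hB.sesq_left, map_neg, pmap_lam]
  · rw [coord_one, hB'.one_left, map_zero]
    split_ifs
    · exact hBm'.one_left _
    · rw [map_zero, LinearMap.zero_apply]
  · rw [map_smul, map_smul, LinearMap.smul_apply, ha, map_smul, LinearMap.smul_apply, map_smul]
  · rw [map_add, map_add, LinearMap.add_apply, ha, ha', map_add, LinearMap.add_apply, map_add]
  · rw [coord_mul, map_sum, LinearMap.sum_apply, hB.leibniz_right, map_add,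
      arrow_naturality_sum Finset.univ (d' := (repD d).toLinearMap)
        (inducedMap_star₁R i j h k) (fun l v => (repD_coord d l j v).symm),
      arrow_naturality_sum Finset.univ (d' := (repD d).toLinearMap)
        (inducedMap_star₁L i j h k) (fun l v => (repD_coord d i l v).symm),
      ← Finset.sum_add_distrib]
    refine Finset.sum_congr rfl fun l _ => ?_
    rw [hBm.leibniz_right, ha, ha']

theorem diffGeneratedBy_coord {d : NCDerivation F A} {G : Set A} (hG : DiffGeneratedBy d.toEnd G) :
    DiffGeneratedBy (repD (m := m) d).toLinearMap
      {x | ∃ (i j : Fin m) (a : A), a ∈ G ∧ x = coord (F := F) i j a} := by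
  rw [DiffGeneratedBy]
  set T := Algebra.adjoin F {a : RepAlg F A m | ∃ g ∈ {x | ∃ (i j : Fin m) (a : A), a ∈ G ∧
    x = coord (F := F) i j a}, ∃ n : ℕ, a = ((repD d).toLinearMap ^ n) g} with hT
  have hc : ∀ (a : A) (i j : Fin m), coord (F := F) i j a ∈ T := by
    intro a
    refine adjoin_top_induction hG a ?_ (fun i j => ?_) (fun e a ha i j => ?_)
      (fun a b ha hb i j => ?_) (fun a b ha hb i j => ?_)
    · rintro _ ⟨g, hg, n, rfl⟩ i j
      exact Algebra.subset_adjoin ⟨_, ⟨i, j, g, hg, rfl⟩, n,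
        end_pow_comm (f := coord (F := F) i j) (fun a => (repD_coord d i j a).symm) n g⟩
    · rw [coord_one]
      split_ifs
      · exact one_mem T
      · exact zero_mem T
    · rw [map_smul]
      exact T.smul_mem (ha i j) e
    · rw [map_add]
      exact add_mem (ha i j) (hb i j)
    · rw [coord_mul]
      exact sum_mem fun l _ => mul_mem (ha i l) (hb l j)
  rw [eq_top_iff]
  intro x _
  obtain ⟨p, rfl⟩ := repMk_surjective x
  induction p using MvPolynomial.induction_on with
  | C c =>
    have := (repMk F A m).commutes c
    rw [MvPolynomial.algebraMap_eq] at this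
    rw [this]
    exact T.algebraMap_mem c
  | add p q hp hq =>
    rw [map_add]
    exact add_mem (hp trivial) (hq trivial)
  | mul_X p x hp =>
    rw [map_mul]
    exact mul_mem (hp trivial) (hc x.1 x.2.1 x.2.2)

/-- The linear map `x ⊗ y ⊗ z ↦ x_{ij} y_{hk} z_{pq}`. -/
def inducedMap₃ (i j h k p q : Fin m) : A ⊗[F] (A ⊗[F] A) →ₗ[F] RepAlg F A m :=
  TensorProduct.lift ((LinearMap.mul F (RepAlg F A m)).compl₁₂ (coord (F := F) i j)
    (inducedMap p k h q))

theorem inducedMap₃_tmul (i j h k p q : Fin m) (x y z : A) :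
    inducedMap₃ i j h k p q (x ⊗ₜ[F] (y ⊗ₜ[F] z)) =
      coord (F := F) i j x * (coord (F := F) h k y * coord (F := F) p q z) := rfl

/-- A bracket induced by a double PVA structure is a PVA structure. -/
theorem IsDoublePVA.isPVA_of_isInduced {d : NCDerivation F A} {B : DoubleBracket F A}
    (hB : IsDoublePVA d B) {Bm : LambdaBracket F (RepAlg F A m)}
    (hBm : IsLambdaBracket (repD d) Bm) (h : IsInduced B Bm) : IsPVA (repD d) Bm := by
  have htop : DiffGeneratedBy d.toEnd (Set.univ : Set A) := by
    rw [DiffGeneratedBy, eq_top_iff]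
    exact fun x _ => Algebra.subset_adjoin ⟨x, trivial, 0, rfl⟩
  refine hBm.isPVA (diffGeneratedBy_coord htop) ?_ ?_
  · rintro _ ⟨i, j, a, -, rfl⟩ _ ⟨h', k, b, -, rfl⟩
    rw [h, h, hB.skew, map_neg, ← negSub_comm (inducedMap_tensorD d i j h' k), pmap_pmap]
    congr 4
    exact LinearMap.ext (inducedMap_comm i j h' k)
  · rintro _ ⟨i, j, f, -, rfl⟩ _ ⟨h', k, g, -, rfl⟩ _ ⟨p, q, c, -, rfl⟩
    rw [commJacobi, h, h, h]
    -- the bracket with the product of an entry of `x` and an entry of `y` splits by the Leibniz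
    -- rule into the brackets with `x` and with `y`
    have hL : ∀ (i j h' k : Fin m) (f : A) (v : A ⊗[F] A),
        Bm (coord (F := F) i j f) (inducedMap h' k p q v) =
          pmap (inducedMap₃ p j i k h' q) (brL B f v) +
            pmap (inducedMap₃ p k h' j i q) (brR B f v) := by
      intro i j h' k f v
      induction v with
      | zero => simp
      | add v w hv hw =>
        simp only [map_add, hv, hw]
        abel
      | tmul x y =>
        rw [inducedMap_tmul, hBm.leibniz_left, h, h, brL_tmul, brR_tmul, pmap_pmap, pmap_pmap,
          pmap_pmap, pmap_pmap]
        congr 3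
        · ext s t
          simp [inducedMap_tmul, inducedMap₃_tmul, appendR_tmul, mul_assoc]
        · ext s t
          simp [inducedMap_tmul, inducedMap₃_tmul, mul_comm]
    refine jacobi_induced (σ := (TensorProduct.comm F A A).toLinearMap) (hL i j h' k f)
      (hL h' k i j g) (T := brFstL d B c) (fun v => ?_)
      (hB.toIsTwoFoldBracket.brFstL_tensorD c) ?_ (hB.jacobi f g c) (hB.jacobi g f c)
    · induction v with
      | zero => simp
      | add v w hv hw =>
        simp only [map_add, hv, hw]
        abel
      | tmul x y =>
        have h1 : ∀ (i j h k p q : Fin m) (v : A ⊗[F] A) (a : A),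
            inducedMap₃ i j h k p q (insertMid v a) =
              LinearMap.mul F _ (inducedMap p j i q v) (coord (F := F) h k a) := by
          intro i j h k p q v a
          induction v with
          | zero => simp
          | add v w hv hw => simp only [map_add, LinearMap.add_apply, hv, hw]
          | tmul s t =>
            rw [insertMid_tmul, inducedMap₃_tmul, inducedMap_tmul, LinearMap.mul_apply']
            ring
        change Bm _ (coord p q c) = pmap _ (brFstL d B c (x ⊗ₜ y)) +
          pmap _ (brFstL d B c (y ⊗ₜ x))
        rw [inducedMap_tmul, hBm.leibniz_right, h, h, brFstL_tmul, brFstL_tmul,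
          arrow_naturality (h1 _ _ _ _ _ _) (fun v => (repD_coord d _ _ v).symm),
          arrow_naturality (h1 _ _ _ _ _ _) (fun v => (repD_coord d _ _ v).symm)]
    · have h1 : (TensorProduct.comm F A A).toLinearMap ∘ₗ (TensorProduct.comm F A A).toLinearMap =
          LinearMap.id := LinearMap.ext fun v => by simp
      rw [hB.skew f g, map_neg, negSub_comm (tensorD_comm d.toEnd), pmap_pmap, h1, pmap_id]

theorem IsInduced.lin_comb {B B' : DoubleBracket F A} {Bm Bm' : LambdaBracket F (RepAlg F A m)}
    (h : IsInduced B Bm) (h' : IsInduced B' Bm') (α β : F) :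
    IsInduced (α • B + β • B') (α • Bm + β • Bm') := by
  intro a b i j k l
  simp only [LinearMap.add_apply, LinearMap.smul_apply, h a b, h' a b, map_add, map_smul]

end Rep

section PolynomialExt

variable {F : Type*} [Field F]

/-- Derivations of a commutative algebra that is polynomial on a family of elements can be
prescribed arbitrarily on this family. -/
theorem extendsDerivations_of_bijective {X A M : Type*} [CommRing A] [Algebra F A] [AddCommGroup M]
    [Module F M] {g : X → A} (hg : Function.Bijective (MvPolynomial.aeval (R := F) g))
    {l : A →ₗ[F] Module.End F M} (h : IsBimodule l l) : ExtendsDerivations g l l := by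
  intro f
  let φ : MvPolynomial X F ≃ₐ[F] A := AlgEquiv.ofBijective _ hg
  let lm : MvPolynomial X F →+* Module.End F M :=
    { toFun := fun p => l (φ p)
      map_one' := by rw [map_one]; exact LinearMap.ext h.l_one
      map_mul' := fun a b => by rw [map_mul]; exact LinearMap.ext fun x => h.l_mul _ _ x
      map_zero' := by rw [map_zero, map_zero]
      map_add' := fun a b => by rw [map_add, map_add] }
  let _ : Module (MvPolynomial X F) M := Module.compHom M lm
  have : IsScalarTower F (MvPolynomial X F) M := ⟨fun c a x => by
    change l (φ (c • a)) x = c • l (φ a) x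
    rw [map_smul, map_smul, LinearMap.smul_apply]⟩
  let D : Derivation F (MvPolynomial X F) M := MvPolynomial.mkDerivation F f
  have hφ : ∀ x, φ.symm (g x) = MvPolynomial.X x := fun x => by
    rw [AlgEquiv.symm_apply_eq]
    exact (MvPolynomial.aeval_X g x).symm
  refine ⟨D.toLinearMap ∘ₗ φ.symm.toLinearMap, fun x => ?_, fun a b => ?_⟩
  · change D (φ.symm (g x)) = f x
    rw [hφ]
    exact MvPolynomial.mkDerivation_X F f x
  · change D (φ.symm (a * b)) = l b (D (φ.symm a)) + l a (D (φ.symm b))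
    have e : ∀ (a : A) (x : M), φ.symm a • x = l a x := fun a x => by
      change l (φ (φ.symm a)) x = l a x
      rw [AlgEquiv.apply_symm_apply]
    rw [map_mul, D.leibniz, e, e, add_comm]

end PolynomialExt

/-! ### The representation algebras of noncommutative differential polynomials -/

section GenericMap

variable (F : Type*) [Field F] (S : Set ℤ) (m : ℕ)

/-- The generic matrix representation `f ↦ (f_{ij})` of `R_I` over the polynomial ring in the
`u_{i,ab}^{(n)}`. -/
def genericMatrix :
    DiffPoly F S →ₐ[F] Matrix (Fin m) (Fin m) (MvPolynomial ((S × ℕ) × Fin m × Fin m) F) :=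
  FreeAlgebra.lift F fun x => Matrix.of fun i j => MvPolynomial.X (x, i, j)

/-- The inverse of `genericMap`, sending `f_{ij}` to the entry of the generic matrix of `f`. -/
def genericInv : RepAlg F (DiffPoly F S) m →ₐ[F] MvPolynomial ((S × ℕ) × Fin m × Fin m) F :=
  Ideal.Quotient.liftₐ _ (MvPolynomial.aeval fun x => genericMatrix F S m x.1 x.2.1 x.2.2) <| by
    have h : Ideal.span {r | RepRel F (DiffPoly F S) m r} ≤ RingHom.ker
        (MvPolynomial.aeval fun x : DiffPoly F S × Fin m × Fin m =>
          genericMatrix F S m x.1 x.2.1 x.2.2).toRingHom := by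
      rw [Ideal.span_le]
      rintro r (⟨k, a, i, j⟩ | ⟨a, b, i, j⟩ | ⟨a, b, i, j⟩ | ⟨i, j⟩)
      · simp [RingHom.mem_ker, MvPolynomial.algebraMap_eq, MvPolynomial.smul_eq_C_mul]
      · simp [RingHom.mem_ker]
      · simp [RingHom.mem_ker, Matrix.mul_apply]
      · by_cases hij : i = j <;> simp [RingHom.mem_ker, hij]
    exact fun a ha => h ha

theorem genericInv_coord (i j : Fin m) (a : DiffPoly F S) :
    genericInv F S m (coord (F := F) i j a) = genericMatrix F S m a i j := by
  change MvPolynomial.aeval _ (MvPolynomial.X (a, i, j)) = _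
  rw [MvPolynomial.aeval_X]

/-- The representation `f ↦ (f_{ij})`. -/
def coordMatrix {A : Type*} [Ring A] [Algebra F A] :
    A →ₐ[F] Matrix (Fin m) (Fin m) (RepAlg F A m) :=
  AlgHom.ofLinearMap
    { toFun := fun a => Matrix.of fun i j => coord (F := F) i j a
      map_add' := fun a b => by ext; simp
      map_smul' := fun c a => by ext; simp }
    (by ext i j; simp [coord_one, Matrix.one_apply])
    (fun a b => by ext i j; simp [coord_mul, Matrix.mul_apply])

theorem genericMap_genericMatrix (i j : Fin m) (a : DiffPoly F S) :
    genericMap F S m (genericMatrix F S m a i j) = coord (F := F) i j a := by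
  have h : (genericMap F S m).mapMatrix.comp (genericMatrix F S m) = coordMatrix F m := by
    ext x i j
    simp [genericMatrix, genericMap, coordMatrix]
  exact congrFun (congrFun (DFunLike.congr_fun h a) i) j

theorem genericMap_bijective : Function.Bijective (genericMap F S m) := by
  refine ⟨Function.LeftInverse.injective (g := genericInv F S m) fun p => ?_,
    Function.RightInverse.surjective (g := genericInv F S m) fun x => ?_⟩
  · have h : (genericInv F S m).comp (genericMap F S m) = AlgHom.id F _ := by
      ext x
      simp [genericMap, genericInv_coord, genericMatrix]
    exact DFunLike.congr_fun h p
  · obtain ⟨p, rfl⟩ := repMk_surjective x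
    have h : ((genericMap F S m).comp (genericInv F S m)).comp (repMk F (DiffPoly F S) m) =
        repMk F (DiffPoly F S) m := by
      ext x
      change genericMap F S m (genericInv F S m (coord (F := F) x.2.1 x.2.2 x.1)) =
        coord (F := F) x.2.1 x.2.2 x.1
      rw [genericInv_coord, genericMap_genericMatrix]
    exact DFunLike.congr_fun h p

theorem diffGeneratedBy_ι : DiffGeneratedBy (diffD F S).toEnd
    (Set.range fun i : S => FreeAlgebra.ι F (i, 0)) := by
  rw [DiffGeneratedBy, eq_top_iff, ← FreeAlgebra.adjoin_range_ι]
  refine Algebra.adjoin_mono ?_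
  rintro _ ⟨⟨i, n⟩, rfl⟩
  refine ⟨_, ⟨i, rfl⟩, n, ?_⟩
  induction n with
  | zero => rfl
  | succ n ih => rw [pow_succ', Module.End.mul_apply, ← ih, diffD_ι]

/-- Every 2-fold bracket on `R_I` induces a `λ`-bracket on `(R_I)_m`. -/
theorem exists_isInduced {B : DoubleBracket F (DiffPoly F S)}
    (hB : IsTwoFoldBracket (diffD F S) B) :
    ∃ Bm : LambdaBracket F (RepAlg F (DiffPoly F S) m),
      IsLambdaBracket (repD (diffD F S)) Bm ∧ IsInduced B Bm := by
  let g : (S × Fin m × Fin m) × ℕ → RepAlg F (DiffPoly F S) m :=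
    fun x => coord (F := F) x.1.2.1 x.1.2.2 (FreeAlgebra.ι F (x.1.1, x.2))
  let e : (S × Fin m × Fin m) × ℕ ≃ (S × ℕ) × Fin m × Fin m :=
    { toFun := fun x => ((x.1.1, x.2), x.1.2)
      invFun := fun x => ((x.1.1, x.2), x.1.2)
      left_inv := fun _ => rfl
      right_inv := fun _ => rfl }
  have hg : Function.Bijective (MvPolynomial.aeval (R := F) g) := by
    have h : MvPolynomial.aeval (R := F) g =
        (genericMap F S m).comp (MvPolynomial.renameEquiv F e).toAlgHom := by
      ext x
      simp [g, e, genericMap]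
    rw [h]
    exact (genericMap_bijective F S m).comp (MvPolynomial.renameEquiv F e).bijective
  have hgen : Algebra.adjoin F (Set.range g) = ⊤ := by
    rw [Algebra.adjoin_range_eq_range_aeval]
    exact AlgHom.range_eq_top _ |>.2 hg.2
  obtain ⟨Bm, hBm, hv⟩ := (commData (repD (diffD F S))).exists_isBracket g hgen
    (fun x n => by
      change repD (diffD F S) _ = _
      rw [repD_coord, diffD_ι])
    (extendsDerivations_of_bijective hg (commData (repD (diffD F S))).coeff_isBimodule)
    (extendsDerivations_of_bijective hg (commData (repD (diffD F S))).arrow_isBimodule.postcomp)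
    (fun x y => pmap (inducedMap x.2.1 x.2.2 y.2.1 y.2.2)
      (B (FreeAlgebra.ι F (x.1, 0)) (FreeAlgebra.ι F (y.1, 0))))
  have hBm' := (isLambdaBracket_iff _ _).2 hBm
  refine ⟨Bm, hBm', isInduced_of_generators (diffGeneratedBy_ι F S) hB hBm' ?_⟩
  rintro _ ⟨x, rfl⟩ _ ⟨y, rfl⟩ i j h k
  exact hv (x, i, j) (y, h, k)

end GenericMap

/-! ### Transfer to commuting operators -/

section Transfer

variable {F : Type*} [Field F]
variable {M Q : Type*} [AddCommGroup M] [Module F M] [AddCommGroup Q] [Module F Q]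

/-- The coefficients lie in the image of `ℤ[X]`, so identities between them carry over from the
commutative ring `ℤ[X]` to arbitrary rings, and in particular to the operators `λ + ∂`. -/
theorem aeval_adlerCoeff {E : Type*} [Ring E] (s : E) (p q n m : ℤ) :
    Polynomial.aeval s (adlerCoeff (Polynomial.X : Polynomial ℤ) p q n m) =
      adlerCoeff s p q n m := by
  have h := map_adlerCoeff (Polynomial.aeval (R := ℤ) s : Polynomial ℤ →+* E) Polynomial.X p q n m
  simpa using h

theorem adlerCoeff_skew_of_ring {E : Type*} [Ring E] (s : E) (p q n m : ℤ) :
    adlerCoeff s p q n m = -adlerCoeff (-s) q p m n := by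
  have h := congrArg (Polynomial.aeval (R := ℤ) s : Polynomial ℤ →+* E)
    (adlerCoeff_skew (Polynomial.X : Polynomial ℤ) p q n m)
  simpa only [map_neg, map_adlerCoeff, RingHom.coe_coe, Polynomial.aeval_X] using h

theorem mulDiff_adlerCoeff_of_ring {E : Type*} [Ring E] (s : E) (p q n m : ℤ) :
    adlerCoeff s (p - 1) q n m - adlerCoeff s p (q - 1) n m - s * adlerCoeff s p q n m =
      dl E p n * dl E q m - pw s n q * pw (-s) m p := by
  have hd : ∀ i j, (Polynomial.aeval (R := ℤ) s : Polynomial ℤ →+* E) (dl _ i j) = dl E i j := by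
    intro i j
    unfold dl
    split_ifs <;> simp
  have h := congrArg (Polynomial.aeval (R := ℤ) s : Polynomial ℤ →+* E)
    (mulDiff_adlerCoeff (Polynomial.X : Polynomial ℤ) p q n m)
  simp only [mulDiff, map_neg, map_sub, map_mul, map_adlerCoeff, map_pw, hd] at h
  simpa only [RingHom.coe_coe, Polynomial.aeval_X] using h

/-- A map that intertwines two endomorphisms intertwines the coefficients formed with them. -/
theorem adlerCoeff_intertwine {f : M →ₗ[F] Q} {s : Module.End F M} {s' : Module.End F Q}
    (h : ∀ m, f (s m) = s' (f m)) (p q n m : ℤ) (v : M) :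
    f (adlerCoeff s p q n m v) = adlerCoeff s' p q n m (f v) := by
  have key : ∀ P : Polynomial ℤ, f (Polynomial.aeval s P v) = Polynomial.aeval s' P (f v) := by
    intro P
    induction P using Polynomial.induction_on' with
    | add P P' hP hP' =>
      rw [map_add, map_add, LinearMap.add_apply, LinearMap.add_apply, map_add, hP, hP']
    | monomial n a =>
      rw [Polynomial.aeval_monomial, Polynomial.aeval_monomial, ← Algebra.smul_def,
        ← Algebra.smul_def, LinearMap.smul_apply, LinearMap.smul_apply, map_zsmul,
        end_pow_comm h]
  rw [← aeval_adlerCoeff, key, aeval_adlerCoeff]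

/-- The Jacobi identity for the coefficients, as an identity of finite sums. -/
theorem sum_adlerCoeff_jacobi {R : Type*} [CommRing R] (x y : R) {N lo k l m p q r : ℤ} (hN : 0 ≤ N)
    (hk : k ≤ N) (hl : l ≤ N) (hm : m ≤ N) (h₁ : lo ≤ q + r + 1 - N) (h₂ : lo ≤ p + r + 1 - N)
    (h₃ : lo ≤ p + q + 1 - N) :
    ∑ n ∈ Finset.Icc lo N, adlerCoeff y q r n m * adlerCoeff x p n k l -
        ∑ n ∈ Finset.Icc lo N, adlerCoeff (x + y) p r k n * adlerCoeff y q n l m =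
      ∑ n ∈ Finset.Icc lo N, adlerCoeff x p q n l * adlerCoeff (x + y) n r k m := by
  have key : ∀ u f : ℤ → R, (∀ n < lo, u n = 0) → (∀ n, N < n → f n = 0) →
      ∑ n ∈ Finset.Icc lo N, u n * f n = pairing u f := by
    intro u f hu hf
    refine (finsum_eq_sum_of_support_subset _ fun n hn => ?_).symm
    rw [Finset.coe_Icc]
    constructor
    · by_contra h
      exact hn (by simp only [hu n (not_le.1 h), zero_mul])
    · by_contra h
      exact hn (by simp only [hf n (not_le.1 h), mul_zero])
  have := jacobiA_sub_jacobiB x y k l m p q r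
  rw [jacobiA, jacobiB, jacobiC] at this
  rw [key, key, key, this]
  · exact fun n hn => adlerCoeff_eq_zero_of_add_le _ (by omega)
  · exact fun n hn => adlerCoeff_eq_zero_of_le_left _ (by omega) (by omega) (by omega)
  · exact fun n hn => adlerCoeff_eq_zero_of_add_le _ (by omega)
  · exact fun n hn => adlerCoeff_eq_zero_of_le_right _ (by omega) (by omega) (by omega)
  · exact fun n hn => adlerCoeff_eq_zero_of_add_le _ (by omega)
  · exact fun n hn => adlerCoeff_eq_zero_of_le_right _ (by omega) (by omega) (by omega)

/-- Obtained from the identity in `ℤ[X, Y]` by evaluation at the commuting elements `x` and `y`. -/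
theorem sum_adlerCoeff_jacobi_of_commute {E : Type*} [Ring E] {x y : E} (hxy : Commute x y)
    {N lo k l m p q r : ℤ} (hN : 0 ≤ N)
    (hk : k ≤ N) (hl : l ≤ N) (hm : m ≤ N) (h₁ : lo ≤ q + r + 1 - N) (h₂ : lo ≤ p + r + 1 - N)
    (h₃ : lo ≤ p + q + 1 - N) :
    ∑ n ∈ Finset.Icc lo N, adlerCoeff y q r n m * adlerCoeff x p n k l -
        ∑ n ∈ Finset.Icc lo N, adlerCoeff (x + y) p r k n * adlerCoeff y q n l m =
      ∑ n ∈ Finset.Icc lo N, adlerCoeff x p q n l * adlerCoeff (x + y) n r k m := by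
  let φ : Polynomial ℤ →+* E := (Polynomial.aeval (R := ℤ) x : Polynomial ℤ →+* E)
  have hφ : ∀ P, Commute (φ P) y := by
    intro P
    induction P using Polynomial.induction_on' with
    | add P P' hP hP' =>
      rw [map_add]
      exact hP.add_left hP'
    | monomial n a =>
      change Commute (Polynomial.aeval x _) y
      rw [Polynomial.aeval_monomial, ← Algebra.smul_def]
      exact (hxy.pow_left n).smul_left a
  let ψ : Polynomial (Polynomial ℤ) →+* E := Polynomial.eval₂RingHom' φ y hφ
  have hx : ψ (Polynomial.C Polynomial.X) = x := by
    simp [ψ, φ]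
  have hy : ψ Polynomial.X = y := by
    simp [ψ]
  have h := congrArg ψ (sum_adlerCoeff_jacobi (Polynomial.C Polynomial.X) Polynomial.X hN hk hl hm
    h₁ h₂ h₃)
  simpa only [map_sub, map_sum, map_mul, map_adlerCoeff, map_add, hx, hy] using h

end Transfer

/-! ### The generating series as sums of the coefficients -/

section HCoeff

variable {F : Type*} [Field F]
variable {M P Q : Type*} [AddCommGroup M] [Module F M] [AddCommGroup P] [Module F P]
  [AddCommGroup Q] [Module F Q]

theorem powCoeff_eq_pw (T : Module.End F M) (n k : ℤ) : powCoeff T n k = pw T n k := rfl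

/-- `(z - w - T) · i_z (z - w - T)^{-1} = 1`. -/
theorem cauchyCoeff_mulDiff (T : Module.End F M) (p j : ℤ) :
    cauchyCoeff T (p - 1) j - cauchyCoeff T p (j - 1) - T * cauchyCoeff T p j =
      dl _ p 0 * dl _ j 0 := by
  rcases lt_trichotomy p 0 with h | rfl | h
  · rw [cauchyCoeff, cauchyCoeff, cauchyCoeff, if_pos (by omega), if_pos h, if_pos h,
      powCoeff_eq_pw, powCoeff_eq_pw, powCoeff_eq_pw, show -(p - 1) - 1 = -p - 1 + 1 by ring,
      pw_succ, dl, if_neg h.ne, zero_mul]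
    abel
  · rw [cauchyCoeff, cauchyCoeff, cauchyCoeff, if_pos (by omega), if_neg (by omega),
      if_neg (by omega), powCoeff_eq_pw, mul_zero, sub_zero, sub_zero,
      show -(0 - 1 : ℤ) - 1 = 0 by rfl,
      pw_zero_left, dl, dl, if_pos rfl, one_mul]
  · rw [cauchyCoeff, cauchyCoeff, cauchyCoeff, if_neg (by omega), if_neg (by omega),
      if_neg (by omega), mul_zero, sub_zero, sub_zero, dl, if_neg h.ne', zero_mul]

/-- `z - w - T` does not annihilate a series whose exponents of `z` are bounded above. -/
theorem eq_zero_of_recursion {T : Module.End F M} {f : ℤ → ℤ → M} {K : ℤ}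
    (hK : ∀ p q, K ≤ p → f p q = 0)
    (hf : ∀ p q, f (p - 1) q - f p (q - 1) - T (f p q) = 0) (p q : ℤ) : f p q = 0 := by
  have key : ∀ j : ℕ, ∀ q, f (K - j) q = 0 := by
    intro j
    induction j with
    | zero => exact fun q => hK _ _ (by simp)
    | succ j ih =>
      intro q
      have := hf (K - j) q
      rwa [ih, ih, map_zero, sub_zero, sub_zero, sub_sub] at this
  rcases le_or_gt K p with h | h
  · exact hK p q h
  · have := key (K - p).toNat q
    rwa [show K - ((K - p).toNat : ℤ) = p by omega] at this

theorem map_finsum_of_finite (f : M →ₗ[F] Q) {ι : Type*} {u : ι → M}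
    (hu : (Function.support u).Finite) : f (∑ᶠ i, u i) = ∑ᶠ i, f (u i) :=
  f.toAddMonoidHom.map_finsum hu

theorem finsum_shift (g : ℤ → M) : ∑ᶠ j, g (j - 1) = ∑ᶠ j, g j :=
  finsum_comp_equiv (Equiv.subRight (1 : ℤ))

theorem finite_support_shift {g : ℤ → M} (hg : (Function.support g).Finite) :
    (Function.support fun j => g (j - 1)).Finite := by
  have := hg.preimage (Equiv.subRight (1 : ℤ)).injective.injOn
  exact this.subset fun j hj => hj

theorem finsum_recursion (T : Module.End F M) {u v w : ℤ → M} (hu : (Function.support u).Finite)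
    (hv : (Function.support v).Finite) (hw : (Function.support w).Finite) :
    ∑ᶠ j, u j - ∑ᶠ j, v j - T (∑ᶠ j, w j) = ∑ᶠ j, (u j - v j - T (w j)) := by
  have hT : (Function.support fun j => T (w j)).Finite := hw.subset fun j hj h => hj (by
    simp only [h, map_zero])
  rw [map_finsum_of_finite T hw, ← finsum_sub_distrib hu hv, ← finsum_sub_distrib _ hT]
  exact (hu.union hv).subset fun j hj => by
    by_contra h
    rw [Set.mem_union, not_or, Function.notMem_support, Function.notMem_support] at h
    exact hj (by simp only [h.1, h.2, sub_zero])

theorem cauchyCoeff_recursion_apply (T : Module.End F M) (p j : ℤ) (v : M) :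
    cauchyCoeff T (p - 1) j v - cauchyCoeff T p (j - 1) v - T (cauchyCoeff T p j v) =
      (dl (Module.End F M) p 0 * dl (Module.End F M) j 0) v := by
  rw [← cauchyCoeff_mulDiff T]
  rfl

variable {N : ℤ} (d : Module.End F P) {a b : ℤ → P}

/-- `(z-w-λ-∂) · i_z (z-w-λ-∂)^{-1} b(w) = b(w)`. -/
theorem cauchyMul_recursion (b : ℤ → P) (p q : ℤ) :
    cauchyMul d b (p - 1) q - cauchyMul d b p (q - 1) - lamAdd d (cauchyMul d b p q) =
      dl (Module.End F (LamPoly P)) p 0 (const (F := F) (b q)) := by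
  have fin : ∀ p (f : ℤ → LamPoly P), (Function.support fun j : ℤ =>
    cauchyCoeff (lamAdd d) p j (f j)).Finite := fun p f => cauchyCoeff_right_finite _ p f
  have e : cauchyMul d b p (q - 1) =
      ∑ᶠ j : ℤ, cauchyCoeff (lamAdd d) p (j - 1) (const (F := F) (b (q - j))) := by
    rw [cauchyMul, ← finsum_shift]
    refine finsum_congr fun j => ?_
    rw [show q - 1 - (j - 1) = q - j by ring]
  have fin' : (Function.support fun j : ℤ =>
      cauchyCoeff (lamAdd d) p (j - 1) (const (F := F) (b (q - j)))).Finite := by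
    have := finite_support_shift (fin p fun j => const (F := F) (b (q - (j + 1))))
    refine this.subset fun j hj => ?_
    simpa using hj
  rw [e, cauchyMul, cauchyMul, finsum_recursion _ (fin _ _) fin' (fin _ _),
    finsum_eq_single _ 0 fun j hj => ?_]
  · rw [cauchyCoeff_recursion_apply]
    simp [dl]
  · rw [cauchyCoeff_recursion_apply]
    simp [dl, hj]

/-- `(z-w-λ-∂) · i_z (z-w-λ-∂)^{-1} b*(-z+λ) = b*(-z+λ)`. -/
theorem cauchyAdj_recursion (hb : ∀ n, N < n → b n = 0) (p q : ℤ) :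
    cauchyAdj d b (p - 1) q - cauchyAdj d b p (q - 1) - lamAdd d (cauchyAdj d b p q) =
      dl (Module.End F (LamPoly P)) q 0 (adjCoeff d b p) := by
  have fin : ∀ p q, (Function.support fun i : ℤ =>
      cauchyCoeff (lamAdd d) i q (adjCoeff d b (p - i))).Finite := fun p q =>
    cauchyCoeff_left_finite _ p q fun n hn => adjCoeff_eq_zero d hb hn
  have e1 : ∀ j, cauchyCoeff (lamAdd d) (j - 1) q (adjCoeff d b (p - 1 - (j - 1))) =
      cauchyCoeff (lamAdd d) (j - 1) q (adjCoeff d b (p - j)) := fun j => by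
    rw [show p - 1 - (j - 1) = p - j by ring]
  have e : cauchyAdj d b (p - 1) q =
      ∑ᶠ i : ℤ, cauchyCoeff (lamAdd d) (i - 1) q (adjCoeff d b (p - i)) := by
    rw [cauchyAdj, ← finsum_shift]
    exact finsum_congr e1
  have fin' : (Function.support fun i : ℤ =>
      cauchyCoeff (lamAdd d) (i - 1) q (adjCoeff d b (p - i))).Finite := by
    have := finite_support_shift (fin (p - 1) q)
    simpa only [e1] using this
  rw [e, cauchyAdj, cauchyAdj, finsum_recursion _ fin' (fin _ _) (fin _ _),
    finsum_eq_single _ 0 fun j hj => ?_]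
  · rw [cauchyCoeff_recursion_apply]
    simp [dl]
  · rw [cauchyCoeff_recursion_apply]
    simp [dl, hj]

theorem pw_apply_comm (T : Module.End F M) (n k : ℤ) (v : M) : T (pw T n k v) = pw T n k (T v) := by
  rw [pw]
  split_ifs
  · rw [LinearMap.smul_apply, map_zsmul, LinearMap.smul_apply, ← Module.End.mul_apply,
      ← Module.End.mul_apply, ← pow_succ', ← pow_succ]
  · simp

/-- The coefficient of `z^p w^q` in
`z^n i_z (z-w-λ-∂)^{-1} b(w) - (w+λ+∂)^n i_z (z-w-λ-∂)^{-1} b*(-z+λ)` satisfies the recursion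
that says that the product with `z-w-λ-∂` is `z^n b(w) - (w+λ+∂)^n b*(-z+λ)`; since it vanishes for
large `p`, it is a combination of the coefficients `adlerCoeff`. -/
theorem cauchyMul_sub_finsum_eq (hb : ∀ n, N < n → b n = 0) (n p q : ℤ) :
    cauchyMul d b (p - n) q - ∑ᶠ j : ℤ, powCoeff (lamAdd d) n j (cauchyAdj d b p (q - j)) =
      ∑ᶠ m : ℤ, adlerCoeff (lamAdd d) p q n m (const (F := F) (b m)) := by
  set T := lamAdd d with hT
  have fin : ∀ p q, (Function.support fun m : ℤ =>
      adlerCoeff T p q n m (const (F := F) (b m))).Finite := fun p q => by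
    refine (Set.finite_Icc (p + q - n) N).subset fun m hm => ?_
    constructor
    · by_contra h
      exact hm (by
        simp only [adlerCoeff_eq_zero_of_add_le T (show n + m ≤ p + q by omega),
          LinearMap.zero_apply])
    · by_contra h
      exact hm (by simp only [hb m (not_le.1 h), map_zero])
  have finj : ∀ p q, (Function.support fun j : ℤ =>
      powCoeff T n j (cauchyAdj d b p (q - j))).Finite := fun p q => hCoeff_inner_finite d hb n p q
  rw [← sub_eq_zero]
  refine eq_zero_of_recursion (T := T) (f := fun p q => cauchyMul d b (p - n) q -
    ∑ᶠ j : ℤ, powCoeff T n j (cauchyAdj d b p (q - j)) -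
      ∑ᶠ m : ℤ, adlerCoeff T p q n m (const (F := F) (b m))) (K := max (max n N) 0)
    (fun p q hp => ?_) (fun p q => ?_) p q
  · rw [cauchyMul_eq_zero d b (by omega), finsum_eq_zero_of_forall_eq_zero,
      finsum_eq_zero_of_forall_eq_zero, sub_zero, sub_zero]
    · intro m
      rcases le_or_gt m N with h | h
      · rw [adlerCoeff_eq_zero_of_le_left T (by omega) (by omega) (by omega), LinearMap.zero_apply]
      · rw [hb m h, map_zero, map_zero]
    · intro j
      rw [cauchyAdj_eq_zero d hb, map_zero]
      rw [Set.mem_Icc]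
      omega
  · have h1 := cauchyMul_recursion d b (p - n) q
    have h2 : ∑ᶠ j : ℤ, powCoeff T n j (cauchyAdj d b (p - 1) (q - j)) -
        ∑ᶠ j : ℤ, powCoeff T n j (cauchyAdj d b p (q - 1 - j)) -
        T (∑ᶠ j : ℤ, powCoeff T n j (cauchyAdj d b p (q - j))) = pw T n q (adjCoeff d b p) := by
      rw [finsum_recursion T (finj _ _) (finj _ _) (finj _ _), finsum_eq_single _ q fun j hj => ?_]
      · rw [powCoeff_eq_pw, pw_apply_comm, ← map_sub, ← map_sub, show q - 1 - q = q - q - 1 by ring,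
          cauchyAdj_recursion d hb]
        simp [dl]
      · rw [powCoeff_eq_pw, pw_apply_comm, ← map_sub, ← map_sub, show q - 1 - j = q - j - 1 by ring,
          cauchyAdj_recursion d hb, dl, if_neg (by omega), LinearMap.zero_apply, map_zero]
    have h3 : ∑ᶠ m : ℤ, adlerCoeff T (p - 1) q n m (const (F := F) (b m)) -
        ∑ᶠ m : ℤ, adlerCoeff T p (q - 1) n m (const (F := F) (b m)) -
        T (∑ᶠ m : ℤ, adlerCoeff T p q n m (const (F := F) (b m))) =
        dl (Module.End F (LamPoly P)) p n (const (F := F) (b q)) - pw T n q (adjCoeff d b p) := by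
      have e : ∀ m v, adlerCoeff T (p - 1) q n m v - adlerCoeff T p (q - 1) n m v -
          T (adlerCoeff T p q n m v) = dl (Module.End F (LamPoly P)) p n
            (dl (Module.End F (LamPoly P)) q m v) - pw T n q (pw (-T) m p v) := fun m v =>
        LinearMap.congr_fun (mulDiff_adlerCoeff_of_ring T p q n m) v
      have f1 : (Function.support fun m : ℤ => dl (Module.End F (LamPoly P)) p n
          (dl (Module.End F (LamPoly P)) q m (const (F := F) (b m)))).Finite := by
        refine (Set.finite_singleton q).subset fun m hm => ?_
        by_contra h
        exact hm (by simp only [dl, if_neg (Ne.symm h), LinearMap.zero_apply, map_zero])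
      have f2 : (Function.support fun m : ℤ => pw (-T) m p (const (F := F) (b m))).Finite :=
        adjCoeff_finite d hb p
      have f3 : (Function.support fun m : ℤ =>
          pw T n q (pw (-T) m p (const (F := F) (b m)))).Finite :=
        f2.subset fun m hm h => hm (by
          have h' : pw (-T) m p (const (F := F) (b m)) = 0 := h
          simp only [h', map_zero])
      rw [finsum_recursion T (fin _ _) (fin _ _) (fin _ _), finsum_congr fun m => e m _,
        finsum_sub_distrib f1 f3, ← map_finsum_of_finite (pw T n q) f2,
        finsum_eq_single _ q fun m hm => ?_]
      · rw [show dl (Module.End F (LamPoly P)) q q = 1 from if_pos rfl]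
        rfl
      · rw [show dl (Module.End F (LamPoly P)) q m = 0 from if_neg hm.symm, LinearMap.zero_apply,
          map_zero]
    rw [show p - n - 1 = p - 1 - n by ring,
      show dl (Module.End F (LamPoly P)) (p - n) 0 = dl _ p n by
        simp only [dl, sub_eq_zero]] at h1
    simp only [map_sub]
    rw [← hT] at h1
    linear_combination (norm := abel) h1 - h2 - h3

/-- The coefficients of `a(z) i_z(z-w-λ-∂)^{-1} b(w) - a(w+λ+∂) i_z(z-w-λ-∂)^{-1} b*(-z+λ)` as
finite sums.  The summation ranges may be enlarged at will. -/
theorem hCoeff_eq_sum (β : M →ₗ[F] P →ₗ[F] Q) {a : ℤ → M} (ha : ∀ n, N < n → a n = 0)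
    (hb : ∀ n, N < n → b n = 0) {p q : ℤ} {s s' : Finset ℤ}
    (hs : Finset.Icc (p + q + 1 - N) N ⊆ s) (hs' : Finset.Icc (p + q + 1 - N) N ⊆ s') :
    hCoeff d β a b p q = ∑ n ∈ s, ∑ m ∈ s',
      pmap (β (a n)) (adlerCoeff (lamAdd d) p q n m (const (F := F) (b m))) := by
  have h0 : ∀ n m, n ∉ Finset.Icc (p + q + 1 - N) N ∨ m ∉ Finset.Icc (p + q + 1 - N) N →
      pmap (β (a n)) (adlerCoeff (lamAdd d) p q n m (const (F := F) (b m))) = 0 := by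
    intro n m h
    rcases lt_or_ge N n with hn | hn
    · rw [ha n hn, map_zero, map_zero, LinearMap.zero_apply]
    · rcases lt_or_ge N m with hm | hm
      · rw [hb m hm, map_zero, map_zero, map_zero]
      · rw [Finset.mem_Icc, Finset.mem_Icc] at h
        rw [adlerCoeff_eq_zero_of_add_le _ (by omega), LinearMap.zero_apply, map_zero]
  have hin : ∀ n, pmap (β (a n)) (∑ᶠ m : ℤ, adlerCoeff (lamAdd d) p q n m (const (F := F) (b m))) =
      ∑ m ∈ s', pmap (β (a n)) (adlerCoeff (lamAdd d) p q n m (const (F := F) (b m))) := by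
    intro n
    rw [map_finsum_of_finite]
    · refine finsum_eq_sum_of_support_subset _ fun m hm => ?_
      by_contra h
      exact hm (h0 n m (Or.inr fun h' => h (hs' h')))
    · refine (Set.finite_Icc (p + q + 1 - n) N).subset fun m hm => ?_
      constructor
      · by_contra h
        exact hm (by
          simp only [adlerCoeff_eq_zero_of_add_le (lamAdd d) (show n + m ≤ p + q by omega),
            LinearMap.zero_apply])
      · by_contra h
        exact hm (by simp only [hb m (not_le.1 h), map_zero])
  rw [hCoeff, ← finsum_sub_distrib (hCoeff_fst_finite d β ha b p q)
    (hCoeff_snd_finite d β ha hb p q)]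
  simp only [← map_sub, cauchyMul_sub_finsum_eq d hb, hin]
  refine finsum_eq_sum_of_support_subset _ fun n hn => ?_
  by_contra h
  exact hn (Finset.sum_eq_zero fun m _ => h0 n m (Or.inl fun h' => h (hs h')))

end HCoeff

/-! ### Skewsymmetry and the Jacobi identity for `H` -/

section Sums

variable {M : Type*} [AddCommMonoid M]

theorem sum_rotate₃ (s t u : Finset ℤ) (f : ℤ → ℤ → ℤ → M) :
    ∑ a ∈ s, ∑ b ∈ t, ∑ c ∈ u, f a b c = ∑ b ∈ t, ∑ c ∈ u, ∑ a ∈ s, f a b c := by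
  rw [Finset.sum_comm]
  exact Finset.sum_congr rfl fun _ _ => Finset.sum_comm

theorem sum_rotate₄ (s t u v : Finset ℤ) (f : ℤ → ℤ → ℤ → ℤ → M) :
    ∑ a ∈ s, ∑ b ∈ t, ∑ c ∈ u, ∑ e ∈ v, f a b c e =
      ∑ b ∈ t, ∑ c ∈ u, ∑ e ∈ v, ∑ a ∈ s, f a b c e := by
  rw [Finset.sum_comm]
  exact Finset.sum_congr rfl fun _ _ => sum_rotate₃ _ _ _ _

end Sums

section Jacobi

variable {F : Type*} [Field F]
variable {V W : Type*} [AddCommGroup V] [Module F V] [AddCommGroup W] [Module F W]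

/-- The Jacobi identity for brackets of the form
`{{L(z)_λ L(w)}} = ∑ adlerCoeff (λ+∂'') L_n ⊗ L_m`: the three terms are sums of
`L_k ⊗ L_l ⊗ L_m`, with coefficients that are polynomials in the commuting operators `x = λ + D₂`
and `y = μ + D₃`. -/
theorem jacobi_of_adlerCoeff {δ : Module.End F V} {D₂ D₃ : Module.End F W}
    (hD : ∀ w, D₂ (D₃ w) = D₃ (D₂ w)) {t₂ : ℤ → ℤ → V} {t₃ : ℤ → ℤ → ℤ → W} {N lo : ℤ} {p q r : ℤ}
    {s s' : Finset ℤ} (hs : s = Finset.Icc lo N) (hs' : ∀ k ∈ s', k ≤ N) (hN : 0 ≤ N)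
    (h₁ : lo ≤ q + r + 1 - N) (h₂ : lo ≤ p + r + 1 - N) (h₃ : lo ≤ p + q + 1 - N)
    {La Rb T : V →ₗ[F] LamPoly W} {bc ac ab : LamPoly V}
    (hbc : bc = ∑ n ∈ s, ∑ m ∈ s', adlerCoeff (lamAdd δ) q r n m (const (F := F) (t₂ n m)))
    (hac : ac = ∑ k ∈ s', ∑ n ∈ s, adlerCoeff (lamAdd δ) p r k n (const (F := F) (t₂ k n)))
    (hab : ab = ∑ n ∈ s, ∑ l ∈ s', adlerCoeff (lamAdd δ) p q n l (const (F := F) (t₂ n l)))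
    (hLa : ∀ v, La (δ v) = pmap D₃ (La v)) (hRb : ∀ v, Rb (δ v) = lamAdd (D₂ + D₃) (Rb v))
    (hT : ∀ v, T (δ v) = pmap D₂ (T v))
    (hLa' : ∀ n ∈ s, ∀ m, La (t₂ n m) =
      ∑ k ∈ s', ∑ l ∈ s', adlerCoeff (lamAdd D₂) p n k l (const (F := F) (t₃ k l m)))
    (hRb' : ∀ n ∈ s, ∀ k, Rb (t₂ k n) =
      ∑ l ∈ s', ∑ m ∈ s', adlerCoeff (lamAdd D₃) q n l m (const (F := F) (t₃ k l m)))
    (hT' : ∀ n ∈ s, ∀ l, T (t₂ n l) =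
      ∑ k ∈ s', ∑ m ∈ s', adlerCoeff (lamAdd (D₂ + D₃)) n r k m (const (F := F) (t₃ k l m))) :
    pmap La bc - swapVars (F := F) (pmap Rb ac) - nest T ab = 0 := by
  set x : Module.End F (LamPoly₂ W) := pmap (lamAdd D₂) with hx
  set y : Module.End F (LamPoly₂ W) := lamAdd (pmap D₃) with hy
  have hxy : Commute x y := by
    refine LinearMap.ext fun v => ?_
    change pmap (lamAdd D₂) (lamAdd (pmap D₃) v) = lamAdd (pmap D₃) (pmap (lamAdd D₂) v)
    refine pmap_lamAdd (fun m => ?_) v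
    exact (pmap_lamAdd (fun w => (hD w).symm) m).symm
  have hxy' : x + y = lamAdd (lamAdd (D₂ + D₃)) := by
    have h : lamAdd (D₂ + D₃) = lamAdd D₂ + pmap D₃ := by
      rw [lamAdd, lamAdd, map_add, add_assoc]
    have h' : ∀ d : Module.End F (LamPoly W), lamAdd d = lam + pmap d := fun _ => rfl
    rw [hx, hy, h, h' (pmap D₃), h' (lamAdd D₂ + pmap D₃), map_add]
    abel
  let cc : W →ₗ[F] LamPoly₂ W := const ∘ₗ const
  have e₁ : pmap La bc = ∑ k ∈ s', ∑ l ∈ s', ∑ m ∈ s', ∑ n ∈ s,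
      (adlerCoeff y q r n m * adlerCoeff x p n k l) (cc (t₃ k l m)) := by
    have i1 : ∀ v, pmap La (lamAdd δ v) = y (pmap La v) := fun v => pmap_lamAdd hLa v
    have i2 : ∀ v : LamPoly W, const (F := F) (lamAdd D₂ v) = x (const (F := F) v) := fun v =>
      (pmap_const (lamAdd D₂) v).symm
    rw [hbc, ← sum_rotate₄]
    simp only [map_sum]
    refine Finset.sum_congr rfl fun n hn => ?_
    rw [← sum_rotate₃]
    refine Finset.sum_congr rfl fun m _ => ?_
    rw [adlerCoeff_intertwine i1, pmap_const, hLa' n hn]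
    simp only [map_sum]
    refine Finset.sum_congr rfl fun k _ => Finset.sum_congr rfl fun l _ => ?_
    rw [adlerCoeff_intertwine i2]
    rfl
  have e₂ : swapVars (F := F) (pmap Rb ac) = ∑ k ∈ s', ∑ l ∈ s', ∑ m ∈ s', ∑ n ∈ s,
      (adlerCoeff (x + y) p r k n * adlerCoeff y q n l m) (cc (t₃ k l m)) := by
    have i1 : ∀ v, (swapVars ∘ₗ pmap Rb) (lamAdd δ v) = (x + y) ((swapVars ∘ₗ pmap Rb) v) := by
      intro v
      rw [hxy', LinearMap.comp_apply, pmap_lamAdd hRb, swapVars_lamAdd_lamAdd]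
      rfl
    have i2 : ∀ v : LamPoly W, (pmap const) (lamAdd D₃ v) = y (pmap (const (F := F)) v) := fun v =>
      pmap_lamAdd (fun w => (pmap_const D₃ w).symm) v
    rw [hac]
    change (swapVars ∘ₗ pmap Rb) _ = _
    simp only [map_sum]
    refine Finset.sum_congr rfl fun k _ => ?_
    rw [← sum_rotate₃]
    refine Finset.sum_congr rfl fun n hn => ?_
    rw [adlerCoeff_intertwine i1, LinearMap.comp_apply, pmap_const, hRb' n hn, swapVars_const]
    simp only [map_sum]
    refine Finset.sum_congr rfl fun l _ => Finset.sum_congr rfl fun m _ => ?_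
    rw [adlerCoeff_intertwine i2, pmap_const]
    rfl
  have e₃ : nest T ab = ∑ k ∈ s', ∑ l ∈ s', ∑ m ∈ s', ∑ n ∈ s,
      (adlerCoeff x p q n l * adlerCoeff (x + y) n r k m) (cc (t₃ k l m)) := by
    have i1 : ∀ v, nest T (lamAdd δ v) = x (nest T v) := by
      intro v
      have h : T ∘ₗ δ = pmap D₂ ∘ₗ T := LinearMap.ext hT
      rw [lamAdd_apply, map_add, nest_lam, nest_pmap, h, pmap_nest, hx, lamAdd, map_add]
      rfl
    have i2 : ∀ v : LamPoly W, substAdd (F := F) (lamAdd (D₂ + D₃) v) =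
        (x + y) (substAdd (F := F) v) := by
      intro v
      have h : ∀ S : LamPoly₂ W, pmap (lamAdd (D₂ + D₃)) S =
          pmap (lam (F := F)) S + pmap (pmap (D₂ + D₃)) S := fun S => by
        rw [lamAdd, map_add, LinearMap.add_apply]
      rw [hxy', lamAdd_apply, map_add, substAdd_lam, substAdd_pmap, lamAdd_apply (lamAdd (D₂ + D₃)),
        h]
      abel
    rw [hab, ← sum_rotate₄]
    simp only [map_sum]
    refine Finset.sum_congr rfl fun n hn => ?_
    rw [Finset.sum_comm]
    refine Finset.sum_congr rfl fun l _ => ?_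
    rw [adlerCoeff_intertwine i1, nest_const, hT' n hn]
    simp only [map_sum]
    refine Finset.sum_congr rfl fun k _ => Finset.sum_congr rfl fun m _ => ?_
    rw [adlerCoeff_intertwine i2, substAdd_const]
    rfl
  rw [e₁, e₂, e₃]
  simp only [← Finset.sum_sub_distrib]
  refine Finset.sum_eq_zero fun k hk => Finset.sum_eq_zero fun l hl =>
    Finset.sum_eq_zero fun m hm => ?_
  have := LinearMap.congr_fun (sum_adlerCoeff_jacobi_of_commute
    (E := Module.End F (LamPoly₂ W)) hxy hN (hs' k hk) (hs' l hl)
    (hs' m hm) h₁ h₂ h₃) (cc (t₃ k l m))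
  rw [← hs, LinearMap.sub_apply, LinearMap.sum_apply, LinearMap.sum_apply, LinearMap.sum_apply,
    ← sub_eq_zero, ← Finset.sum_sub_distrib, ← Finset.sum_sub_distrib] at this
  exact this

/-- Skewsymmetry of the coefficients. -/
theorem adlerCoeff_negSub {D δ δ' σ : Module.End F V} (hσ : ∀ v, σ (δ v) = δ' (σ v))
    (hD : D = δ + δ') (hc : ∀ v, δ (δ' v) = δ' (δ v)) (p q n m : ℤ) (v : V) :
    -negSub D (pmap σ (adlerCoeff (lamAdd δ) q p n m (const (F := F) v))) =
      adlerCoeff (lamAdd δ) p q m n (const (F := F) (σ v)) := by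
  have i : ∀ v, (negSub D ∘ₗ pmap σ) (lamAdd δ v) = (-lamAdd δ) ((negSub D ∘ₗ pmap σ) v) := by
    intro v
    have hcomm : ∀ v, δ' (D v) = D (δ' v) := fun v => by
      rw [hD, LinearMap.add_apply, LinearMap.add_apply, map_add, hc]
    rw [LinearMap.comp_apply, pmap_lamAdd hσ, lamAdd_apply, map_add, negSub_lam, negSub_comm hcomm,
      hD, lamAdd_apply, map_add, LinearMap.add_apply, LinearMap.neg_apply, LinearMap.comp_apply,
      lamAdd_apply]
    abel
  change -(negSub D ∘ₗ pmap σ) _ = _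
  rw [adlerCoeff_intertwine i, LinearMap.comp_apply, pmap_const, negSub_const,
    adlerCoeff_skew_of_ring (lamAdd δ) p q m n, LinearMap.neg_apply]

theorem pmap_adlerCoeff_const {P : Type*} [AddCommGroup P] [Module F P] {f : P →ₗ[F] V}
    {d : Module.End F P} {δ : Module.End F V} (h : ∀ v, f (d v) = δ (f v)) (p q n m : ℤ) (v : P) :
    pmap f (adlerCoeff (lamAdd d) p q n m (const (F := F) v)) =
      adlerCoeff (lamAdd δ) p q n m (const (F := F) (f v)) := by
  rw [adlerCoeff_intertwine (fun v => pmap_lamAdd h v), pmap_const]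

theorem flip_arrow_adlerCoeff_const {P Q : Type*} [AddCommGroup P] [Module F P]
    [AddCommGroup Q] [Module F Q] {δ : Module.End F V} {d : Module.End F P} {D : Module.End F Q}
    {β : V →ₗ[F] P →ₗ[F] Q} {D' : Module.End F V}
    (h : ∀ v x, D (β v x) = β (D' v) x + β v (d x)) (h' : D' = δ) (p q n m : ℤ) (v : V) (x : P) :
    arrow d β (adlerCoeff (lamAdd δ) p q n m (const (F := F) v)) x =
      adlerCoeff (lamAdd D) p q n m (const (F := F) (β v x)) := by
  subst h'
  have hA : ∀ v : LamPoly V, (arrow d β).flip x (lamAdd D' v) =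
      lamAdd D ((arrow d β).flip x v) := fun v => arrow_lamAdd h v x
  change (arrow d β).flip x _ = _
  rw [adlerCoeff_intertwine hA, LinearMap.flip_apply, arrow_const]

variable {P : Type*} [AddCommGroup P] [Module F P] {d : Module.End F P} {β : P →ₗ[F] P →ₗ[F] V}
  {N : ℤ} {a : ℤ → P}

theorem hCoeff_eq_sum_const {δ : Module.End F V} (hβ : ∀ x y, β x (d y) = δ (β x y))
    (ha : ∀ n, N < n → a n = 0) {p q : ℤ} {s s' : Finset ℤ}
    (hs : Finset.Icc (p + q + 1 - N) N ⊆ s) (hs' : Finset.Icc (p + q + 1 - N) N ⊆ s') :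
    hCoeff d β a a p q = ∑ n ∈ s, ∑ m ∈ s',
      adlerCoeff (lamAdd δ) p q n m (const (F := F) (β (a n) (a m))) := by
  rw [hCoeff_eq_sum d _ ha ha hs hs']
  exact Finset.sum_congr rfl fun n _ => Finset.sum_congr rfl fun m _ =>
    pmap_adlerCoeff_const (hβ (a n)) p q n m (a m)

theorem hCoeff_skew {D δ δ' σ : Module.End F V} (hσβ : ∀ x y, σ (β x y) = β y x)
    (hβ : ∀ x y, β x (d y) = δ (β x y)) (hσ : ∀ v, σ (δ v) = δ' (σ v))
    (hD : D = δ + δ') (hc : ∀ v, δ (δ' v) = δ' (δ v)) (ha : ∀ n, N < n → a n = 0) (p q : ℤ) :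
    hCoeff d β a a p q = -negSub D (pmap σ (hCoeff d β a a q p)) := by
  rw [hCoeff_eq_sum_const hβ ha (Finset.Subset.refl _) (Finset.Subset.refl _),
    hCoeff_eq_sum_const hβ ha (Finset.Subset.refl _) (Finset.Subset.refl _), add_comm q p,
    Finset.sum_comm]
  simp only [map_sum, ← Finset.sum_neg_distrib]
  refine Finset.sum_congr rfl fun n _ => Finset.sum_congr rfl fun m _ => ?_
  rw [adlerCoeff_negSub hσ hD hc, hσβ]

end Jacobi

section Double

variable {F : Type*} [Field F] {A : Type*} [Ring A] [Algebra F A]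
variable {d : NCDerivation F A} {B : DoubleBracket F A} {N : ℤ} {a : ℤ → A}

theorem hCoeff_mk_eq_sum (ha : ∀ n, N < n → a n = 0) {p q : ℤ} {s s' : Finset ℤ}
    (hs : Finset.Icc (p + q + 1 - N) N ⊆ s) (hs' : Finset.Icc (p + q + 1 - N) N ⊆ s') :
    hCoeff d.toEnd (TensorProduct.mk F A A) a a p q = ∑ n ∈ s, ∑ m ∈ s',
      adlerCoeff (lamAdd (LinearMap.lTensor A d.toEnd)) p q n m
        (const (F := F) (TensorProduct.mk F A A (a n) (a m))) :=
  hCoeff_eq_sum_const (fun _ _ => rfl) ha hs hs'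

theorem hCoeff_mk_skew (ha : ∀ n, N < n → a n = 0) (p q : ℤ) :
    hCoeff d.toEnd (TensorProduct.mk F A A) a a p q = -negSub (tensorD d.toEnd)
      (pmap (TensorProduct.comm F A A).toLinearMap
        (hCoeff d.toEnd (TensorProduct.mk F A A) a a q p)) := by
  have h1 : ∀ v : A ⊗[F] A, (TensorProduct.comm F A A).toLinearMap (LinearMap.lTensor A d.toEnd v) =
      LinearMap.rTensor A d.toEnd ((TensorProduct.comm F A A).toLinearMap v) := fun v => by
    induction v with
    | zero => simp
    | add v w hv hw => simp only [map_add, hv, hw]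
    | tmul x y => rfl
  have h2 : ∀ v : A ⊗[F] A, LinearMap.lTensor A d.toEnd (LinearMap.rTensor A d.toEnd v) =
      LinearMap.rTensor A d.toEnd (LinearMap.lTensor A d.toEnd v) := fun v => by
    induction v with
    | zero => simp
    | add v w hv hw => simp only [map_add, hv, hw]
    | tmul x y => rfl
  exact hCoeff_skew (fun _ _ => rfl) (fun _ _ => rfl) h1 (add_comm _ _) h2 ha p q

theorem brL_lTensor (B : DoubleBracket F A) (δ : Module.End F A) (a : A) (v : A ⊗[F] A) :
    brL B a (LinearMap.lTensor A δ v) =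
      pmap (LinearMap.lTensor A (LinearMap.lTensor A δ)) (brL B a v) := by
  induction v with
  | zero => simp
  | add v w hv hw => simp only [map_add, hv, hw]
  | tmul x y =>
    rw [LinearMap.lTensor_tmul, brL_tmul, brL_tmul, pmap_pmap]
    congr 2
    exact TensorProduct.ext (LinearMap.ext₂ fun s t => rfl)

theorem IsTwoFoldBracket.brR_lTensor (hB : IsTwoFoldBracket d B) (a : A) (v : A ⊗[F] A) :
    brR B a (LinearMap.lTensor A d.toEnd v) =
      lamAdd (LinearMap.lTensor A (tensorD d.toEnd)) (brR B a v) := by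
  induction v with
  | zero => simp
  | add v w hv hw => simp only [map_add, hv, hw]
  | tmul x y =>
    rw [LinearMap.lTensor_tmul, brR_tmul, brR_tmul, hB.sesq_right]
    exact pmap_lamAdd (f := TensorProduct.mk F A (A ⊗[F] A) x)
      (d' := LinearMap.lTensor A (tensorD d.toEnd)) (fun v => rfl) (B a y)

theorem brFstL_lTensor (B : DoubleBracket F A) (a : A) (v : A ⊗[F] A) :
    brFstL d B a (LinearMap.lTensor A d.toEnd v) =
      pmap (LinearMap.lTensor A (LinearMap.rTensor A d.toEnd)) (brFstL d B a v) := by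
  have key : ∀ (v : A ⊗[F] A) (b : A), LinearMap.lTensor A (LinearMap.rTensor A d.toEnd)
      (insertMid v b) = insertMid ((LinearMap.id : Module.End F (A ⊗[F] A)) v) (d.toEnd b) :=
    fun v b => by
      induction v with
      | zero => simp
      | add v w hv hw => simp only [map_add, LinearMap.add_apply, hv, hw]
      | tmul x y => rfl
  induction v with
  | zero => simp
  | add v w hv hw => simp only [map_add, hv, hw]
  | tmul x y =>
    rw [LinearMap.lTensor_tmul, brFstL_tmul, brFstL_tmul, arrow_naturality key (fun _ => rfl),
      pmap_id]

theorem lTensor_tensorD_insertMid (δ : Module.End F A) (v : A ⊗[F] A) (b : A) :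
    LinearMap.lTensor A (tensorD δ) (insertMid v b) =
      insertMid (LinearMap.lTensor A δ v) b + insertMid v (δ b) := by
  induction v with
  | zero => simp
  | add v w hv hw =>
    simp only [map_add, LinearMap.add_apply, hv, hw]
    abel
  | tmul x y =>
    rw [insertMid_tmul, LinearMap.lTensor_tmul, LinearMap.lTensor_tmul, tensorD_tmul,
      TensorProduct.tmul_add, add_comm]
    rfl

/-- If `{{a_p λ a_q}}` is given on the coefficients of `a(z)` by the generating series that
defines `H`, then
the Jacobi identity holds on these coefficients. -/
theorem doubleJacobi_hCoeff (hB : IsTwoFoldBracket d B) (hN : 0 ≤ N) (ha : ∀ n, N < n → a n = 0)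
    (h : ∀ p q, B (a p) (a q) = hCoeff d.toEnd (TensorProduct.mk F A A) a a p q) (p q r : ℤ) :
    doubleJacobi d B (a p) (a q) (a r) = 0 := by
  -- all sums run over `lo ≤ n ≤ N` or `lo' ≤ n ≤ N`, with bounds so low that no term is lost
  obtain ⟨lo, h₁, h₂, h₃⟩ : ∃ lo, lo ≤ q + r + 1 - N ∧ lo ≤ p + r + 1 - N ∧ lo ≤ p + q + 1 - N :=
    ⟨min (q + r + 1 - N) (min (p + r + 1 - N) (p + q + 1 - N)), by omega, by omega, by omega⟩
  obtain ⟨lo', h₀', h₁', h₂', h₃'⟩ : ∃ lo', lo' ≤ lo ∧ lo' ≤ p + lo + 1 - N ∧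
      lo' ≤ q + lo + 1 - N ∧ lo' ≤ r + lo + 1 - N :=
    ⟨min lo (min (p + lo + 1 - N) (min (q + lo + 1 - N) (r + lo + 1 - N))), by omega, by omega,
      by omega, by omega⟩
  have sub : ∀ {u v : ℤ}, u ≤ v → Finset.Icc v N ⊆ Finset.Icc u N := fun h =>
    Finset.Icc_subset_Icc_left h
  set δ : Module.End F (A ⊗[F] A) := LinearMap.lTensor A d.toEnd
  set D₂ : Module.End F (A ⊗[F] (A ⊗[F] A)) :=
    LinearMap.lTensor A (LinearMap.rTensor A d.toEnd) with hD₂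
  set D₃ : Module.End F (A ⊗[F] (A ⊗[F] A)) :=
    LinearMap.lTensor A (LinearMap.lTensor A d.toEnd) with hD₃
  have hD₂₃ : D₂ + D₃ = LinearMap.lTensor A (tensorD d.toEnd) := by
    rw [hD₂, hD₃, tensorD, LinearMap.lTensor_add]
  rw [doubleJacobi]
  refine jacobi_of_adlerCoeff (δ := δ) (D₂ := D₂) (D₃ := D₃)
    (t₂ := fun n m => TensorProduct.mk F A A (a n) (a m))
    (t₃ := fun k l m => TensorProduct.mk F A (A ⊗[F] A) (a k) (TensorProduct.mk F A A (a l) (a m)))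
    (s' := Finset.Icc lo' N) ?_ rfl (fun k hk => (Finset.mem_Icc.1 hk).2) hN h₁ h₂ h₃
    ((h q r).trans (hCoeff_mk_eq_sum ha (sub h₁) (sub (by omega))))
    ((h p r).trans (hCoeff_mk_eq_sum ha (sub (by omega)) (sub h₂)))
    ((h p q).trans (hCoeff_mk_eq_sum ha (sub h₃) (sub (by omega))))
    (brL_lTensor B d.toEnd (a p)) ?_ (brFstL_lTensor B (a r)) ?_ ?_ ?_
  · intro w
    rw [hD₂, hD₃, ← LinearMap.comp_apply, ← LinearMap.comp_apply, ← LinearMap.lTensor_comp,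
      ← LinearMap.lTensor_comp, LinearMap.lTensor_comp_rTensor, LinearMap.rTensor_comp_lTensor]
  · rw [hD₂₃]
    exact hB.brR_lTensor (a q)
  · intro n hn m
    rw [Finset.mem_Icc] at hn
    have h4 : ∀ v : A ⊗[F] A, appendR (a m) (LinearMap.lTensor A d.toEnd v) =
        D₂ (appendR (a m) v) := fun v => by
      induction v with
      | zero => simp
      | add v w hv hw => simp only [map_add, hv, hw]
      | tmul x y => rfl
    refine (brL_tmul B (a p) (a n) (a m)).trans ?_
    rw [h, hCoeff_mk_eq_sum ha (sub (by omega : lo' ≤ _)) (sub (by omega : lo' ≤ _)), map_sum]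
    refine Finset.sum_congr rfl fun k _ => ?_
    rw [map_sum]
    exact Finset.sum_congr rfl fun l _ => pmap_adlerCoeff_const h4 _ _ _ _ _
  · intro n hn k
    rw [Finset.mem_Icc] at hn
    refine (brR_tmul B (a q) (a k) (a n)).trans ?_
    rw [h, hCoeff_mk_eq_sum ha (sub (by omega : lo' ≤ _)) (sub (by omega : lo' ≤ _)), map_sum]
    refine Finset.sum_congr rfl fun l _ => ?_
    rw [map_sum]
    exact Finset.sum_congr rfl fun m _ =>
      pmap_adlerCoeff_const (f := TensorProduct.mk F A (A ⊗[F] A) (a k)) (fun v => rfl) _ _ _ _ _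
  · intro n hn l
    rw [Finset.mem_Icc] at hn
    refine (brFstL_tmul d B (a r) (a n) (a l)).trans ?_
    rw [h, hCoeff_mk_eq_sum ha (sub (by omega : lo' ≤ _)) (sub (by omega : lo' ≤ _)), hD₂₃, map_sum,
      LinearMap.sum_apply]
    refine Finset.sum_congr rfl fun k _ => ?_
    rw [map_sum, LinearMap.sum_apply]
    exact Finset.sum_congr rfl fun m _ =>
      flip_arrow_adlerCoeff_const (lTensor_tensorD_insertMid d.toEnd) rfl _ _ _ _ _ _

end Double

/-! ### The bracket `K` as the change of `H` under a shift of `L(z)` by a constant -/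

section KCoeff

variable {F : Type*} [Field F]
variable {M P Q : Type*} [AddCommGroup M] [Module F M] [AddCommGroup P] [Module F P]
  [AddCommGroup Q] [Module F Q]

theorem pw_intertwine {f : M →ₗ[F] Q} {s : Module.End F M} {s' : Module.End F Q}
    (h : ∀ m, f (s m) = s' (f m)) (n k : ℤ) (v : M) : f (pw s n k v) = pw s' n k (f v) := by
  rw [pw, pw]
  split_ifs
  · rw [LinearMap.smul_apply, map_zsmul, LinearMap.smul_apply, end_pow_comm h]
  · simp

theorem cauchyCoeff_intertwine {f : M →ₗ[F] Q} {s : Module.End F M} {s' : Module.End F Q}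
    (h : ∀ m, f (s m) = s' (f m)) (i j : ℤ) (v : M) :
    f (cauchyCoeff s i j v) = cauchyCoeff s' i j (f v) := by
  rw [cauchyCoeff, cauchyCoeff]
  split_ifs
  · exact pw_intertwine h _ _ v
  · simp

/-- The coefficients of the constant series `v`. -/
def constSeries (v : P) (n : ℤ) : P := if n = 0 then v else 0

theorem constSeries_zero (v : P) : constSeries v 0 = v := if_pos rfl

theorem constSeries_of_ne (v : P) {n : ℤ} (h : n ≠ 0) : constSeries v n = 0 := if_neg h

/-- For the constant series `a(z) = v`, the series that defines `H` reduces to the second half of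
the one that defines `K`. -/
theorem hCoeff_constSeries_left (d : Module.End F P) (β : M →ₗ[F] P →ₗ[F] Q) (v : M) (b : ℤ → P)
    (p q : ℤ) : hCoeff d β (constSeries v) b p q = pmap (β v) (kCoeff₂ d b p q) := by
  have h : ∑ᶠ j : ℤ, powCoeff (lamAdd d) 0 j (cauchyAdj d b p (q - j)) = cauchyAdj d b p q := by
    rw [finsum_eq_single _ 0 fun j hj => ?_]
    · rw [powCoeff_eq_pw, pw_self, sub_zero]
      rfl
    · rw [powCoeff_eq_pw, pw_zero_left, dl, if_neg hj, LinearMap.zero_apply]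
  rw [hCoeff, finsum_eq_single _ 0 fun n hn => ?_, finsum_eq_single _ 0 fun n hn => ?_,
    constSeries_zero, h, sub_zero, kCoeff₂, map_sub]
  · rw [constSeries_of_ne v hn, map_zero, map_zero, LinearMap.zero_apply]
  · rw [constSeries_of_ne v hn, map_zero, map_zero, LinearMap.zero_apply]

section

variable (d : Module.End F P)

theorem cauchyMul_constSeries (v : P) (p q : ℤ) :
    cauchyMul d (constSeries v) p q = cauchyCoeff (lamAdd d) p q (const (F := F) v) := by
  rw [cauchyMul, finsum_eq_single _ q fun j hj => ?_, sub_self, constSeries_zero]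
  rw [constSeries_of_ne v (by omega), map_zero, map_zero]

theorem cauchyAdj_constSeries (v : P) (p q : ℤ) :
    cauchyAdj d (constSeries v) p q = cauchyCoeff (lamAdd d) p q (const (F := F) v) := by
  have h : ∀ i, adjCoeff d (constSeries v) i = constSeries (const (F := F) v) i := by
    intro i
    rw [adjCoeff, finsum_eq_single _ 0 fun n hn => ?_, constSeries_zero, powCoeff_eq_pw,
      pw_zero_left, dl, constSeries]
    · split_ifs <;> rfl
    · rw [constSeries_of_ne v hn, map_zero, map_zero]
  rw [cauchyAdj, finsum_eq_single _ p fun j hj => ?_, sub_self, h, constSeries_zero]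
  rw [h, constSeries_of_ne _ (by omega), map_zero]

theorem kCoeff₂_constSeries (v : P) (p q : ℤ) : kCoeff₂ d (constSeries v) p q = 0 := by
  rw [kCoeff₂, cauchyMul_constSeries, cauchyAdj_constSeries, sub_self]

end

theorem const_eq_pmap_toSpanSingleton (x : M) :
    const (F := F) x = pmap (LinearMap.toSpanSingleton F M x) (const (F := F) (1 : F)) := by
  rw [pmap_const, LinearMap.toSpanSingleton_apply, one_smul]

/-- For the constant series `b(z) = v`, the series that defines `H` reduces to the first half of the
one that defines `K`. -/
theorem hCoeff_constSeries_right (d : Module.End F P) (β : M →ₗ[F] P →ₗ[F] Q) {v : P} (hv : d v = 0)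
    {N : ℤ} {a : ℤ → M} (ha : ∀ n, N < n → a n = 0) (p q : ℤ) :
    hCoeff d β a (constSeries v) p q = pmap (β.flip v) (kCoeff₁ F a p q) := by
  -- `λ + ∂` acts as `λ` on polynomials whose coefficients are multiples of `v`
  have hlam : ∀ (x : M) (w : LamPoly F), pmap (β x) (pmap (LinearMap.toSpanSingleton F P v) w) =
      pmap (β.flip v) (pmap (LinearMap.toSpanSingleton F M x) w) := by
    intro x w
    rw [pmap_pmap, pmap_pmap]
    congr 2
    ext
    simp
  have i1 : ∀ w : LamPoly F, pmap (LinearMap.toSpanSingleton F P v) (lam (F := F) w) =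
      lamAdd d (pmap (LinearMap.toSpanSingleton F P v) w) := by
    intro w
    have h0 : d ∘ₗ LinearMap.toSpanSingleton F P v = 0 := by
      ext
      simp [hv]
    rw [lamAdd_apply, pmap_lam, pmap_pmap, h0, map_zero, LinearMap.zero_apply, add_zero]
  have i2 : ∀ (x : M) (w : LamPoly F), pmap (LinearMap.toSpanSingleton F M x) (lam (F := F) w) =
      lam (F := F) (pmap (LinearMap.toSpanSingleton F M x) w) := fun x w => pmap_lam _ w
  have e1 : ∀ (x : M) (i j : ℤ), pmap (β x) (cauchyCoeff (lamAdd d) i j (const (F := F) v)) =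
      pmap (β.flip v) (cauchyCoeff (lam (F := F)) i j (const (F := F) x)) := by
    intro x i j
    rw [const_eq_pmap_toSpanSingleton v, ← cauchyCoeff_intertwine i1, hlam,
      cauchyCoeff_intertwine (i2 x), ← const_eq_pmap_toSpanSingleton x]
  have e2 : ∀ (x : M) (n k i j : ℤ), pmap (β x)
      (pw (lamAdd d) n k (cauchyCoeff (lamAdd d) i j (const (F := F) v))) =
      pmap (β.flip v)
        (cauchyCoeff (lam (F := F)) i j (pw (lam (F := F)) n k (const (F := F) x))) := by
    intro x n k i j
    rw [const_eq_pmap_toSpanSingleton v, ← cauchyCoeff_intertwine i1, ← pw_intertwine i1, hlam,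
      pw_intertwine (i2 x),
      cauchyCoeff_intertwine (i2 x), ← const_eq_pmap_toSpanSingleton x,
      cauchyCoeff_intertwine fun w => (pw_apply_comm (lam (F := F)) n k w).symm]
  rw [hCoeff, kCoeff₁, map_sub]
  congr 1
  · rw [map_finsum_of_finite _ (cauchyCoeff_left_finite (N := N) (lam (F := F)) p q
      (f := fun n => const (F := F) (a n)) fun n hn => by rw [ha n hn, map_zero]),
      ← finsum_comp_equiv (Equiv.subLeft p)]
    refine finsum_congr fun i => ?_
    rw [cauchyMul_constSeries, e1, Equiv.subLeft_apply, show p - (p - i) = i by ring]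
  · have hj : ∀ j, j ∉ Finset.Icc 0 (-p - 1) → cauchyCoeff (lam (F := F) (M := M)) p j = 0 := by
      intro j hj
      exact cauchyCoeff_eq_zero _ (by simpa using hj)
    have hn : ∀ n j, j ∈ Finset.Icc 0 (-p - 1) → n ∉ Finset.Icc (q + p + 1) N →
        powCoeff (lam (F := F) (M := M)) n (q - j) (const (F := F) (a n)) = 0 := by
      intro n j hj hn
      rw [Finset.mem_Icc] at hj hn
      rcases lt_or_ge N n with h | h
      · rw [ha n h, map_zero, map_zero]
      · rw [powCoeff_eq_zero_of_lt _ (by omega), LinearMap.zero_apply]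
    have l1 : ∀ n, pmap (β (a n)) (∑ᶠ j : ℤ, powCoeff (lamAdd d) n j
        (cauchyAdj d (constSeries v) p (q - j))) = ∑ j ∈ Finset.Icc 0 (-p - 1),
          pmap (β.flip v) (cauchyCoeff (lam (F := F)) p j
            (powCoeff (lam (F := F)) n (q - j) (const (F := F) (a n)))) := by
      intro n
      have h1 : ∑ᶠ j : ℤ, powCoeff (lamAdd d) n j (cauchyAdj d (constSeries v) p (q - j)) =
          ∑ᶠ j : ℤ, powCoeff (lamAdd d) n (q - j)
            (cauchyCoeff (lamAdd d) p j (const (F := F) v)) := by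
        rw [← finsum_comp_equiv (Equiv.subLeft q)]
        refine finsum_congr fun i => ?_
        rw [cauchyAdj_constSeries, Equiv.subLeft_apply, show q - (q - i) = i by ring]
      rw [h1, finsum_eq_sum_of_support_subset (s := Finset.Icc 0 (-p - 1)), map_sum]
      · exact Finset.sum_congr rfl fun j _ => e2 (a n) n (q - j) p j
      · intro j hj'
        by_contra h
        refine hj' ?_
        beta_reduce
        rw [cauchyCoeff_eq_zero _ (by simpa using h), LinearMap.zero_apply, map_zero]
    have l2 : ∀ j ∈ Finset.Icc 0 (-p - 1), shiftCoeff F a (q - j) =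
        ∑ n ∈ Finset.Icc (q + p + 1) N,
          powCoeff (lam (F := F)) n (q - j) (const (F := F) (a n)) := by
      intro j hj
      refine finsum_eq_sum_of_support_subset _ fun n hn' => ?_
      by_contra h
      exact hn' (hn n j hj h)
    rw [finsum_congr l1, finsum_eq_sum_of_support_subset (s := Finset.Icc (q + p + 1) N),
      finsum_eq_sum_of_support_subset (s := Finset.Icc 0 (-p - 1)), map_sum, Finset.sum_comm]
    · refine Finset.sum_congr rfl fun j hj => ?_
      rw [l2 j hj, map_sum, map_sum]
    · intro j hj'
      by_contra h
      refine hj' ?_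
      beta_reduce
      rw [hj j h, LinearMap.zero_apply]
    · intro n hn'
      by_contra h
      exact hn' (Finset.sum_eq_zero fun j hj => by rw [hn n j hj h, map_zero, map_zero])

/-- The coefficients commute with maps that respect the products and the derivations. -/
theorem hCoeff_natural {M' P' Q' : Type*} [AddCommGroup M'] [Module F M'] [AddCommGroup P']
    [Module F P'] [AddCommGroup Q'] [Module F Q'] {d : Module.End F P} {d' : Module.End F P'}
    {β : M →ₗ[F] P →ₗ[F] Q} {β' : M' →ₗ[F] P' →ₗ[F] Q'} {f : Q →ₗ[F] Q'} {g : M →ₗ[F] M'}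
    {g' : P →ₗ[F] P'} (hf : ∀ x y, f (β x y) = β' (g x) (g' y)) (hd : ∀ y, g' (d y) = d' (g' y))
    {N : ℤ} {a : ℤ → M} {b : ℤ → P} (ha : ∀ n, N < n → a n = 0) (hb : ∀ n, N < n → b n = 0)
    (p q : ℤ) :
    pmap f (hCoeff d β a b p q) = hCoeff d' β' (fun n => g (a n)) (fun n => g' (b n)) p q := by
  rw [hCoeff_eq_sum d β ha hb (Finset.Subset.refl _) (Finset.Subset.refl _),
    hCoeff_eq_sum d' β' (N := N) (fun n hn => by rw [ha n hn, map_zero])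
      (fun n hn => by rw [hb n hn, map_zero]) (Finset.Subset.refl _) (Finset.Subset.refl _)]
  simp only [map_sum]
  refine Finset.sum_congr rfl fun n _ => Finset.sum_congr rfl fun m _ => ?_
  have h : f ∘ₗ β (a n) = β' (g (a n)) ∘ₗ g' := LinearMap.ext (hf (a n))
  rw [pmap_pmap, h, ← pmap_pmap, pmap_adlerCoeff_const hd]

theorem kCoeff₁_eq_hCoeff {N : ℤ} {a : ℤ → M} (ha : ∀ n, N < n → a n = 0) (p q : ℤ) :
    kCoeff₁ F a p q = hCoeff (0 : Module.End F F) (LinearMap.lsmul F M).flip a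
      (constSeries (1 : F)) p q := by
  have h : (LinearMap.lsmul F M).flip.flip 1 = LinearMap.id := by
    ext
    simp
  rw [hCoeff_constSeries_right 0 _ rfl ha, h, pmap_id]

theorem kCoeff₂_eq_hCoeff (d : Module.End F M) (a : ℤ → M) (p q : ℤ) :
    kCoeff₂ d a p q =
      hCoeff d (LinearMap.lsmul F M) (constSeries (1 : F)) a p q := by
  have h : (LinearMap.lsmul F M) 1 = LinearMap.id := by
    ext
    simp
  rw [hCoeff_constSeries_left, h, pmap_id]

theorem kCoeff₁_natural (g : M →ₗ[F] Q) {N : ℤ} {a : ℤ → M} (ha : ∀ n, N < n → a n = 0)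
    (hN : 0 ≤ N) (p q : ℤ) : pmap g (kCoeff₁ F a p q) = kCoeff₁ F (fun n => g (a n)) p q := by
  rw [kCoeff₁_eq_hCoeff ha,
    kCoeff₁_eq_hCoeff (a := fun n => g (a n)) (fun n hn => by rw [ha n hn, map_zero])]
  have hβ : ∀ (x : M) (y : F), g ((LinearMap.lsmul F M).flip x y) =
      (LinearMap.lsmul F Q).flip (g x) (LinearMap.id (R := F) y) := fun x y => by simp
  exact hCoeff_natural (d := (0 : Module.End F F)) (d' := 0) hβ (fun _ => rfl) ha
    (b := constSeries (1 : F)) (fun n hn => constSeries_of_ne _ (by omega)) p q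

theorem kCoeff₂_natural {d : Module.End F M} {d' : Module.End F Q} {g : M →ₗ[F] Q}
    (hg : ∀ x, g (d x) = d' (g x)) {N : ℤ} {a : ℤ → M} (ha : ∀ n, N < n → a n = 0)
    (hN : 0 ≤ N) (p q : ℤ) : pmap g (kCoeff₂ d a p q) = kCoeff₂ d' (fun n => g (a n)) p q := by
  rw [kCoeff₂_eq_hCoeff, kCoeff₂_eq_hCoeff]
  have hβ : ∀ (x : F) (y : M), g (LinearMap.lsmul F M x y) =
      LinearMap.lsmul F Q (LinearMap.id (R := F) x) (g y) := fun x y => by simp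
  exact hCoeff_natural hβ hg (a := constSeries (1 : F))
    (fun n hn => constSeries_of_ne _ (by omega)) ha p q

/-- Shifting `a(z)` by a constant `ε v` with `∂v = 0` changes the series that defines `H` by `ε`
times the one that defines `K`.  There is no term with `ε²`, since both halves of the latter vanish
on constant series. -/
theorem hCoeff_add_smul (d : Module.End F P) (β : P →ₗ[F] P →ₗ[F] Q) {v : P} (hv : d v = 0)
    {N : ℤ} (hN : 0 ≤ N) {a : ℤ → P} (ha : ∀ n, N < n → a n = 0) (ε : F) (p q : ℤ) :
    hCoeff d β (fun n => a n + ε • constSeries v n) (fun n => a n + ε • constSeries v n) p q =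
      hCoeff d β a a p q + ε • (pmap (β.flip v) (kCoeff₁ F a p q) +
        pmap (β v) (kCoeff₂ d a p q)) := by
  have hc : ∀ n, N < n → constSeries v n = 0 := fun n hn => constSeries_of_ne v (by omega)
  have h0 : hCoeff d β (constSeries v) (constSeries v) p q = 0 := by
    rw [hCoeff_constSeries_left, kCoeff₂_constSeries, map_zero]
  have ha' : ∀ n, N < n → a n + ε • constSeries v n = 0 := fun n hn => by
    rw [ha n hn, hc n hn, smul_zero, add_zero]
  have r := Finset.Subset.refl (Finset.Icc (p + q + 1 - N) N)
  rw [← hCoeff_constSeries_left, ← hCoeff_constSeries_right d β hv ha,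
    ← add_zero (hCoeff d β a (constSeries v) p q + _), ← smul_zero ε, ← h0,
    hCoeff_eq_sum d β ha' ha' r r, hCoeff_eq_sum d β ha ha r r, hCoeff_eq_sum d β ha hc r r,
    hCoeff_eq_sum d β hc ha r r, hCoeff_eq_sum d β hc hc r r]
  simp only [map_add, map_smul, LinearMap.add_apply, LinearMap.smul_apply, Finset.sum_add_distrib,
    ← Finset.smul_sum, smul_add]
  abel

end KCoeff

/-! ### Linear combinations of brackets -/

section Pencil

variable {F : Type*} [Field F] [CharZero F]

/-- A quadratic polynomial that vanishes identically has zero coefficients. -/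
theorem quadratic_form_eq_zero {W : Type*} [AddCommGroup W] [Module F W] {x y z : W}
    (h : ∀ ε : F, x + ε • y + (ε * ε) • z = 0) (α β : F) :
    (α * α) • x + (α * β) • y + (β * β) • z = 0 := by
  have h0 : x = 0 := by simpa using h 0
  have h1 : y + z = 0 := by simpa [h0] using h 1
  have h2 : -y + z = 0 := by simpa [h0] using h (-1)
  have hz : (2 : F) • z = 0 := by
    rw [two_smul, ← add_zero (0 : W), ← congrArg₂ (· + ·) h1 h2]
    abel
  have hz' : z = 0 := (smul_eq_zero.1 hz).resolve_left two_ne_zero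
  have hy : y = 0 := by simpa [hz'] using h1
  simp [h0, hy, hz']

/-- The Jacobi identity is quadratic in the bracket, so it holds for all linear combinations of two
brackets if it holds for the combinations in which the first coefficient is `1`. -/
theorem jacobi_pencil {V W : Type*} [AddCommGroup V] [Module F V] [AddCommGroup W] [Module F W]
    {L R T : F → F → V →ₗ[F] LamPoly W} {bc ac ab : F → F → LamPoly V}
    (hL : ∀ α β v, L α β v = α • L 1 0 v + β • L 0 1 v)
    (hR : ∀ α β v, R α β v = α • R 1 0 v + β • R 0 1 v)
    (hT : ∀ α β v, T α β v = α • T 1 0 v + β • T 0 1 v)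
    (hbc : ∀ α β, bc α β = α • bc 1 0 + β • bc 0 1)
    (hac : ∀ α β, ac α β = α • ac 1 0 + β • ac 0 1)
    (hab : ∀ α β, ab α β = α • ab 1 0 + β • ab 0 1)
    (h : ∀ ε, pmap (L 1 ε) (bc 1 ε) - swapVars (F := F) (pmap (R 1 ε) (ac 1 ε)) -
      nest (T 1 ε) (ab 1 ε) = 0) (α β : F) :
    pmap (L α β) (bc α β) - swapVars (F := F) (pmap (R α β) (ac α β)) -
      nest (T α β) (ab α β) = 0 := by
  let J : F → F → F → F → LamPoly₂ W := fun α β γ δ =>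
    pmap (L α β) (bc γ δ) - swapVars (F := F) (pmap (R α β) (ac γ δ)) - nest (T α β) (ab γ δ)
  have key : ∀ α β, pmap (L α β) (bc α β) - swapVars (F := F) (pmap (R α β) (ac α β)) -
      nest (T α β) (ab α β) =
      (α * α) • J 1 0 1 0 + (α * β) • (J 1 0 0 1 + J 0 1 1 0) + (β * β) • J 0 1 0 1 := by
    intro α β
    have eL : L α β = α • L 1 0 + β • L 0 1 := LinearMap.ext (hL α β)
    have eR : R α β = α • R 1 0 + β • R 0 1 := LinearMap.ext (hR α β)
    have eT : nest (T α β) (ab α β) = α • nest (T 1 0) (ab α β) + β • nest (T 0 1) (ab α β) := by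
      have : T α β = α • T 1 0 + β • T 0 1 := LinearMap.ext (hT α β)
      rw [this, nest_add, nest_smul, nest_smul]
    rw [eT, eL, eR, hbc α β, hac α β, hab α β]
    simp only [J, map_add, map_smul, LinearMap.add_apply, LinearMap.smul_apply, smul_add, smul_sub,
      smul_smul, mul_comm β α]
    abel
  rw [key]
  refine quadratic_form_eq_zero (fun ε => ?_) α β
  have := h ε
  rw [key] at this
  simpa using this

end Pencil

section Double

variable {F : Type*} [Field F] {A : Type*} [Ring A] [Algebra F A]

/-- A pencil of double PVA structures that contains all `H + εK` consists of double PVA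
structures. -/
theorem IsDoublePVA.lin_comb [CharZero F] {d : NCDerivation F A} {H K : DoubleBracket F A}
    (h : ∀ ε : F, IsDoublePVA d (H + ε • K)) (α β : F) : IsDoublePVA d (α • H + β • K) := by
  have hH : IsDoublePVA d H := by simpa using h 0
  have hHK : IsDoublePVA d (H + (1 : F) • K) := h 1
  -- the conditions linear in the bracket are inherited from `H` and `H + K`
  have e : α • H + β • K = (α - β) • H + β • (H + (1 : F) • K) :=
    LinearMap.ext fun a => LinearMap.ext fun b => by
      simp only [LinearMap.add_apply, LinearMap.smul_apply, one_smul, smul_add, sub_smul]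
      abel
  have hB : IsTwoFoldBracket d (α • H + β • K) := by
    rw [e, isTwoFoldBracket_iff]
    exact ((isTwoFoldBracket_iff d H).1 hH.toIsTwoFoldBracket).lin_comb
      ((isTwoFoldBracket_iff d _).1 hHK.toIsTwoFoldBracket) _ _
  refine ⟨hB, fun a b => ?_, fun a b c => sub_eq_zero.1 ?_⟩
  · have h1 := hH.skew a b
    have h2 := hHK.skew a b
    rw [e]
    generalize H + (1 : F) • K = B at *
    simp only [LinearMap.add_apply, LinearMap.smul_apply, map_add, map_smul, neg_add, ← smul_neg]
    rw [← h1, ← h2]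
  · refine jacobi_pencil (L := fun α β => brL (α • H + β • K) a)
      (R := fun α β => brR (α • H + β • K) b) (T := fun α β => brFstL d (α • H + β • K) c)
      (bc := fun α β => (α • H + β • K) b c) (ac := fun α β => (α • H + β • K) a c)
      (ab := fun α β => (α • H + β • K) a b)
      (fun α β v => ?_) (fun α β v => ?_) (fun α β v => ?_) (fun α β => ?_) (fun α β => ?_)
      (fun α β => ?_) (fun ε => ?_) α β
    · induction v with
      | zero => simp only [map_zero, smul_zero, add_zero]
      | add v w hv hw =>
        rw [map_add, map_add, map_add, hv, hw, smul_add, smul_add]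
        abel
      | tmul x y => simp [brL_tmul]
    · induction v with
      | zero => simp only [map_zero, smul_zero, add_zero]
      | add v w hv hw =>
        rw [map_add, map_add, map_add, hv, hw, smul_add, smul_add]
        abel
      | tmul x y => simp [brR_tmul]
    · induction v with
      | zero => simp only [map_zero, smul_zero, add_zero]
      | add v w hv hw =>
        rw [map_add, map_add, map_add, hv, hw, smul_add, smul_add]
        abel
      | tmul x y => simp [brFstL_tmul]
    · simp
    · simp
    · simp
    · have := h ε
      rw [← one_smul F H] at this
      exact sub_eq_zero.2 (this.jacobi a b c)

end Double

/-! ### Brackets on the coefficients of `L(z)` -/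

section Vanishing

variable {F : Type*} [Field F]
variable {M P Q : Type*} [AddCommGroup M] [Module F M] [AddCommGroup P] [Module F P]
  [AddCommGroup Q] [Module F Q]

/-- If `a(z)` and `b(z)` have degree at most `N ≥ 0`, then the bracket has degree less than `N` in
`z` and in `w`. -/
theorem hCoeff_eq_zero_of_le (d : Module.End F P) (β : M →ₗ[F] P →ₗ[F] Q) {N : ℤ} {a : ℤ → M}
    {b : ℤ → P} (ha : ∀ n, N < n → a n = 0) (hb : ∀ n, N < n → b n = 0) (hN : 0 ≤ N) {p q : ℤ}
    (h : N ≤ p ∨ N ≤ q) : hCoeff d β a b p q = 0 := by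
  rw [hCoeff_eq_sum d β ha hb (Finset.Subset.refl _) (Finset.Subset.refl _)]
  refine Finset.sum_eq_zero fun n hn => Finset.sum_eq_zero fun m hm => ?_
  rw [Finset.mem_Icc] at hn hm
  have : adlerCoeff (lamAdd d) p q n m = 0 := by
    rcases h with h | h
    · exact adlerCoeff_eq_zero_of_le_left _ (by omega) (by omega) (by omega)
    · rw [adlerCoeff_skew_of_ring,
        adlerCoeff_eq_zero_of_le_left _ (by omega) (by omega) (by omega), neg_zero]
  rw [this, LinearMap.zero_apply, map_zero]

/-- If `a(z)` and `b(z)` are polynomials, then so is the bracket. -/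
theorem hCoeff_eq_zero_of_neg (d : Module.End F P) (β : M →ₗ[F] P →ₗ[F] Q) {N : ℤ} {a : ℤ → M}
    {b : ℤ → P} (ha : ∀ n, N < n → a n = 0) (hb : ∀ n, N < n → b n = 0)
    (ha' : ∀ n, n < 0 → a n = 0) (hb' : ∀ n, n < 0 → b n = 0) {p q : ℤ}
    (h : p < 0 ∨ q < 0) : hCoeff d β a b p q = 0 := by
  rw [hCoeff_eq_sum d β ha hb (Finset.Subset.refl _) (Finset.Subset.refl _)]
  refine Finset.sum_eq_zero fun n _ => Finset.sum_eq_zero fun m _ => ?_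
  by_cases hn : n < 0
  · rw [ha' n hn, map_zero, map_zero, LinearMap.zero_apply]
  by_cases hm : m < 0
  · rw [hb' m hm, map_zero, map_zero, map_zero]
  rw [adlerCoeff_eq_zero_of_neg _ (not_lt.1 hn) (not_lt.1 hm) h, LinearMap.zero_apply, map_zero]

variable {S : Set ℤ} {N : ℕ}

/-- If `a(z)` and `b(z)` involve only `z^N` and the powers `z^{-i-1}`, `i ∈ I`, then the bracket
involves only the powers `z^{-i-1} w^{-j-1}` with `i, j ∈ I`. -/
theorem hCoeff_eq_zero_of_notMem (hS : S = Set.Ici (-(N : ℤ)) ∨ S = Set.Ico (-(N : ℤ)) 0)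
    (d : Module.End F P) (β : M →ₗ[F] P →ₗ[F] Q) {a : ℤ → M} {b : ℤ → P}
    (ha : ∀ n : ℤ, n ≠ N → -n - 1 ∉ S → a n = 0) (hb : ∀ n : ℤ, n ≠ N → -n - 1 ∉ S → b n = 0)
    {p q : ℤ} (h : -p - 1 ∉ S ∨ -q - 1 ∉ S) : hCoeff d β a b p q = 0 := by
  have hlt : ∀ n : ℤ, (N : ℤ) < n → n ≠ N ∧ -n - 1 ∉ S := by
    intro n hn
    rcases hS with rfl | rfl
    · exact ⟨by omega, by rw [Set.mem_Ici]; omega⟩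
    · exact ⟨by omega, by rw [Set.mem_Ico]; omega⟩
  have ha₁ : ∀ n : ℤ, (N : ℤ) < n → a n = 0 := fun n hn => ha n (hlt n hn).1 (hlt n hn).2
  have hb₁ : ∀ n : ℤ, (N : ℤ) < n → b n = 0 := fun n hn => hb n (hlt n hn).1 (hlt n hn).2
  rcases hS with rfl | rfl
  · refine hCoeff_eq_zero_of_le d β ha₁ hb₁ (by omega) ?_
    simp only [Set.mem_Ici] at h
    omega
  · have hneg : ∀ n : ℤ, n < 0 → n ≠ N ∧ -n - 1 ∉ Set.Ico (-(N : ℤ)) 0 := fun n hn =>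
      ⟨by omega, by rw [Set.mem_Ico]; omega⟩
    by_cases hp : (N : ℤ) ≤ p ∨ (N : ℤ) ≤ q
    · exact hCoeff_eq_zero_of_le d β ha₁ hb₁ (by omega) hp
    · refine hCoeff_eq_zero_of_neg d β ha₁ hb₁ (fun n hn => ha n (hneg n hn).1 (hneg n hn).2)
        (fun n hn => hb n (hneg n hn).1 (hneg n hn).2) ?_
      simp only [Set.mem_Ico] at h
      omega

end Vanishing

section Generic

variable {F : Type*} [Field F] {S : Set ℤ} {N : ℕ}

theorem neg_sub_one_notMem (hS : S = Set.Ici (-(N : ℤ)) ∨ S = Set.Ico (-(N : ℤ)) 0) {n : ℤ}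
    (hn : (N : ℤ) ≤ n) : -n - 1 ∉ S := by
  rcases hS with rfl | rfl
  · rw [Set.mem_Ici]; omega
  · rw [Set.mem_Ico]; omega

theorem Lc_self : Lc F S N N = 1 := if_pos rfl

theorem Lc_eq_zero {n : ℤ} (hn : n ≠ N) (h : -n - 1 ∉ S) : Lc F S N n = 0 := by
  rw [Lc, if_neg hn, dif_neg h]

theorem Lc_mem (hS : S = Set.Ici (-(N : ℤ)) ∨ S = Set.Ico (-(N : ℤ)) 0) (i : S) :
    Lc F S N (-i - 1) = FreeAlgebra.ι F (i, 0) := by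
  have hi : -(-(i : ℤ) - 1) - 1 = i := by ring
  have hne : -(i : ℤ) - 1 ≠ N := by
    intro h
    have := neg_sub_one_notMem hS h.ge
    rw [hi] at this
    exact this i.2
  rw [Lc, if_neg hne, dif_pos (by rw [hi]; exact i.2)]
  congr 2
  exact Subtype.ext hi

theorem Lc_of_lt (hS : S = Set.Ici (-(N : ℤ)) ∨ S = Set.Ico (-(N : ℤ)) 0) (n : ℤ)
    (hn : (N : ℤ) < n) : Lc F S N n = 0 :=
  Lc_eq_zero hn.ne' (neg_sub_one_notMem hS hn.le)

theorem constSeries_eq_zero {M : Type*} [AddCommGroup M]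
    (hS : S = Set.Ici (-(N : ℤ)) ∨ S = Set.Ico (-(N : ℤ)) 0) (v : M) (n : ℤ)
    (hn : n ≠ N) (h : -n - 1 ∉ S) : constSeries v n = 0 := by
  refine constSeries_of_ne v ?_
  rintro rfl
  rcases hS with rfl | rfl
  · rw [Set.mem_Ici] at h; omega
  · rw [Set.mem_Ico] at h; omega

/-- The coefficients of `L(z) + ε`, for a constant `ε`, are differential generators, since
`∂ε = 0`. -/
theorem diffGeneratedBy_Lc (hS : S = Set.Ici (-(N : ℤ)) ∨ S = Set.Ico (-(N : ℤ)) 0) (ε : F) :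
    DiffGeneratedBy (diffD F S).toEnd
      (Set.range fun n => Lc F S N n + ε • constSeries (1 : DiffPoly F S) n) := by
  have h := diffGeneratedBy_ι F S
  rw [DiffGeneratedBy, eq_top_iff] at h ⊢
  refine h.trans (Algebra.adjoin_le ?_)
  rintro _ ⟨_, ⟨i, rfl⟩, n, rfl⟩
  set T := Algebra.adjoin F {a | ∃ g ∈ Set.range fun n => Lc F S N n +
    ε • constSeries (1 : DiffPoly F S) n, ∃ n : ℕ, a = ((diffD F S).toEnd ^ n) g} with hT
  have h1 : ((diffD F S).toEnd ^ n) (Lc F S N (-i - 1) +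
      ε • constSeries (1 : DiffPoly F S) (-i - 1)) ∈ T :=
    Algebra.subset_adjoin ⟨_, ⟨_, rfl⟩, n, rfl⟩
  have h2 : ((diffD F S).toEnd ^ n) (ε • constSeries (1 : DiffPoly F S) (-i - 1)) ∈ T := by
    rw [map_smul]
    refine T.smul_mem ?_ ε
    rcases n with _ | n
    · rw [constSeries]
      split_ifs
      · exact T.one_mem
      · exact T.zero_mem
    · have : (diffD F S).toEnd (constSeries (1 : DiffPoly F S) (-i - 1)) = 0 := by
        rw [constSeries]
        split_ifs
        · exact (diffD F S).map_one
        · exact map_zero _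
      rw [pow_succ, Module.End.mul_apply, this, map_zero]
      exact T.zero_mem
  have h3 := T.sub_mem h1 h2
  rw [← map_sub, add_sub_cancel_right, Lc_mem hS] at h3
  exact h3

theorem diffGeneratedBy_range_Lc (hS : S = Set.Ici (-(N : ℤ)) ∨ S = Set.Ico (-(N : ℤ)) 0) :
    DiffGeneratedBy (diffD F S).toEnd (Set.range (Lc F S N)) := by
  simpa using diffGeneratedBy_Lc (F := F) hS 0

/-- A 2-fold bracket can be prescribed on the coefficients of `L(z)`, as long as the prescribed
values vanish on the coefficients that are constants. -/
theorem exists_twoFoldBracket (hS : S = Set.Ici (-(N : ℤ)) ∨ S = Set.Ico (-(N : ℤ)) 0)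
    (C : ℤ → ℤ → LamPoly (DiffPoly F S ⊗[F] DiffPoly F S))
    (hC : ∀ p q, (-p - 1 ∉ S ∨ -q - 1 ∉ S) → C p q = 0) :
    ∃ B : DoubleBracket F (DiffPoly F S), IsTwoFoldBracket (diffD F S) B ∧
      ∀ p q, B (Lc F S N p) (Lc F S N q) = C p q := by
  obtain ⟨B, hB, hv⟩ := (doubleData (diffD F S)).exists_isBracket (FreeAlgebra.ι F)
    (FreeAlgebra.adjoin_range_ι F _) (fun x n => diffD_ι F S x n)
    (FreeAlgebra.extendsDerivations (doubleData (diffD F S)).coeff_isBimodule)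
    (FreeAlgebra.extendsDerivations (doubleData (diffD F S)).arrow_isBimodule.postcomp)
    (fun i j => C (-i - 1) (-j - 1))
  refine ⟨B, (isTwoFoldBracket_iff _ _).2 hB, fun p q => ?_⟩
  by_cases h : -p - 1 ∉ S ∨ -q - 1 ∉ S
  · rw [hC p q h]
    have hz : ∀ n : ℤ, -n - 1 ∉ S → Lc F S N n = 1 ∨ Lc F S N n = 0 := by
      intro n hn
      by_cases h' : n = N
      · rw [h']
        exact Or.inl Lc_self
      · exact Or.inr (Lc_eq_zero h' hn)
    rcases h with h | h <;> rcases hz _ h with h' | h' <;> rw [h']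
    · exact hB.one_left _
    · rw [map_zero]
      rfl
    · exact hB.one_right _
    · rw [map_zero]
  · rw [not_or, not_not, not_not] at h
    have e : ∀ n : ℤ, n = -(-n - 1) - 1 := fun n => by ring
    have h1 := Lc_mem (F := F) hS ⟨_, h.1⟩
    have h2 := Lc_mem (F := F) hS ⟨_, h.2⟩
    have h3 := hv ⟨_, h.1⟩ ⟨_, h.2⟩
    rw [← h1, ← h2] at h3
    simpa only [← e] using h3

end Generic

/-! ### The brackets `H`, `K` and the brackets induced by them -/

section Brackets

variable {F : Type*} [Field F] {S : Set ℤ} {N : ℕ}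

theorem exists_isH (hS : S = Set.Ici (-(N : ℤ)) ∨ S = Set.Ico (-(N : ℤ)) 0) :
    ∃ H : DoubleBracket F (DiffPoly F S), IsTwoFoldBracket (diffD F S) H ∧ IsH F S N H :=
  exists_twoFoldBracket hS _ fun _ _ h => hCoeff_eq_zero_of_notMem hS _ _
    (fun _ hn h => Lc_eq_zero hn h) (fun _ hn h => Lc_eq_zero hn h) h

theorem exists_isK (hS : S = Set.Ici (-(N : ℤ)) ∨ S = Set.Ico (-(N : ℤ)) 0) :
    ∃ K : DoubleBracket F (DiffPoly F S), IsTwoFoldBracket (diffD F S) K ∧ IsK F S N K := by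
  refine exists_twoFoldBracket hS _ fun p q h => ?_
  have hL : ∀ n : ℤ, n ≠ N → -n - 1 ∉ S → Lc F S N n = 0 := fun n hn h => Lc_eq_zero hn h
  rw [kCoeff₁_eq_hCoeff (Lc_of_lt hS), kCoeff₂_eq_hCoeff,
    hCoeff_eq_zero_of_notMem hS _ _ hL (constSeries_eq_zero hS _) h,
    hCoeff_eq_zero_of_notMem hS _ _ (constSeries_eq_zero hS _) hL h, map_zero, map_zero, add_zero]

theorem IsTwoFoldBracket.ext_Lc (hS : S = Set.Ici (-(N : ℤ)) ∨ S = Set.Ico (-(N : ℤ)) 0)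
    {B B' : DoubleBracket F (DiffPoly F S)} (hB : IsTwoFoldBracket (diffD F S) B)
    (hB' : IsTwoFoldBracket (diffD F S) B')
    (h : ∀ p q, B (Lc F S N p) (Lc F S N q) = B' (Lc F S N p) (Lc F S N q)) : B = B' := by
  have hG : DiffGeneratedBy (doubleData (diffD F S)).d (Set.range (Lc F S N)) :=
    diffGeneratedBy_range_Lc hS
  refine LeibnizData.IsBracket.ext hG ((isTwoFoldBracket_iff _ _).1 hB)
    ((isTwoFoldBracket_iff _ _).1 hB') ?_
  rintro _ ⟨p, rfl⟩ _ ⟨q, rfl⟩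
  exact h p q

/-- The bracket `H + εK` is a double PVA structure, since it is given on the coefficients of
`L(z) + ε` by the series that defines `H`. -/
theorem isDoublePVA_add_smul (hS : S = Set.Ici (-(N : ℤ)) ∨ S = Set.Ico (-(N : ℤ)) 0)
    {H K : DoubleBracket F (DiffPoly F S)} (hH : IsTwoFoldBracket (diffD F S) H)
    (hK : IsTwoFoldBracket (diffD F S) K) (hH' : IsH F S N H) (hK' : IsK F S N K) (ε : F) :
    IsDoublePVA (diffD F S) (H + ε • K) := by
  have hB : (doubleData (diffD F S)).IsBracket (H + ε • K) := by
    have := ((isTwoFoldBracket_iff _ _).1 hH).lin_comb ((isTwoFoldBracket_iff _ _).1 hK) 1 ε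
    rwa [one_smul] at this
  have hB' := (isTwoFoldBracket_iff _ _).2 hB
  have ha : ∀ n : ℤ, (N : ℤ) < n →
      Lc F S N n + ε • constSeries (1 : DiffPoly F S) n = 0 := fun n hn => by
    rw [Lc_of_lt hS n hn, constSeries_of_ne _ (by omega), smul_zero, add_zero]
  -- the bracket of a constant with anything is zero, so the shift does not affect the left side
  have hc₁ : ∀ n x, (H + ε • K) (ε • constSeries (1 : DiffPoly F S) n) x = 0 := fun n x => by
    rw [map_smul, LinearMap.smul_apply, constSeries]
    split_ifs
    · rw [hB.one_left, smul_zero]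
    · rw [map_zero, LinearMap.zero_apply, smul_zero]
  have hc₂ : ∀ n x, (H + ε • K) x (ε • constSeries (1 : DiffPoly F S) n) = 0 := fun n x => by
    rw [map_smul, constSeries]
    split_ifs
    · rw [hB.one_right, smul_zero]
    · rw [map_zero, smul_zero]
  have h : ∀ p q, (H + ε • K) (Lc F S N p + ε • constSeries (1 : DiffPoly F S) p)
      (Lc F S N q + ε • constSeries (1 : DiffPoly F S) q) =
      hCoeff (diffD F S).toEnd (TensorProduct.mk F (DiffPoly F S) (DiffPoly F S))
        (fun n => Lc F S N n + ε • constSeries (1 : DiffPoly F S) n)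
        (fun n => Lc F S N n + ε • constSeries (1 : DiffPoly F S) n) p q := fun p q => by
    rw [map_add ((H + ε • K) _), hc₂, add_zero, map_add (H + ε • K),
      LinearMap.add_apply ((H + ε • K) _), hc₁, add_zero,
      hCoeff_add_smul _ _ (diffD F S).map_one (by omega) (Lc_of_lt hS), LinearMap.add_apply,
      LinearMap.add_apply, LinearMap.smul_apply, LinearMap.smul_apply, hH' p q, hK' p q]
  refine hB'.isDoublePVA (diffGeneratedBy_Lc hS ε) ?_ ?_
  · rintro _ ⟨p, rfl⟩ _ ⟨q, rfl⟩
    rw [h, h]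
    exact hCoeff_mk_skew ha p q
  · rintro _ ⟨p, rfl⟩ _ ⟨q, rfl⟩ _ ⟨r, rfl⟩
    exact doubleJacobi_hCoeff hB' (by omega) ha h p q r

variable {m : ℕ}

theorem coord_Lc (a b : Fin m) : (fun n => coord (F := F) a b (Lc F S N n)) = Lmc F S N m a b := by
  funext n
  rw [Lc, Lmc]
  split_ifs with h1 h2
  · rw [coord_one, if_pos h2]
  · rw [coord_one, if_neg h2]
  · rfl
  · rw [map_zero]

theorem IsInduced.apply_Lmc {B : DoubleBracket F (DiffPoly F S)}
    {Bm : LambdaBracket F (RepAlg F (DiffPoly F S) m)} (h : IsInduced B Bm) (a b c d : Fin m)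
    (p q : ℤ) : Bm (Lmc F S N m a b p) (Lmc F S N m c d q) =
      pmap (inducedMap a b c d) (B (Lc F S N p) (Lc F S N q)) := by
  rw [← h, ← congrFun (coord_Lc a b) p, ← congrFun (coord_Lc c d) q]

theorem IsH.isHm (hS : S = Set.Ici (-(N : ℤ)) ∨ S = Set.Ico (-(N : ℤ)) 0)
    {B : DoubleBracket F (DiffPoly F S)} (hB : IsH F S N B)
    {Bm : LambdaBracket F (RepAlg F (DiffPoly F S) m)} (h : IsInduced B Bm) :
    IsHm F S N m Bm := by
  intro a b c d p q
  rw [h.apply_Lmc, hB, hCoeff_natural (d' := (repD (diffD F S)).toLinearMap)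
    (β' := LinearMap.mul F (RepAlg F (DiffPoly F S) m)) (g := coord c b) (g' := coord a d)
    (fun x y => inducedMap_tmul a b c d x y) (fun y => (repD_coord (diffD F S) a d y).symm)
    (Lc_of_lt hS) (Lc_of_lt hS), coord_Lc, coord_Lc]

theorem IsK.isKm (hS : S = Set.Ici (-(N : ℤ)) ∨ S = Set.Ico (-(N : ℤ)) 0)
    {B : DoubleBracket F (DiffPoly F S)} (hB : IsK F S N B)
    {Bm : LambdaBracket F (RepAlg F (DiffPoly F S) m)} (h : IsInduced B Bm) :
    IsKm F S N m Bm := by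
  intro a b c d p q
  have h1 : inducedMap (F := F) a b c d ∘ₗ
      (TensorProduct.mk F (DiffPoly F S) (DiffPoly F S)).flip 1 =
      (if a = d then (1 : F) else 0) • coord c b := LinearMap.ext fun x => by
    change coord c b x * coord a d 1 = _
    rw [coord_one]
    split_ifs <;> simp
  have h2 : inducedMap (F := F) a b c d ∘ₗ TensorProduct.mk F (DiffPoly F S) (DiffPoly F S) 1 =
      (if c = b then (1 : F) else 0) • coord a d := LinearMap.ext fun x => by
    change coord c b 1 * coord a d x = _
    rw [coord_one]
    split_ifs <;> simp
  have h3 := kCoeff₁_natural (coord (F := F) c b) (Lc_of_lt (F := F) hS) (by omega) p q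
  have h4 := kCoeff₂_natural (d' := (repD (diffD F S)).toLinearMap) (g := coord (F := F) a d)
    (fun y => (repD_coord (diffD F S) a d y).symm) (Lc_of_lt (F := F) hS) (by omega) p q
  rw [coord_Lc] at h3 h4
  rw [h.apply_Lmc, hB, map_add, pmap_pmap, pmap_pmap, h1, h2, map_smul, map_smul,
    LinearMap.smul_apply, LinearMap.smul_apply, h3, h4]
  split_ifs <;> simp only [one_smul, zero_smul]

theorem IsLambdaBracket.ext_Lmc (hS : S = Set.Ici (-(N : ℤ)) ∨ S = Set.Ico (-(N : ℤ)) 0)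
    {B B' : LambdaBracket F (RepAlg F (DiffPoly F S) m)}
    (hB : IsLambdaBracket (repD (diffD F S)) B) (hB' : IsLambdaBracket (repD (diffD F S)) B')
    (h : ∀ a b c d p q, B (Lmc F S N m a b p) (Lmc F S N m c d q) =
      B' (Lmc F S N m a b p) (Lmc F S N m c d q)) : B = B' := by
  have hG : DiffGeneratedBy (commData (repD (m := m) (diffD F S))).d
      {x | ∃ (i j : Fin m) (a : DiffPoly F S), a ∈ Set.range (Lc F S N) ∧ x = coord i j a} :=
    diffGeneratedBy_coord (diffGeneratedBy_range_Lc hS)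
  refine LeibnizData.IsBracket.ext hG ((isLambdaBracket_iff _ _).1 hB)
    ((isLambdaBracket_iff _ _).1 hB') ?_
  rintro _ ⟨a, b, _, ⟨p, rfl⟩, rfl⟩ _ ⟨c, d, _, ⟨q, rfl⟩, rfl⟩
  have h1 := congrFun (coord_Lc (F := F) (S := S) (N := N) a b) p
  have h2 := congrFun (coord_Lc (F := F) (S := S) (N := N) c d) q
  beta_reduce at h1 h2
  rw [h1, h2]
  exact h a b c d p q

end Brackets

end DPVA

end

theorem mainTheorem5 {F : Type*} [Field F] [CharZero F] (N : ℕ) (S : Set ℤ)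
    (hS : S = Set.Ici (-(N : ℤ)) ∨ S = Set.Ico (-(N : ℤ)) 0) :
    ∃ H K : DPVA.DoubleBracket F (DPVA.DiffPoly F S),
      -- `H` and `K` are the 2-fold brackets given by the two generating series
      DPVA.IsH F S N H ∧ DPVA.IsK F S N K ∧
      (∀ B, DPVA.IsTwoFoldBracket (DPVA.diffD F S) B → DPVA.IsH F S N B → B = H) ∧
      (∀ B, DPVA.IsTwoFoldBracket (DPVA.diffD F S) B → DPVA.IsK F S N B → B = K) ∧
      DPVA.AreCompatibleDoublePVA (DPVA.diffD F S) H K ∧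
      ∀ m : ℕ, 1 ≤ m →
        -- `V_m` is the polynomial algebra in the `u_{i,ab}^{(n)}`
        Function.Bijective (DPVA.genericMap F S m) ∧
        ∃ Hm Km : DPVA.LambdaBracket F (DPVA.RepAlg F (DPVA.DiffPoly F S) m),
          DPVA.IsInduced H Hm ∧ DPVA.IsInduced K Km ∧
          DPVA.IsHm F S N m Hm ∧ DPVA.IsKm F S N m Km ∧
          (∀ B, DPVA.IsLambdaBracket (DPVA.repD (DPVA.diffD F S)) B →
            DPVA.IsHm F S N m B → B = Hm) ∧
          (∀ B, DPVA.IsLambdaBracket (DPVA.repD (DPVA.diffD F S)) B →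
            DPVA.IsKm F S N m B → B = Km) ∧
          DPVA.AreCompatiblePVA (DPVA.repD (DPVA.diffD F S)) Hm Km := by
  obtain ⟨H, hH, hH'⟩ := DPVA.exists_isH (F := F) hS
  obtain ⟨K, hK, hK'⟩ := DPVA.exists_isK (F := F) hS
  have hall : ∀ α β : F, DPVA.IsDoublePVA (DPVA.diffD F S) (α • H + β • K) :=
    DPVA.IsDoublePVA.lin_comb fun ε => DPVA.isDoublePVA_add_smul hS hH hK hH' hK' ε
  have hHP : DPVA.IsDoublePVA (DPVA.diffD F S) H := by simpa using hall 1 0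
  have hKP : DPVA.IsDoublePVA (DPVA.diffD F S) K := by simpa using hall 0 1
  refine ⟨H, K, hH', hK', fun B hB hB' => hB.ext_Lc hS hH fun p q => by rw [hB' p q, hH' p q],
    fun B hB hB' => hB.ext_Lc hS hK fun p q => by rw [hB' p q, hK' p q],
    ⟨hHP, hKP, hall⟩, fun m _ => ⟨DPVA.genericMap_bijective F S m, ?_⟩⟩
  obtain ⟨Hm, hHm, iH⟩ := DPVA.exists_isInduced F S m hH
  obtain ⟨Km, hKm, iK⟩ := DPVA.exists_isInduced F S m hK
  have hHm' := hH'.isHm hS iH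
  have hKm' := hK'.isKm hS iK
  refine ⟨Hm, Km, iH, iK, hHm', hKm',
    fun B hB hB' => hB.ext_Lmc hS hHm fun a b c d p q => by rw [hB' a b c d, hHm' a b c d],
    fun B hB hB' => hB.ext_Lmc hS hKm fun a b c d p q => by rw [hB' a b c d, hKm' a b c d],
    hHP.isPVA_of_isInduced hHm iH, hKP.isPVA_of_isInduced hKm iK, fun α β => ?_⟩
  refine (hall α β).isPVA_of_isInduced ?_ (iH.lin_comb iK α β)
  rw [DPVA.isLambdaBracket_iff] at hHm hKm ⊢
  exact hHm.lin_comb hKm α β
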